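/- Let $q\in\mathbb C$ with $0<|q|<1$, put $\Omega_q=\{q^{-k}:k=0,1,2,\dots\}$, $(x;q)_n=\prod_{j=0}^{n-1}(1-xq^j)$, $(x;q)_\infty=\prod_{j\ge 0}(1-xq^j)$, $(x_1,\dots,x_m;q)_n=\prod_i(x_i;q)_n$ for $n\in\{0,1,2,\dots\}\cup\{\infty\}$, and $${}_8W_7(b;c_1,\dots,c_5;q,z)=\sum_{k=0}^\infty\frac{(q\sqrt b,-q\sqrt b,b,c_1,\dots,c_5;q)_k}{(q,\sqrt b,-\sqrt b,qb/c_1,\dots,qb/c_5;q)_k}\,z^k ,$$ where $\pm\sqrt b,\,qb/c_1,\dots,qb/c_5\notin\Omega_q$. Let $a_1,\dots,a_5,\lambda$ be nonzero complex numbers, put $A=a_1a_2a_3a_4a_5$, and assume $|q|<|A/\lambda|<1$. Assume that no infinite product in a denominator below vanishes and that no denominator parameter of an ${}_8W_7$ below lies in $\Omega_q$; explicitly, $a_ia_j\notin\Omega_q$ and $a_j/a_i\notin\Omega_q$ for all $i\ne j$; $a_i,\,-a_i,\,\lambda a_i\notin\Omega_q$ for all $i$; $\lambda^2\notin\Omega_q$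 and $\lambda^2\ne q$. Then all the ${}_8W_7$ series below converge absolutely, and $$\sum_{k=1}^5\frac{(\lambda a_k,\,a_k^{-2},\,\lambda/a_k;q)_\infty}{\prod_{j\ne k}(a_ka_j,\,a_j/a_k;q)_\infty}\;{}_8W_7\!\left(a_k^2;\{a_ka_j\}_{j\ne k},\frac{qa_k}{\lambda};q,\frac{q\lambda}{A}\right)$$ $$=\frac{2\,(\lambda a_1,\dots,\lambda a_5,\,A/\lambda;q)_\infty}{(\lambda^2;q)_\infty\prod_{1\le i<j\le5}(a_ia_j;q)_\infty}\;{}_8W_7\!\left(\frac{\lambda^2}{q};\frac{\lambda}{a_1},\dots,\frac{\lambda}{a_5};q,\frac{A}{\lambda}\right).$$ -/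

import Mathlib

namespace BasicHyp

noncomputable section

/-- The set `Ω_q = {q^{-k} : k = 0, 1, 2, …}`. -/
def Omega (q : ℂ) : Set ℂ := {z | ∃ k : ℕ, z = (q ^ k)⁻¹}

/-- The finite `q`-shifted factorial `(x;q)_n = (1-x)(1-xq)⋯(1-xq^{n-1})`. -/
def qPoch (x q : ℂ) (n : ℕ) : ℂ := ∏ j ∈ Finset.range n, (1 - x * q ^ j)

/-- The infinite `q`-shifted factorial `(x;q)_∞ = ∏_{n ≥ 0} (1 - x q^n)`, used for `|q| < 1`. -/
def qPochInf (x q : ℂ) : ℂ := ∏' n : ℕ, (1 - x * q ^ n)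

/-- The `k`-th term of the basic hypergeometric series `_{r+1}φ_s` with numerator parameters `as`
(`r + 1` of them), denominator parameters `bs` (`s` of them), base `q` and argument `z`. The
exponent below is `s - r`. -/
def phiTerm (as bs : List ℂ) (q z : ℂ) (k : ℕ) : ℂ :=
  (as.map fun x => qPoch x q k).prod / (qPoch q q k * (bs.map fun x => qPoch x q k).prod) *
    ((-1) ^ k * q ^ k.choose 2) ^ ((bs.length : ℤ) + 1 - (as.length : ℤ)) * z ^ k

/-- Numerator parameters `±q√b, b, a_4, …, a_{r+1}` of the very-well-poised series. -/
def vwpNum (b : ℂ) (as : List ℂ) (q : ℂ) : List ℂ :=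
  [q * Complex.sqrt b, -(q * Complex.sqrt b), b] ++ as

/-- Denominator parameters `±√b, qb/a_4, …, qb/a_{r+1}` of the very-well-poised series. -/
def vwpDen (b : ℂ) (as : List ℂ) (q : ℂ) : List ℂ :=
  [Complex.sqrt b, -Complex.sqrt b] ++ as.map fun x => q * b / x

/-- The `k`-th term of the very-well-poised series `_{r+1}W_r(b; as; q, z)`. -/
def WTerm (b : ℂ) (as : List ℂ) (q z : ℂ) (k : ℕ) : ℂ :=
  phiTerm (vwpNum b as q) (vwpDen b as q) q z k

/-- The very-well-poised series `_{r+1}W_r(b; as; q, z)`, where `as = [a_4, …, a_{r+1}]`. -/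
def W (b : ℂ) (as : List ℂ) (q z : ℂ) : ℂ := ∑' k : ℕ, WTerm b as q z k

/-- The symmetric sum `f(a) + idem(a_0; a_1, …, a_n)`: the sum of `f(a)` and of the `n` expressions
obtained by interchanging `a_0` with `a_k`, `k = 1, …, n` (the summand `k = 0` is `f(a)`). -/
def symSum {n : ℕ} (f : (Fin (n + 1) → ℂ) → ℂ) (a : Fin (n + 1) → ℂ) : ℂ :=
  ∑ k : Fin (n + 1), f (a ∘ Equiv.swap 0 k)

/-- With `a = (a_1, …, a_5)`, the last five parameters `a_1a_2, …, a_1a_5, qa_1/λ` of the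
`_8W_7` with base `a_1²`. -/
def leftParams (l q : ℂ) (a : Fin 5 → ℂ) : List ℂ :=
  [a 0 * a 1, a 0 * a 2, a 0 * a 3, a 0 * a 4, q * a 0 / l]

/-- The last five parameters `λ/a_1, …, λ/a_5` of the `_8W_7` with base `λ²/q`. -/
def rightParams (l : ℂ) (a : Fin 5 → ℂ) : List ℂ :=
  [l / a 0, l / a 1, l / a 2, l / a 3, l / a 4]

/-- The expression that is symmetrized: an infinite product times the `_8W_7` with base `a_1²`
and argument `qλ/(a_1a_2a_3a_4a_5)`. -/
def leftSummand (l q : ℂ) (a : Fin 5 → ℂ) : ℂ :=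
  qPochInf (l * a 0) q * qPochInf (1 / a 0 ^ 2) q * qPochInf (l / a 0) q /
      ((∏ j : Fin 4, qPochInf (a 0 * a j.succ) q) * ∏ j : Fin 4, qPochInf (a j.succ / a 0) q) *
    W (a 0 ^ 2) (leftParams l q a) q (q * l / ∏ i, a i)

end

end BasicHyp

/-! Both sides are two evaluations of one contour integral, the Nassrallah–Rahman integral: the
average over |z| = 1 of (z², z⁻², λz, λ/z; q)_∞ / ∏ᵢ (aᵢz, aᵢ/z; q)_∞, multiplied by (q; q)_∞. This
is meant literally for small parameters; the general case follows by analytic continuation.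

Left side: the poles in the unit disc are aₖqⁿ. By quasi-periodicity of the weight under z ↦ qz,
consecutive residues along one geometric progression have the term ratio of an `_8W_7` with base aₖ²
(`poleCofactor_eq`). The multiplier of the weight tends to qλ/A as z → 0, so |q| < |A/λ| makes the
integrals over small circles tend to 0, and the integral is the sum of all residues
(`qPochInf_mul_nrIntegral`).

Right side: the integral and the single series with base λ²/q satisfy the same contiguous relation,
which replaces λ by λq and one of two parameters c, d by cq or dq (`nrIntegral_contiguous`,
`nrClosed_contiguous`). For the integral it is linear interpolation in z + 1/z; for the series it is
a telescoping identity with an explicit certificate. When the fifth parameter is λq^M, induction on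
M reaches the Askey–Wilson integral (`awIntegral_eq`). The points λq^M accumulate at 0, so the
identity theorem in that parameter gives the general evaluation (`nrIntegral_eq_nrClosed`).

The Askey–Wilson integral divided by its product side is unchanged when one parameter is multiplied
by q, hence is constant; the constant is read off at (q, -q, √q, -√q), where the weight becomes a
Laurent polynomial.

To remove the smallness conditions, put aᵢ ↦ s aᵢ and λ ↦ s⁵λ. This fixes A/λ and every aⱼ/aᵢ. Both
sides are holomorphic in s off a countable closed set, whose complement is connected, and they agree
near s = 0, hence at s = 1 (`leftSide_eq_rightSide`). -/

open Filter Topology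

namespace BasicHyp

noncomputable section

/-! ### Finite and infinite q-shifted factorials. -/

section Pochhammer

variable {q : ℂ}

theorem qPoch_zero (x q : ℂ) : qPoch x q 0 = 1 := by simp [qPoch]

theorem qPoch_succ (x q : ℂ) (n : ℕ) : qPoch x q (n + 1) = qPoch x q n * (1 - x * q ^ n) := by
  simp [qPoch, Finset.prod_range_succ]

theorem qPoch_succ' (x q : ℂ) (n : ℕ) : qPoch x q (n + 1) = (1 - x) * qPoch (x * q) q n := by
  simp only [qPoch, Finset.prod_range_succ']
  rw [mul_comm]
  simp [pow_succ', mul_assoc]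

theorem qPoch_ne_zero {x : ℂ} (hx : x ∉ Omega q) (n : ℕ) : qPoch x q n ≠ 0 := by
  refine Finset.prod_ne_zero_iff.2 fun j _ h => hx ⟨j, ?_⟩
  exact eq_inv_of_mul_eq_one_left (sub_eq_zero.1 h).symm

theorem one_sub_ne_zero_of_notMem {x : ℂ} (hx : x ∉ Omega q) (n : ℕ) :
    1 - x * q ^ n ≠ 0 := fun h =>
  hx ⟨n, eq_inv_of_mul_eq_one_left (sub_eq_zero.1 h).symm⟩

theorem notMem_Omega_of_norm_lt {x : ℂ} (hq : q ≠ 0) (hq1 : ‖q‖ < 1) (hx : ‖x‖ < 1) :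
    x ∉ Omega q := by
  rintro ⟨k, rfl⟩
  rw [norm_inv, norm_pow] at hx
  have h0 : 0 < ‖q‖ ^ k := pow_pos (norm_pos_iff.2 hq) k
  have h1 : ‖q‖ ^ k ≤ 1 := pow_le_one₀ (norm_nonneg _) hq1.le
  exact absurd hx (not_lt.2 ((one_le_inv₀ h0).2 h1))

theorem summable_norm_mul_pow (hq1 : ‖q‖ < 1) (x : ℂ) : Summable fun n : ℕ => ‖-(x * q ^ n)‖ := by
  simpa [norm_mul, norm_pow] using (summable_geometric_of_lt_one (norm_nonneg q) hq1).mul_left ‖x‖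

theorem multipliable_qPochInf (hq1 : ‖q‖ < 1) (x : ℂ) :
    Multipliable fun n : ℕ => 1 - x * q ^ n := by
  simpa [sub_eq_add_neg] using multipliable_one_add_of_summable (summable_norm_mul_pow hq1 x)

theorem qPochInf_eq_mul (hq1 : ‖q‖ < 1) (x : ℂ) :
    qPochInf x q = (1 - x) * qPochInf (x * q) q := by
  have h := tprod_eq_zero_mul' (f := fun n : ℕ => 1 - x * q ^ n)
    (by simpa [pow_succ', mul_assoc] using multipliable_qPochInf hq1 (x * q))
  simpa [qPochInf, pow_succ', mul_assoc] using h

/-- On each ball the factors differ from 1 by at most the terms of a geometric series, so the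
product converges locally uniformly. -/
theorem differentiable_qPochInf (hq1 : ‖q‖ < 1) : Differentiable ℂ fun x => qPochInf x q := by
  have key : ∀ R : ℝ, DifferentiableOn ℂ (fun x => qPochInf x q) (Metric.ball 0 R) := by
    intro R
    have h := Summable.hasProdLocallyUniformlyOn_nat_one_add
      (f := fun (n : ℕ) (x : ℂ) => -(x * q ^ n)) (K := Metric.ball 0 R) Metric.isOpen_ball
      (u := fun n => R * ‖q‖ ^ n)
      ((summable_geometric_of_lt_one (norm_nonneg q) hq1).mul_left R)
      (Eventually.of_forall fun n x hx => by
        rw [norm_neg, norm_mul, norm_pow]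
        gcongr
        simpa using (Metric.mem_ball.1 hx).le)
      (fun n => by fun_prop)
    have h2 := h.differentiableOn (Eventually.of_forall fun s => by fun_prop) Metric.isOpen_ball
    simpa [qPochInf, sub_eq_add_neg] using h2
  intro x
  exact (key (‖x‖ + 1)).differentiableAt (Metric.isOpen_ball.mem_nhds (by simp))

theorem qPochInf_ne_zero (hq1 : ‖q‖ < 1) {x : ℂ} (hx : x ∉ Omega q) :
    qPochInf x q ≠ 0 := by
  have := tprod_one_add_ne_zero_of_summable (f := fun n : ℕ => -(x * q ^ n))
    (fun n => by simpa [sub_eq_add_neg] using one_sub_ne_zero_of_notMem hx n)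
    (summable_norm_mul_pow hq1 x)
  simpa [qPochInf, sub_eq_add_neg] using this

theorem qPochInf_zero (q : ℂ) : qPochInf 0 q = 1 := by simp [qPochInf]

theorem qPochInf_eq_qPoch_mul (hq1 : ‖q‖ < 1) (x : ℂ) (n : ℕ) :
    qPochInf x q = qPoch x q n * qPochInf (x * q ^ n) q := by
  induction n with
  | zero => simp [qPoch_zero]
  | succ n ih =>
    rw [ih, qPoch_succ, qPochInf_eq_mul hq1 (x * q ^ n), pow_succ]
    ring_nf

end Pochhammer

/-! ### Series whose term ratio is a function of q^n. -/

section Ratio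

variable {q : ℂ}

/-- A series whose term ratio is a function of `q ^ n` and a parameter, with limiting ratio of norm
less than one, is locally uniformly dominated. -/
theorem exists_summable_bound_of_ratio (hq1 : ‖q‖ < 1) {U : Set ℂ} (hU : IsOpen U)
    {T : ℕ → ℂ → ℂ} {R : ℂ → ℂ → ℂ} (hT : ∀ n, ContinuousOn (T n) U)
    (hR : ∀ s ∈ U, ContinuousAt (fun p : ℂ × ℂ => R p.1 p.2) (0, s))
    (hR0 : ∀ s ∈ U, ‖R 0 s‖ < 1)
    (hrec : ∀ n, ∀ s ∈ U, T (n + 1) s = R (q ^ n) s * T n s) {s : ℂ} (hs : s ∈ U) :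
    ∃ V ⊆ U, IsOpen V ∧ s ∈ V ∧ ∃ N : ℕ, ∃ u : ℕ → ℝ, Summable u ∧
      ∀ n, ∀ w ∈ V, ‖T (n + N) w‖ ≤ u n := by
  -- Joint continuity at (0, s) keeps the ratio below a fixed κ < 1 for all large n, uniformly near
  -- s; the tail is then dominated by a geometric series.
  obtain ⟨κ, hκ0, hκ1⟩ := exists_between (hR0 s hs)
  have h1 : ∀ᶠ p : ℂ × ℂ in 𝓝 (0, s), ‖R p.1 p.2‖ < κ := (hR s hs).norm.eventually_lt_const hκ0
  rw [nhds_prod_eq] at h1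
  obtain ⟨P, hP, Q, hQ, hPQ⟩ := eventually_prod_iff.1 h1
  obtain ⟨N, hN⟩ := eventually_atTop.1 ((tendsto_pow_atTop_nhds_zero_of_norm_lt_one hq1).eventually hP)
  have h2 : ∀ᶠ w in 𝓝 s, ‖T N w‖ < ‖T N s‖ + 1 :=
    (((hT N).continuousAt (hU.mem_nhds hs)).norm).eventually_lt_const (lt_add_one _)
  obtain ⟨V, hV, hVo, hsV⟩ := eventually_nhds_iff.1 ((hQ.and h2).and (hU.mem_nhds hs))
  have hκ : 0 ≤ κ := (norm_nonneg _).trans hκ0.le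
  refine ⟨V, fun w hw => (hV w hw).2, hVo, hsV, N, fun n => (‖T N s‖ + 1) * κ ^ n,
    (summable_geometric_of_lt_one hκ hκ1).mul_left _, fun n w hw => ?_⟩
  obtain ⟨⟨hwQ, hwT⟩, hwU⟩ := hV w hw
  induction n with
  | zero => simpa using hwT.le
  | succ n ih =>
    rw [show n + 1 + N = (n + N) + 1 by ring, hrec _ _ hwU, norm_mul]
    calc _ ≤ κ * ((‖T N s‖ + 1) * κ ^ n) := by
          gcongr
          exact (hPQ (hN (n + N) (by omega)) hwQ).le
      _ = _ := by ring

theorem summable_of_ratio (hq1 : ‖q‖ < 1) {T : ℕ → ℂ} {R : ℂ → ℂ} (hR : ContinuousAt R 0)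
    (hR0 : ‖R 0‖ < 1) (hrec : ∀ n, T (n + 1) = R (q ^ n) * T n) : Summable T := by
  obtain ⟨V, -, -, hs, N, u, hu, h⟩ := exists_summable_bound_of_ratio hq1 isOpen_univ
    (T := fun n _ => T n) (R := fun x _ => R x) (fun n => continuousOn_const)
    (fun s _ => ContinuousAt.comp (g := R) (x := ((0 : ℂ), s)) hR continuousAt_fst)
    (fun _ _ => hR0) (fun n _ _ => hrec n) (Set.mem_univ 0)
  exact (summable_nat_add_iff N).1 (hu.of_norm_bounded fun n => h n 0 hs)

/-- Near each point Weierstrass' theorem applies to the tail beyond N, and the finite head is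
differentiable term by term. -/
theorem differentiableOn_tsum_of_ratio (hq1 : ‖q‖ < 1) {U : Set ℂ} (hU : IsOpen U)
    {T : ℕ → ℂ → ℂ} {R : ℂ → ℂ → ℂ} (hT : ∀ n, DifferentiableOn ℂ (T n) U)
    (hR : ∀ s ∈ U, ContinuousAt (fun p : ℂ × ℂ => R p.1 p.2) (0, s))
    (hR0 : ∀ s ∈ U, ‖R 0 s‖ < 1)
    (hrec : ∀ n, ∀ s ∈ U, T (n + 1) s = R (q ^ n) s * T n s) :
    DifferentiableOn ℂ (fun s => ∑' n, T n s) U := by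
  intro s hs
  obtain ⟨V, hVU, hV, hsV, N, u, hu, h⟩ := exists_summable_bound_of_ratio hq1 hU
    (fun n => (hT n).continuousOn) hR hR0 hrec hs
  have h1 : DifferentiableOn ℂ (fun s => ∑' n, T (n + N) s) V :=
    Complex.differentiableOn_tsum_of_summable_norm hu (fun n => (hT _).mono hVU) hV h
  have h2 : DifferentiableOn ℂ (fun s => ∑ n ∈ Finset.range N, T n s + ∑' n, T (n + N) s) V :=
    (DifferentiableOn.fun_sum fun n _ => (hT n).mono hVU).add h1
  have h3 : DifferentiableOn ℂ (fun s => ∑' n, T n s) V := h2.congr fun w hw =>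
    (((summable_nat_add_iff N).1 (hu.of_norm_bounded fun n => h n w hw)).sum_add_tsum_nat_add N).symm
  exact (h3.differentiableAt (hV.mem_nhds hsV)).differentiableWithinAt

end Ratio

/-! ### Very-well-poised series: term ratio, convergence, holomorphy in the parameters. -/

section VeryWellPoised

/-- The terms of a very-well-poised series of type `_8W_7` with base `b`; the numerator parameters
are `c` and `y / z`, the denominator parameters are `d`, and the argument is `z`. The numerator
parameter `y / z` is kept in the form that makes sense for `z = 0`. -/
def vwpTerm (b : ℂ) (c : Fin 4 → ℂ) (d : Fin 5 → ℂ) (q y z : ℂ) (n : ℕ) : ℂ :=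
  (1 - b * q ^ (2 * n)) / (1 - b) * (qPoch b q n / qPoch q q n) *
    ((∏ i, qPoch (c i) q n) / ∏ i, qPoch (d i) q n) * ∏ j ∈ Finset.range n, (z - y * q ^ j)

/-- The ratio of consecutive terms of a very-well-poised series, as a function of `x = q ^ n`. -/
def vwpRatio (b : ℂ) (c : Fin 4 → ℂ) (d : Fin 5 → ℂ) (q y z x : ℂ) : ℂ :=
  (1 - b * q ^ 2 * x ^ 2) / (1 - b * x ^ 2) * ((1 - b * x) / (1 - q * x)) *
    ((∏ i, (1 - c i * x)) / ∏ i, (1 - d i * x)) * (z - y * x)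

variable {q : ℂ}

/-- Only the very-well-poised factor is cancelled between consecutive terms, hence `hb`. The other
quotients are merely multiplied, which is legitimate even for zero denominators since inversion with
0⁻¹ = 0 is multiplicative. -/
theorem vwpTerm_succ {b : ℂ} (hb : ∀ n : ℕ, 1 - b * q ^ (2 * n) ≠ 0) (c : Fin 4 → ℂ)
    (d : Fin 5 → ℂ) (y z : ℂ) (n : ℕ) :
    vwpTerm b c d q y z (n + 1) = vwpRatio b c d q y z (q ^ n) * vwpTerm b c d q y z n := by
  have h := hb n
  have h1 : (1 - b * q ^ (2 * (n + 1))) / (1 - b) =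
      (1 - b * q ^ 2 * (q ^ n) ^ 2) / (1 - b * (q ^ n) ^ 2) * ((1 - b * q ^ (2 * n)) / (1 - b)) := by
    rw [show 1 - b * (q ^ n) ^ 2 = 1 - b * q ^ (2 * n) by ring, div_mul_div_cancel₀ h]
    ring
  simp only [vwpTerm, vwpRatio, h1, qPoch_succ, Finset.prod_mul_distrib, Finset.prod_range_succ,
    mul_div_mul_comm]
  ring

/-- All denominators equal 1 where x = 0, so no restriction on the parameters is needed. -/
theorem continuousAt_vwpRatio {X : Type*} [TopologicalSpace X] {b : X → ℂ} {c : X → Fin 4 → ℂ}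
    {d : X → Fin 5 → ℂ} {y z x : X → ℂ} {p : X} (hb : ContinuousAt b p)
    (hc : ∀ i, ContinuousAt (fun s => c s i) p)
    (hd : ∀ i, ContinuousAt (fun s => d s i) p) (hy : ContinuousAt y p) (hz : ContinuousAt z p)
    (hx : ContinuousAt x p) (hx0 : x p = 0) :
    ContinuousAt (fun s => vwpRatio (b s) (c s) (d s) q (y s) (z s) (x s)) p := by
  unfold vwpRatio
  refine ContinuousAt.mul (ContinuousAt.mul (ContinuousAt.mul (ContinuousAt.div ?_ ?_ ?_)
    (ContinuousAt.div ?_ ?_ ?_)) (ContinuousAt.div ?_ ?_ ?_)) ?_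
  all_goals first
    | fun_prop
    | simp [hx0]

theorem vwpRatio_zero (b : ℂ) (c : Fin 4 → ℂ) (d : Fin 5 → ℂ) (q y z : ℂ) :
    vwpRatio b c d q y z 0 = z := by simp [vwpRatio]

theorem summable_vwpTerm (hq1 : ‖q‖ < 1) {b : ℂ} (hb : ∀ n : ℕ, 1 - b * q ^ (2 * n) ≠ 0)
    (c : Fin 4 → ℂ) (d : Fin 5 → ℂ) (y : ℂ) {z : ℂ} (hz : ‖z‖ < 1) : Summable (vwpTerm b c d q y z) := by
  refine summable_of_ratio hq1 (R := vwpRatio b c d q y z) ?_ (by rwa [vwpRatio_zero])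
    (vwpTerm_succ hb c d y z)
  exact continuousAt_vwpRatio continuousAt_const (fun _ => continuousAt_const)
    (fun _ => continuousAt_const) continuousAt_const continuousAt_const continuousAt_id rfl

theorem differentiableOn_qPoch {U : Set ℂ} {f : ℂ → ℂ} (hf : DifferentiableOn ℂ f U) (n : ℕ) :
    DifferentiableOn ℂ (fun s => qPoch (f s) q n) U :=
  DifferentiableOn.fun_finsetProd fun _ _ => (differentiableOn_const _).sub (hf.mul_const _)

theorem differentiableOn_tsum_vwpTerm (hq : q ≠ 0) (hq1 : ‖q‖ < 1) {U : Set ℂ} (hU : IsOpen U)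
    {b : ℂ → ℂ} {c : ℂ → Fin 4 → ℂ} {d : ℂ → Fin 5 → ℂ} {y z : ℂ → ℂ}
    (hb : DifferentiableOn ℂ b U) (hc : ∀ i, DifferentiableOn ℂ (fun s => c s i) U)
    (hd : ∀ i, DifferentiableOn ℂ (fun s => d s i) U) (hy : DifferentiableOn ℂ y U)
    (hz : DifferentiableOn ℂ z U) (hbΩ : ∀ s ∈ U, ∀ n : ℕ, 1 - b s * q ^ (2 * n) ≠ 0)
    (hdΩ : ∀ s ∈ U, ∀ i, d s i ∉ Omega q) (hz1 : ∀ s ∈ U, ‖z s‖ < 1) :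
    DifferentiableOn ℂ (fun s => ∑' n, vwpTerm (b s) (c s) (d s) q (y s) (z s) n) U := by
  have hqΩ : q ∉ Omega q := notMem_Omega_of_norm_lt hq hq1 hq1
  refine differentiableOn_tsum_of_ratio hq1 hU
    (T := fun n s => vwpTerm (b s) (c s) (d s) q (y s) (z s) n)
    (R := fun x s => vwpRatio (b s) (c s) (d s) q (y s) (z s) x) (fun n => ?_) (fun s hs => ?_)
    (fun s hs => by rw [vwpRatio_zero]; exact hz1 s hs)
    (fun n s hs => vwpTerm_succ (hbΩ s hs) _ _ _ _ n)
  · unfold vwpTerm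
    refine DifferentiableOn.mul (DifferentiableOn.mul (DifferentiableOn.mul
      (DifferentiableOn.div ?_ ?_ ?_) ?_) (DifferentiableOn.div ?_ ?_ ?_)) ?_
    · fun_prop
    · fun_prop
    · intro s hs
      simpa using hbΩ s hs 0
    · exact (differentiableOn_qPoch hb n).div_const _
    · exact DifferentiableOn.fun_finsetProd fun i _ => differentiableOn_qPoch (hc i) n
    · exact DifferentiableOn.fun_finsetProd fun i _ => differentiableOn_qPoch (hd i) n
    · exact fun s hs => Finset.prod_ne_zero_iff.2 fun i _ => qPoch_ne_zero (hdΩ s hs i) n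
    · exact DifferentiableOn.fun_finsetProd fun _ _ => hz.sub (hy.mul_const _)
  · have hUs := hU.mem_nhds hs
    have aux : ∀ {f : ℂ → ℂ}, DifferentiableOn ℂ f U →
        ContinuousAt (fun p : ℂ × ℂ => f p.2) ((0 : ℂ), s) := fun hf =>
      ContinuousAt.comp (x := ((0 : ℂ), s)) (hf.differentiableAt hUs).continuousAt continuousAt_snd
    exact continuousAt_vwpRatio (aux hb) (fun i => aux (hc i)) (fun i => aux (hd i)) (aux hy)
      (aux hz) continuousAt_fst rfl

end VeryWellPoised

/-! ### Circle averages, residues in an annulus, holomorphic dependence on a parameter. -/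

section Contour

open Metric Real Set MeasureTheory

/-- Multiplication by q rotates the unit circle by arg q and rescales it by |q|; the average does
not see the rotation. -/
theorem circleAverage_comp_mul_left {q : ℂ} (g : ℂ → ℂ) :
    circleAverage (fun z => g (q * z)) 0 1 = circleAverage g 0 ‖q‖ := by
  rw [circleAverage_eq_integral_add (f := g) (Complex.arg q), circleAverage]
  congr 2
  ext θ
  congr 1
  conv_lhs => rw [← Complex.norm_mul_exp_arg_mul_I q]
  simp only [circleMap, zero_add, Complex.ofReal_one, one_mul, Complex.ofReal_add, add_mul,
    Complex.exp_add]
  ring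

theorem circleAverage_eq_of_differentiableAt {g : ℂ → ℂ} {r R : ℝ} (hr : 0 < r) (hrR : r ≤ R)
    (hg : ∀ z : ℂ, r ≤ ‖z‖ → ‖z‖ ≤ R → DifferentiableAt ℂ g z) :
    circleAverage g 0 R = circleAverage g 0 r := by
  rw [circleAverage_eq_circleIntegral hr.ne', circleAverage_eq_circleIntegral (hr.trans_le hrR).ne']
  congr 1
  refine Complex.circleIntegral_sub_center_inv_smul_eq_of_differentiable_on_annulus_off_countable
    hr hrR countable_empty (fun z hz => ?_) (fun z hz => ?_)
  · exact (hg z (by simpa using hz.2) (by simpa using hz.1)).continuousAt.continuousWithinAt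
  · have := hz.1
    simp only [Set.mem_sdiff, mem_ball, dist_zero_right, mem_closedBall, not_le] at this
    exact hg z this.2.le this.1.le

theorem circleIntegral_inv_sub_of_norm_lt {p : ℂ} {r : ℝ} (hr : 0 ≤ r) (hp : r < ‖p‖) :
    (∮ z in C(0, r), (z - p)⁻¹) = 0 := by
  refine Complex.circleIntegral_eq_zero_of_differentiable_on_off_countable hr countable_empty
    (fun z hz => ?_) (fun z hz => ?_)
  · refine ContinuousAt.continuousWithinAt (ContinuousAt.inv₀ (by fun_prop) ?_)
    rintro h
    rw [sub_eq_zero.1 h] at hz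
    simp at hz; linarith
  · have := hz.1
    refine DifferentiableAt.inv (by fun_prop) ?_
    rintro h
    rw [sub_eq_zero.1 h] at this
    simp at this; linarith

/-- The residue theorem for an annulus and finitely many simple poles. -/
theorem circleIntegral_sub_eq_sum_residues {r R : ℝ} (hr : 0 < r) (hrR : r ≤ R) (S : Finset ℂ)
    (hS : ∀ p ∈ S, r < ‖p‖ ∧ ‖p‖ < R) (h : ℂ → ℂ → ℂ) (hh : ∀ p ∈ S, AnalyticAt ℂ (h p) p)
    (f : ℂ → ℂ) (hf : ∀ z : ℂ, r ≤ ‖z‖ → ‖z‖ ≤ R → z ∉ S → DifferentiableAt ℂ f z)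
    (hfh : ∀ p ∈ S, ∀ᶠ z in 𝓝[≠] p, f z = h p z / (z - p)) :
    (∮ z in C(0, R), f z) - (∮ z in C(0, r), f z) = 2 * π * Complex.I * ∑ p ∈ S, h p p := by
  classical
  induction S using Finset.induction_on generalizing f h with
  | empty =>
    rw [Complex.circleIntegral_eq_of_differentiable_on_annulus_off_countable hr hrR countable_empty
      (f := f) (fun z hz => ?_) (fun z hz => ?_)]
    · simp
    · exact (hf z (by simpa using hz.2) (by simpa using hz.1)
        (by simp)).continuousAt.continuousWithinAt
    · have := hz.1
      simp only [Set.mem_sdiff, mem_ball, dist_zero_right, mem_closedBall, not_le] at this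
      exact hf z this.2.le this.1.le (by simp)
  | insert p S hpS ih =>
    have hp := hS p (Finset.mem_insert_self _ _)
    -- The principal part at p is removed. The value `deriv (h p) p` makes f₁ agree near p with the
    -- divided difference of `h p` at p, so the singularity is genuinely filled in.
    set f₁ : ℂ → ℂ := Function.update (fun z => f z - h p p * (z - p)⁻¹) p (deriv (h p) p) with hf₁
    have hne : ∀ z, z ≠ p → f₁ z = f z - h p p * (z - p)⁻¹ := fun z hz => by
      simp [hf₁, Function.update_of_ne hz]
    have hev : ∀ z, z ≠ p → f₁ =ᶠ[𝓝 z] fun z => f z - h p p * (z - p)⁻¹ := fun z hz => by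
      filter_upwards [isOpen_ne.mem_nhds hz] with w hw using hne w hw
    have hsphere : ∀ ρ : ℝ, 0 < ρ → ‖p‖ ≠ ρ → (∀ z : ℂ, ‖z‖ = ρ → DifferentiableAt ℂ f z) →
        (∮ z in C(0, ρ), f z) = (∮ z in C(0, ρ), f₁ z) + h p p * ∮ z in C(0, ρ), (z - p)⁻¹ := by
      intro ρ hρ hpρ hd
      have hzp : ∀ z ∈ sphere (0 : ℂ) ρ, z ≠ p := by
        rintro z hz rfl
        exact hpρ (by simpa using hz)
      have i2 : ContinuousOn (fun z : ℂ => (z - p)⁻¹) (sphere 0 ρ) :=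
        ContinuousOn.inv₀ (by fun_prop) fun z hz => sub_ne_zero.2 (hzp z hz)
      have i1 : ContinuousOn f (sphere 0 ρ) := fun z hz =>
        (hd z (by simpa using hz)).continuousAt.continuousWithinAt
      have e1 : (∮ z in C(0, ρ), f₁ z) = ∮ z in C(0, ρ), (f z - h p p * (z - p)⁻¹) :=
        circleIntegral.integral_congr hρ.le fun z hz => hne z (hzp z hz)
      rw [e1, circleIntegral.integral_sub (i1.circleIntegrable hρ.le)
        (ContinuousOn.circleIntegrable hρ.le (f := fun z => h p p * (z - p)⁻¹)
          (continuousOn_const.mul i2))]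
      have e2 : (∮ z in C(0, ρ), h p p * (z - p)⁻¹) = h p p * ∮ z in C(0, ρ), (z - p)⁻¹ := by
        simp
      rw [e2]
      ring
    have hnS : ∀ ρ : ℝ, (ρ = r ∨ ρ = R) → ∀ z : ℂ, ‖z‖ = ρ → DifferentiableAt ℂ f z := by
      rintro ρ hρ z rfl
      refine hf z (by rcases hρ with h | h <;> linarith) (by rcases hρ with h | h <;> linarith)
        fun hz => ?_
      have := hS z hz
      rcases hρ with h | h <;> linarith
    rw [hsphere R (hr.trans_le hrR) hp.2.ne (hnS R (.inr rfl)),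
      hsphere r hr hp.1.ne' (hnS r (.inl rfl)), circleIntegral_inv_sub_of_norm_lt hr.le hp.1,
      circleIntegral.integral_sub_inv_of_mem_ball (by simpa using hp.2), Finset.sum_insert hpS]
    -- The cofactor at another pole p' is corrected by a term with the factor z - p', so the residue
    -- there is unchanged.
    have key := ih (fun p' hp' => hS p' (Finset.mem_insert_of_mem hp'))
      (fun p' z => h p' z - (z - p') * (h p p * (z - p)⁻¹)) (fun p' hp' => ?_) f₁ ?_ ?_
    · simp only [sub_self, zero_mul, sub_zero] at key
      linear_combination key
    · have hpp : p' ≠ p := fun e => hpS (e ▸ hp')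
      refine (hh p' (Finset.mem_insert_of_mem hp')).sub (AnalyticAt.mul (by fun_prop)
        (analyticAt_const.mul (AnalyticAt.inv (by fun_prop) (sub_ne_zero.2 hpp))))
    · intro z hz1 hz2 hzS
      by_cases hzp : z = p
      · subst hzp
        have h1 : f₁ =ᶠ[𝓝 z] dslope (h z) z := by
          have := hfh z (Finset.mem_insert_self _ _)
          rw [eventually_nhdsWithin_iff] at this
          filter_upwards [this] with w hw
          by_cases hwz : w = z
          · subst hwz; simp [hf₁]
          · rw [hne w hwz, hw hwz, dslope_of_ne _ hwz, slope_def_field]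
            ring
        have h2 := (hh z (Finset.mem_insert_self _ _)).eventually_analyticAt
        refine DifferentiableAt.congr_of_eventuallyEq ?_ h1
        refine ((Complex.differentiableOn_dslope (s := {w | AnalyticAt ℂ (h z) w}) h2).2
          fun w hw => hw.differentiableAt.differentiableWithinAt).differentiableAt h2
      · refine DifferentiableAt.congr_of_eventuallyEq ?_ (hev z hzp)
        exact (hf z hz1 hz2 (by simp [hzp, hzS])).sub
          (DifferentiableAt.const_mul (a := fun z => (z - p)⁻¹)
            (DifferentiableAt.inv (by fun_prop) (sub_ne_zero.2 hzp)) _)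
    · intro p' hp'
      have hpp : p' ≠ p := fun e => hpS (e ▸ hp')
      filter_upwards [hfh p' (Finset.mem_insert_of_mem hp'), self_mem_nhdsWithin,
        nhdsWithin_le_nhds (hev p' hpp)] with z hz hzp' hz1
      have : z - p' ≠ 0 := sub_ne_zero.2 hzp'
      rw [hz1, hz, sub_div, mul_div_cancel_left₀ _ this]

/-- Differentiation under the integral sign: joint continuity bounds the integrand on a compact set,
and Cauchy's estimate turns this into a bound for its derivative. -/
theorem differentiableOn_circleAverage {U : Set ℂ} (hU : IsOpen U) {Φ : ℂ → ℂ → ℂ}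
    (hc : ContinuousOn (fun p : ℂ × ℂ => Φ p.1 p.2) (U ×ˢ sphere 0 1))
    (hd : ∀ z ∈ sphere (0 : ℂ) 1, DifferentiableOn ℂ (fun s => Φ s z) U) :
    DifferentiableOn ℂ (fun s => circleAverage (Φ s) 0 1) U := by
  intro s hs
  obtain ⟨ε, hε, hεU⟩ := Metric.isOpen_iff.1 hU s hs
  -- Discs of radius δ centred within δ of s stay inside the closed ball of radius 2δ < ε, where the
  -- bound C holds; Cauchy's estimate gives C / δ.
  set δ := ε / 3
  have hδ : 0 < δ := by positivity
  have hsub : closedBall s (2 * δ) ⊆ U := (closedBall_subset_ball (by simp [δ]; linarith)).trans hεU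
  obtain ⟨C, hC⟩ := ((isCompact_closedBall s (2 * δ)).prod
    (isCompact_sphere (0 : ℂ) 1)).exists_bound_of_continuousOn (hc.mono (prod_mono hsub subset_rfl))
  have hmap : ∀ θ : ℝ, circleMap 0 1 θ ∈ sphere (0 : ℂ) 1 := fun θ => by simp
  have hcont : ∀ w ∈ U, Continuous fun θ : ℝ => Φ w (circleMap 0 1 θ) := fun w hw =>
    hc.comp_continuous (f := fun θ : ℝ => (w, circleMap 0 1 θ)) (by fun_prop)
      fun θ => ⟨hw, hmap θ⟩
  have hder : ∀ θ : ℝ, ∀ w ∈ U, HasDerivAt (fun x => Φ x (circleMap 0 1 θ))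
      (deriv (fun x => Φ x (circleMap 0 1 θ)) w) w := fun θ w hw =>
    ((hd _ (hmap θ)).differentiableAt (hU.mem_nhds hw)).hasDerivAt
  have hballU : ball s δ ⊆ U := (ball_subset_closedBall.trans
    (closedBall_subset_closedBall (by linarith))).trans hsub
  have main := (intervalIntegral.hasDerivAt_integral_of_dominated_loc_of_deriv_le (μ := volume)
    (a := 0) (b := 2 * π) (F := fun w θ => Φ w (circleMap 0 1 θ))
    (F' := fun w θ => deriv (fun x => Φ x (circleMap 0 1 θ)) w) (x₀ := s) (s := ball s δ)
    (bound := fun _ => C / δ) (ball_mem_nhds s hδ) ?_ ?_ ?_ ?_ ?_ ?_).2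
  · have := (main.const_smul (2 * π)⁻¹).differentiableAt
    exact this.differentiableWithinAt
  · filter_upwards [hU.mem_nhds hs] with w hw using (hcont w hw).aestronglyMeasurable
  · exact (hcont s hs).intervalIntegrable _ _
  · have hseq : Tendsto (fun n : ℕ => s + ((δ / (n + 1) : ℝ) : ℂ)) atTop (𝓝[≠] s) := by
      refine tendsto_nhdsWithin_iff.2 ⟨?_, Eventually.of_forall fun n => ?_⟩
      · have h1 : Tendsto (fun n : ℕ => δ / ((n : ℝ) + 1)) atTop (𝓝 0) :=
          tendsto_const_div_atTop_nhds_zero_nat δ |>.comp (tendsto_add_atTop_nat 1) |>.congr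
            fun n => by simp
        have h2 := (Complex.continuous_ofReal.tendsto 0).comp h1
        simpa using h2.const_add s
      · have : (δ / ((n : ℝ) + 1)) ≠ 0 := by positivity
        simpa using Complex.ofReal_ne_zero.2 this
    refine aestronglyMeasurable_of_tendsto_ae atTop
      (f := fun (n : ℕ) θ => slope (fun x => Φ x (circleMap 0 1 θ)) s
        (s + ((δ / (n + 1) : ℝ) : ℂ))) (fun n => ?_) (Eventually.of_forall fun θ => ?_)
    · have hmem : s + ((δ / (n + 1) : ℝ) : ℂ) ∈ U := by
        refine hsub ?_
        rw [mem_closedBall, dist_eq_norm, add_sub_cancel_left, Complex.norm_real, Real.norm_eq_abs,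
          abs_of_pos (by positivity)]
        have : δ / ((n : ℝ) + 1) ≤ δ := div_le_self hδ.le (by linarith [n.cast_nonneg (α := ℝ)])
        linarith
      simp only [slope_def_field]
      exact (((hcont _ hmem).sub (hcont s hs)).div_const _).aestronglyMeasurable
    · exact (hasDerivAt_iff_tendsto_slope.1 (hder θ s hs)).comp hseq
  · refine Eventually.of_forall fun θ _ w hw => ?_
    have hcb : closedBall w δ ⊆ closedBall s (2 * δ) := by
      refine closedBall_subset_closedBall' ?_
      have := (mem_ball.1 hw).le
      linarith
    refine Complex.norm_deriv_le_of_forall_mem_sphere_norm_le hδ ?_ fun x hx =>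
      hC (x, _) ⟨hcb (sphere_subset_closedBall hx), hmap θ⟩
    exact ((hd _ (hmap θ)).mono (hcb.trans hsub)).diffContOnCl_ball subset_rfl
  · exact intervalIntegrable_const
  · exact Eventually.of_forall fun θ _ w hw => hder θ w (hballU hw)

end Contour

/-! ### The Askey–Wilson integral. -/

section AskeyWilson

open Metric Real

variable {q : ℂ}

/-- The product `(x z, x / z; q)_∞`. -/
def qPochPM (x q z : ℂ) : ℂ := qPochInf (x * z) q * qPochInf (x / z) q

/-- The Askey--Wilson weight. -/
def awWeight (q a b c d z : ℂ) : ℂ :=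
  qPochInf (z ^ 2) q * qPochInf (1 / z ^ 2) q /
    (qPochPM a q z * qPochPM b q z * qPochPM c q z * qPochPM d q z)

/-- The Askey--Wilson integral, as an average over the unit circle. -/
def awIntegral (q a b c d : ℂ) : ℂ := circleAverage (awWeight q a b c d) 0 1

theorem qPochPM_eq_mul (hq1 : ‖q‖ < 1) (x z : ℂ) :
    qPochPM x q z = (1 - x * z) * (1 - x / z) * qPochPM (x * q) q z := by
  rw [qPochPM, qPochInf_eq_mul hq1, qPochInf_eq_mul hq1 (x / z), qPochPM,
    show x * z * q = x * q * z by ring, show x / z * q = x * q / z by ring]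
  ring

theorem qPochInf_ne_zero_of_norm_lt (hq : q ≠ 0) (hq1 : ‖q‖ < 1) {x : ℂ} (hx : ‖x‖ < 1) :
    qPochInf x q ≠ 0 :=
  qPochInf_ne_zero hq1 (notMem_Omega_of_norm_lt hq hq1 hx)

theorem qPochPM_ne_zero (hq : q ≠ 0) (hq1 : ‖q‖ < 1) {x z : ℂ} (hx : ‖x‖ < 1) (hz : ‖z‖ = 1) :
    qPochPM x q z ≠ 0 :=
  mul_ne_zero (qPochInf_ne_zero_of_norm_lt hq hq1 (by simpa [hz] using hx))
    (qPochInf_ne_zero_of_norm_lt hq hq1 (by simpa [hz] using hx))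

theorem continuousOn_qPochInf_comp (hq1 : ‖q‖ < 1) {X : Type*} [TopologicalSpace X] {f : X → ℂ}
    {s : Set X} (hf : ContinuousOn f s) : ContinuousOn (fun x => qPochInf (f x) q) s :=
  (differentiable_qPochInf hq1).continuous.comp_continuousOn hf

theorem continuousOn_qPochPM_comp (hq1 : ‖q‖ < 1) {X : Type*} [TopologicalSpace X] {f g : X → ℂ}
    {s : Set X} (hf : ContinuousOn f s) (hg : ContinuousOn g s) (hg0 : ∀ x ∈ s, g x ≠ 0) :
    ContinuousOn (fun x => qPochPM (f x) q (g x)) s :=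
  (continuousOn_qPochInf_comp hq1 (hf.mul hg)).mul
    (continuousOn_qPochInf_comp hq1 (hf.div hg hg0))

theorem differentiableOn_qPochInf_comp (hq1 : ‖q‖ < 1) {f : ℂ → ℂ} {s : Set ℂ}
    (hf : DifferentiableOn ℂ f s) : DifferentiableOn ℂ (fun x => qPochInf (f x) q) s :=
  (differentiable_qPochInf hq1).comp_differentiableOn hf

theorem differentiableAt_qPochInf_comp (hq1 : ‖q‖ < 1) {f : ℂ → ℂ} {z : ℂ}
    (hf : DifferentiableAt ℂ f z) : DifferentiableAt ℂ (fun x => qPochInf (f x) q) z :=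
  DifferentiableAt.comp (g := fun x => qPochInf x q) z (differentiable_qPochInf hq1 _) hf

theorem differentiableOn_qPochPM (hq1 : ‖q‖ < 1) {f : ℂ → ℂ} {s : Set ℂ}
    (hf : DifferentiableOn ℂ f s) (z : ℂ) : DifferentiableOn ℂ (fun x => qPochPM (f x) q z) s :=
  (differentiableOn_qPochInf_comp hq1 (hf.mul_const z)).mul
    (differentiableOn_qPochInf_comp hq1 (hf.div_const z))

theorem norm_mul_lt_one {x y : ℂ} (hx : ‖x‖ < 1) (hy : ‖y‖ < 1) : ‖x * y‖ < 1 := by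
  rw [norm_mul]
  exact mul_lt_one_of_nonneg_of_lt_one_left (norm_nonneg _) hx hy.le

theorem ne_zero_of_norm_eq_one {z : ℂ} (hz : ‖z‖ = 1) : z ≠ 0 := by
  rintro rfl
  simp at hz

/-- The auxiliary function whose `q`-difference relates contiguous Askey--Wilson weights. -/
def awAux (q a b c d z : ℂ) : ℂ :=
  z ^ 3 * (qPochInf (q * z ^ 2) q * qPochInf (1 / z ^ 2) q) /
    ((qPochInf (a * z) q * qPochInf (a * q / z) q) * (qPochInf (b * z) q * qPochInf (b * q / z) q) *
      (qPochInf (c * z) q * qPochInf (c * q / z) q) * (qPochInf (d * z) q * qPochInf (d * q / z) q))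

/-- The difference of `awAux` at z and qz averages to zero, so this pointwise identity gives a
recurrence for the integral. Once every infinite product is reduced to ten common ones, a rational
identity in z and the parameters remains. -/
theorem awWeight_shift (hq : q ≠ 0) (hq1 : ‖q‖ < 1) {a b c d z : ℂ} (ha : ‖a‖ < 1) (hb : ‖b‖ < 1)
    (hc : ‖c‖ < 1) (hd : ‖d‖ < 1) (hz : ‖z‖ = 1) :
    (1 - a * b * c * d) * awWeight q (a * q) b c d z =
      (1 - a * b) * (1 - a * c) * (1 - a * d) * awWeight q a b c d z +
        a * (awAux q a b c d z - awAux q a b c d (q * z)) := by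
  have hz0 := ne_zero_of_norm_eq_one hz
  have n1 : ∀ {x : ℂ}, ‖x‖ < 1 → 1 - x ≠ 0 := fun hx h => by
    rw [← sub_eq_zero.1 h] at hx
    simp at hx
  have m1 : ∀ {x : ℂ}, ‖x‖ < 1 → 1 - x * z ≠ 0 := fun hx => n1 (by simpa [hz] using hx)
  have m2 : ∀ {x : ℂ}, ‖x‖ < 1 → 1 - x / z ≠ 0 := fun hx => n1 (by simpa [hz] using hx)
  have m2' : ∀ {x : ℂ}, ‖x‖ < 1 → z - x ≠ 0 := fun hx h => m2 hx (by
    rw [← sub_eq_zero.1 h]; field_simp; simp)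
  have hq2 : ‖q ^ 2‖ < 1 := by simpa using pow_lt_one₀ (norm_nonneg q) hq1 two_ne_zero
  have k1 : 1 - q * z ^ 2 ≠ 0 := n1 (by simpa [hz] using hq1)
  have k2 : 1 - q ^ 2 * z ^ 2 ≠ 0 := n1 (by simpa [hz] using hq2)
  have e : ∀ x : ℂ, qPochInf (x * z) q = (1 - x * z) * qPochInf (x * q * z) q := fun x => by
    rw [qPochInf_eq_mul hq1, show x * z * q = x * q * z by ring]
  have e' : ∀ x : ℂ, qPochInf (x / z) q = (1 - x / z) * qPochInf (x * q / z) q := fun x => by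
    rw [qPochInf_eq_mul hq1, show x / z * q = x * q / z by ring]
  have s1 : qPochInf (z ^ 2) q = (1 - z ^ 2) * qPochInf (q * z ^ 2) q := by
    rw [qPochInf_eq_mul hq1, mul_comm (z ^ 2)]
  have s2 : qPochInf (1 / z ^ 2) q = (1 - 1 / z ^ 2) * qPochInf (q / z ^ 2) q := by
    rw [qPochInf_eq_mul hq1, show 1 / z ^ 2 * q = q / z ^ 2 by ring]
  have s3 : qPochInf (q * z ^ 2) q =
      (1 - q * z ^ 2) * ((1 - q ^ 2 * z ^ 2) * qPochInf (q * (q * z) ^ 2) q) := by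
    rw [qPochInf_eq_mul hq1, qPochInf_eq_mul hq1 (q * z ^ 2 * q)]
    ring_nf
  have s4 : qPochInf (1 / (q * z) ^ 2) q = (1 - 1 / (q * z) ^ 2) * ((1 - 1 / (q * z ^ 2)) *
      ((1 - 1 / z ^ 2) * qPochInf (q / z ^ 2) q)) := by
    rw [qPochInf_eq_mul hq1, qPochInf_eq_mul hq1 (1 / (q * z) ^ 2 * q),
      qPochInf_eq_mul hq1 (1 / (q * z) ^ 2 * q * q)]
    rw [show 1 / (q * z) ^ 2 * q = 1 / (q * z ^ 2) by field_simp,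
      show 1 / (q * z ^ 2) * q = 1 / z ^ 2 by field_simp, show 1 / z ^ 2 * q = q / z ^ 2 by ring]
  have s5 : ∀ x : ℂ, qPochInf (x * (q * z)) q = qPochInf (x * q * z) q := fun x => by ring_nf
  have s6 : ∀ x : ℂ, qPochInf (x * q / (q * z)) q = (1 - x / z) * qPochInf (x * q / z) q :=
    fun x => by rw [← e', show x * q / (q * z) = x / z by field_simp]
  have p1 : ∀ {x : ℂ}, ‖x‖ < 1 → qPochInf (x * q * z) q ≠ 0 := fun hx =>
    qPochInf_ne_zero_of_norm_lt hq hq1 (by rw [norm_mul, hz, mul_one]; exact norm_mul_lt_one hx hq1)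
  have p2 : ∀ {x : ℂ}, ‖x‖ < 1 → qPochInf (x * q / z) q ≠ 0 := fun hx =>
    qPochInf_ne_zero_of_norm_lt hq hq1 (by rw [norm_div, hz, div_one]; exact norm_mul_lt_one hx hq1)
  have p3 : qPochInf (q * (q * z) ^ 2) q ≠ 0 := qPochInf_ne_zero_of_norm_lt hq hq1 (by
    simpa [hz] using norm_mul_lt_one hq1 hq2)
  simp only [awWeight, awAux, qPochPM, s5, s6, s4, s1, s3, s2, e a, e b, e c, e d, e' a, e' b, e' c,
    e' d]
  have a1 := p1 ha
  have a2 := p2 ha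
  have b1 := p1 hb
  have b2 := p2 hb
  have c1 := p1 hc
  have c2 := p2 hc
  have d1 := p1 hd
  have d2 := p2 hd
  generalize qPochInf (a * q * z) q = A1 at *
  generalize qPochInf (a * q / z) q = A2 at *
  generalize qPochInf (b * q * z) q = B1 at *
  generalize qPochInf (b * q / z) q = B2 at *
  generalize qPochInf (c * q * z) q = C1 at *
  generalize qPochInf (c * q / z) q = C2 at *
  generalize qPochInf (d * q * z) q = D1 at *
  generalize qPochInf (d * q / z) q = D2 at *
  generalize qPochInf (q * (q * z) ^ 2) q = E1 at *
  generalize qPochInf (q / z ^ 2) q = E2 at *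
  have := m1 ha
  have := m1 hb
  have := m1 hc
  have := m1 hd
  have := m2' ha
  have := m2' hb
  have := m2' hc
  have := m2' hd
  field_simp
  ring

theorem continuousOn_awWeight (hq : q ≠ 0) (hq1 : ‖q‖ < 1) {X : Type*} [TopologicalSpace X]
    {a b c d z : X → ℂ} {s : Set X} (ha : ContinuousOn a s) (hb : ContinuousOn b s)
    (hc : ContinuousOn c s) (hd : ContinuousOn d s) (hz : ContinuousOn z s)
    (ha1 : ∀ x ∈ s, ‖a x‖ < 1) (hb1 : ∀ x ∈ s, ‖b x‖ < 1) (hc1 : ∀ x ∈ s, ‖c x‖ < 1)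
    (hd1 : ∀ x ∈ s, ‖d x‖ < 1) (hz1 : ∀ x ∈ s, ‖z x‖ = 1) :
    ContinuousOn (fun x => awWeight q (a x) (b x) (c x) (d x) (z x)) s := by
  have hz0 : ∀ x ∈ s, z x ≠ 0 := fun x hx => ne_zero_of_norm_eq_one (hz1 x hx)
  refine ContinuousOn.div ?_ ?_ ?_
  · exact (continuousOn_qPochInf_comp hq1 (hz.pow 2)).mul (continuousOn_qPochInf_comp hq1
      (continuousOn_const.div (hz.pow 2) fun x hx => pow_ne_zero 2 (hz0 x hx)))
  · exact (((continuousOn_qPochPM_comp hq1 ha hz hz0).mul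
      (continuousOn_qPochPM_comp hq1 hb hz hz0)).mul
      (continuousOn_qPochPM_comp hq1 hc hz hz0)).mul (continuousOn_qPochPM_comp hq1 hd hz hz0)
  · intro x hx
    exact mul_ne_zero (mul_ne_zero (mul_ne_zero (qPochPM_ne_zero hq hq1 (ha1 x hx) (hz1 x hx))
      (qPochPM_ne_zero hq hq1 (hb1 x hx) (hz1 x hx)))
      (qPochPM_ne_zero hq hq1 (hc1 x hx) (hz1 x hx)))
      (qPochPM_ne_zero hq hq1 (hd1 x hx) (hz1 x hx))

theorem circleIntegrable_awWeight (hq : q ≠ 0) (hq1 : ‖q‖ < 1) {a b c d : ℂ} (ha : ‖a‖ < 1)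
    (hb : ‖b‖ < 1) (hc : ‖c‖ < 1) (hd : ‖d‖ < 1) : CircleIntegrable (awWeight q a b c d) 0 1 :=
  ContinuousOn.circleIntegrable zero_le_one <|
    continuousOn_awWeight hq hq1 continuousOn_const continuousOn_const continuousOn_const
      continuousOn_const continuousOn_id (fun _ _ => ha) (fun _ _ => hb) (fun _ _ => hc)
      (fun _ _ => hd) fun x hx => by simpa using hx

/-- The factors (az; q)_∞ vanish only for |z| > 1 and (aq/z; q)_∞ only for |z| < |q|. The extra q in
the second argument is what clears the closed annulus of poles. -/
theorem differentiableAt_awAux (hq : q ≠ 0) (hq1 : ‖q‖ < 1) {a b c d z : ℂ} (ha : ‖a‖ < 1)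
    (hb : ‖b‖ < 1) (hc : ‖c‖ < 1) (hd : ‖d‖ < 1) (hzq : ‖q‖ ≤ ‖z‖) (hz1 : ‖z‖ ≤ 1) :
    DifferentiableAt ℂ (awAux q a b c d) z := by
  have hz0 : z ≠ 0 := norm_pos_iff.1 ((norm_pos_iff.2 hq).trans_le hzq)
  have k : ∀ {x : ℂ}, ‖x‖ < 1 → qPochInf (x * z) q * qPochInf (x * q / z) q ≠ 0 := fun {x} hx => by
    refine mul_ne_zero (qPochInf_ne_zero_of_norm_lt hq hq1 ?_)
      (qPochInf_ne_zero_of_norm_lt hq hq1 ?_)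
    · rw [norm_mul]
      exact mul_lt_one_of_nonneg_of_lt_one_left (norm_nonneg _) hx hz1
    · rw [norm_div, norm_mul, div_lt_one (norm_pos_iff.2 hz0)]
      exact (mul_lt_of_lt_one_left (norm_pos_iff.2 hq) hx).trans_le hzq
  have kd : ∀ x : ℂ, DifferentiableAt ℂ
      (fun z => qPochInf (x * z) q * qPochInf (x * q / z) q) z := fun x =>
    (differentiableAt_qPochInf_comp hq1 (by fun_prop)).mul
      (differentiableAt_qPochInf_comp hq1 ((differentiableAt_const _).div differentiableAt_id hz0))
  refine DifferentiableAt.div (DifferentiableAt.mul (by fun_prop) (DifferentiableAt.mul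
    (differentiableAt_qPochInf_comp hq1 (by fun_prop)) (differentiableAt_qPochInf_comp hq1
      ((differentiableAt_const _).div (by fun_prop) (pow_ne_zero 2 hz0)))))
    ((((kd a).mul (kd b)).mul (kd c)).mul (kd d))
    (mul_ne_zero (mul_ne_zero (mul_ne_zero (k ha) (k hb)) (k hc)) (k hd))

/-- The averages of `awAux` over |z| = 1 and |z| = |q| agree by Cauchy's theorem on the annulus, so
the q-difference drops out. -/
theorem awIntegral_shift (hq : q ≠ 0) (hq1 : ‖q‖ < 1) {a b c d : ℂ} (ha : ‖a‖ < 1) (hb : ‖b‖ < 1)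
    (hc : ‖c‖ < 1) (hd : ‖d‖ < 1) :
    (1 - a * b * c * d) * awIntegral q (a * q) b c d =
      (1 - a * b) * (1 - a * c) * (1 - a * d) * awIntegral q a b c d := by
  have hdiff : ∀ z : ℂ, ‖q‖ ≤ ‖z‖ → ‖z‖ ≤ 1 → DifferentiableAt ℂ (awAux q a b c d) z :=
    fun z => differentiableAt_awAux hq hq1 ha hb hc hd
  have hg : circleAverage (awAux q a b c d) 0 1 =
      circleAverage (fun z => awAux q a b c d (q * z)) 0 1 := by
    rw [circleAverage_comp_mul_left]
    exact circleAverage_eq_of_differentiableAt (norm_pos_iff.2 hq) hq1.le hdiff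
  have i1 : CircleIntegrable (awAux q a b c d) 0 1 :=
    ContinuousOn.circleIntegrable zero_le_one fun z hz => by
      have hz : ‖z‖ = 1 := by simpa using hz
      exact (hdiff z (hz ▸ hq1.le) hz.le).continuousAt.continuousWithinAt
  have i2 : CircleIntegrable (fun z => awAux q a b c d (q * z)) 0 1 :=
    ContinuousOn.circleIntegrable zero_le_one fun z hz => by
      have hz : ‖q * z‖ = ‖q‖ := by
        have : ‖z‖ = 1 := by simpa using hz
        rw [norm_mul, this, mul_one]
      exact ContinuousAt.continuousWithinAt (ContinuousAt.comp (f := fun z => q * z)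
        (hdiff (q * z) hz.ge (hz ▸ hq1.le)).continuousAt (by fun_prop))
  have i3 := circleIntegrable_awWeight hq hq1 ha hb hc hd
  have e := circleAverage_congr_sphere (c := 0) (R := 1)
    (f₁ := (1 - a * b * c * d) • awWeight q (a * q) b c d)
    (f₂ := ((1 - a * b) * (1 - a * c) * (1 - a * d)) • awWeight q a b c d +
      a • (awAux q a b c d - fun z => awAux q a b c d (q * z)))
    (fun z hz => awWeight_shift hq hq1 ha hb hc hd (by simpa using hz))
  rw [circleAverage_add i3.const_smul (i1.sub i2).const_smul, circleAverage_smul,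
    circleAverage_smul, circleAverage_smul, circleAverage_sub i1 i2, hg, sub_self, smul_zero,
    add_zero] at e
  exact e

/-- Cyclic symmetry transports the shift of the first parameter to the other three. -/
theorem awWeight_rotate (q a b c d : ℂ) : awWeight q b c d a = awWeight q a b c d := by
  ext z
  simp only [awWeight]
  ring_nf

/-- The Askey--Wilson integral divided by its product side; this turns out to be constant. -/
def awNormalized (q a b c d : ℂ) : ℂ :=
  awIntegral q a b c d * (qPochInf (a * b) q * qPochInf (a * c) q * qPochInf (a * d) q *
    qPochInf (b * c) q * qPochInf (b * d) q * qPochInf (c * d) q) / qPochInf (a * b * c * d) q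

theorem awNormalized_rotate (q a b c d : ℂ) : awNormalized q b c d a = awNormalized q a b c d := by
  simp only [awNormalized, awIntegral, awWeight_rotate]
  rw [mul_comm b a, mul_comm c a, mul_comm d a, show b * c * d * a = a * b * c * d by ring]
  ring

theorem awNormalized_shift (hq : q ≠ 0) (hq1 : ‖q‖ < 1) {a b c d : ℂ} (ha : ‖a‖ < 1)
    (hb : ‖b‖ < 1) (hc : ‖c‖ < 1) (hd : ‖d‖ < 1) :
    awNormalized q (a * q) b c d = awNormalized q a b c d := by
  have h := awIntegral_shift hq hq1 ha hb hc hd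
  have hab := norm_mul_lt_one ha hb
  have habcd := norm_mul_lt_one (norm_mul_lt_one hab hc) hd
  have h0 := qPochInf_ne_zero_of_norm_lt hq hq1 habcd
  have e : ∀ x : ℂ, qPochInf (a * x) q = (1 - a * x) * qPochInf (a * q * x) q := fun x => by
    rw [qPochInf_eq_mul hq1, show a * x * q = a * q * x by ring]
  have e4 : qPochInf (a * b * c * d) q = (1 - a * b * c * d) * qPochInf (a * q * b * c * d) q := by
    rw [qPochInf_eq_mul hq1, show a * b * c * d * q = a * q * b * c * d by ring]
  rw [e4] at h0
  have h1 := left_ne_zero_of_mul h0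
  have h2 := right_ne_zero_of_mul h0
  simp only [awNormalized, e4, e b, e c, e d]
  rw [div_eq_div_iff h2 h0]
  linear_combination (qPochInf (a * q * b) q * qPochInf (a * q * c) q * qPochInf (a * q * d) q *
    qPochInf (b * c) q * qPochInf (b * d) q * qPochInf (c * d) q) * qPochInf (a * q * b * c * d) q * h

theorem awNormalized_mul_pow (hq : q ≠ 0) (hq1 : ‖q‖ < 1) {a b c d : ℂ} (ha : ‖a‖ < 1)
    (hb : ‖b‖ < 1) (hc : ‖c‖ < 1) (hd : ‖d‖ < 1) (n : ℕ) :
    awNormalized q (q ^ n * a) (q ^ n * b) (q ^ n * c) (q ^ n * d) = awNormalized q a b c d := by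
  have k : ∀ {x : ℂ} (n : ℕ), ‖x‖ < 1 → ‖q ^ n * x‖ < 1 := fun n hx => by
    rw [norm_mul, norm_pow]
    exact mul_lt_one_of_nonneg_of_lt_one_right (pow_le_one₀ (norm_nonneg _) hq1.le)
      (norm_nonneg _) hx
  induction n with
  | zero => simp
  | succ n ih =>
    have e : ∀ x : ℂ, q ^ (n + 1) * x = q ^ n * x * q := fun x => by ring
    have k' : ∀ {x : ℂ}, ‖x‖ < 1 → ‖q ^ n * x * q‖ < 1 := fun hx => norm_mul_lt_one (k n hx) hq1
    rw [← ih]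
    simp only [e]
    rw [awNormalized_shift hq hq1 (k n ha) (k' hb) (k' hc) (k' hd), ← awNormalized_rotate,
      awNormalized_shift hq hq1 (k n hb) (k' hc) (k' hd) (k n ha), ← awNormalized_rotate,
      awNormalized_shift hq hq1 (k n hc) (k' hd) (k n ha) (k n hb), ← awNormalized_rotate,
      awNormalized_shift hq hq1 (k n hd) (k n ha) (k n hb) (k n hc), ← awNormalized_rotate]

/-- Along (ta, tb, tc, td) the normalized integral takes the same value at every t = qⁿ and is
continuous at t = 0. -/
theorem awNormalized_eq_zero_params (hq : q ≠ 0) (hq1 : ‖q‖ < 1) {a b c d : ℂ} (ha : ‖a‖ < 1)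
    (hb : ‖b‖ < 1) (hc : ‖c‖ < 1) (hd : ‖d‖ < 1) :
    awNormalized q a b c d = awNormalized q 0 0 0 0 := by
  set U : Set ℂ := {t | ‖t * a‖ < 1 ∧ ‖t * b‖ < 1 ∧ ‖t * c‖ < 1 ∧ ‖t * d‖ < 1}
  have hU : IsOpen U := by
    have : ∀ x : ℂ, IsOpen {t : ℂ | ‖t * x‖ < 1} := fun x =>
      isOpen_lt (by fun_prop) continuous_const
    exact (this a).inter ((this b).inter ((this c).inter (this d)))
  have h0 : (0 : ℂ) ∈ U := by simp [U]
  have hI : DifferentiableOn ℂ (fun t => awIntegral q (t * a) (t * b) (t * c) (t * d)) U := by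
    refine differentiableOn_circleAverage hU ?_ fun z hz => ?_
    · refine continuousOn_awWeight hq hq1 (by fun_prop) (by fun_prop) (by fun_prop) (by fun_prop)
        (by fun_prop) (fun x hx => hx.1.1) (fun x hx => hx.1.2.1) (fun x hx => hx.1.2.2.1)
        (fun x hx => hx.1.2.2.2) fun x hx => by simpa using hx.2
    · have hz : ‖z‖ = 1 := by simpa using hz
      refine (differentiableOn_const _).div ((((differentiableOn_qPochPM hq1 (by fun_prop) z).mul
        (differentiableOn_qPochPM hq1 (by fun_prop) z)).mul
        (differentiableOn_qPochPM hq1 (by fun_prop) z)).mul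
        (differentiableOn_qPochPM hq1 (by fun_prop) z)) fun t ht => ?_
      exact mul_ne_zero (mul_ne_zero (mul_ne_zero (qPochPM_ne_zero hq hq1 ht.1 hz)
        (qPochPM_ne_zero hq hq1 ht.2.1 hz)) (qPochPM_ne_zero hq hq1 ht.2.2.1 hz))
        (qPochPM_ne_zero hq hq1 ht.2.2.2 hz)
  have hcI := (hI.differentiableAt (hU.mem_nhds h0)).continuousAt
  have hcont : ContinuousAt
      (fun t => awNormalized q (t * a) (t * b) (t * c) (t * d)) 0 := by
    have hc : Continuous fun x => qPochInf x q := (differentiable_qPochInf hq1).continuous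
    refine ContinuousAt.div (hcI.mul (Continuous.continuousAt (by fun_prop)))
      (Continuous.continuousAt (by fun_prop)) (by simp [qPochInf_zero])
  have ht := hcont.tendsto.comp (tendsto_pow_atTop_nhds_zero_of_norm_lt_one hq1)
  have ht2 : Tendsto ((fun t => awNormalized q (t * a) (t * b) (t * c) (t * d)) ∘ fun n : ℕ => q ^ n)
      atTop (𝓝 (awNormalized q a b c d)) :=
    tendsto_const_nhds.congr fun n => (awNormalized_mul_pow hq hq1 ha hb hc hd n).symm
  simpa using tendsto_nhds_unique ht2 ht

/-- With base r one has (x²; r²)_∞ = (x; r)_∞ (-x; r)_∞, and (y; r)_∞ splits into even and odd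
factors as (y; q)_∞ (ry; q)_∞. -/
theorem qPochInf_sq (hq1 : ‖q‖ < 1) {r : ℂ} (hr : r ^ 2 = q) (x : ℂ) :
    qPochInf (x ^ 2) q =
      qPochInf x q * qPochInf (-x) q * (qPochInf (r * x) q * qPochInf (-(r * x)) q) := by
  have hr1 : ‖r‖ < 1 := by
    rw [← hr, norm_pow] at hq1
    exact (pow_lt_one_iff_of_nonneg (norm_nonneg r) two_ne_zero).1 hq1
  have h1 : ∀ y : ℂ, qPochInf y r = qPochInf y q * qPochInf (r * y) q := fun y => by
    have := tprod_even_mul_odd (f := fun n : ℕ => 1 - y * r ^ n)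
      (by simpa [pow_mul, hr] using multipliable_qPochInf hq1 y)
      ((multipliable_qPochInf hq1 (r * y)).congr fun n => by
        rw [pow_succ, pow_mul, hr]
        ring)
    rw [qPochInf, ← this, qPochInf, qPochInf]
    congr 1
    · simp [pow_mul, hr]
    · refine tprod_congr fun n => ?_
      rw [pow_succ, pow_mul, hr]
      ring
  have h2 : qPochInf (x ^ 2) q = qPochInf x r * qPochInf (-x) r := by
    rw [qPochInf, qPochInf, qPochInf,
      ← (multipliable_qPochInf hr1 x).tprod_mul (multipliable_qPochInf hr1 (-x))]
    refine tprod_congr fun n => ?_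
    rw [← hr]
    ring
  rw [h2, h1, h1]
  ring_nf

/-- The average of a Laurent polynomial is its constant term. -/
theorem circleAverage_one_sub_sq_mul :
    circleAverage (fun z : ℂ => (1 - z ^ 2) * (1 - 1 / z ^ 2)) 0 1 = 2 := by
  have hm : ∀ n : ℤ, n ≠ 0 → circleAverage (fun z : ℂ => z ^ n) 0 1 = 0 := by
    intro n hn
    rw [circleAverage_eq_circleIntegral one_ne_zero]
    have : (∮ z in C(0, 1), (z - 0)⁻¹ • z ^ n) = ∮ z in C(0, 1), (z - 0) ^ (n - 1) := by
      refine circleIntegral.integral_congr zero_le_one fun z hz => ?_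
      have hz0 : z ≠ 0 := ne_zero_of_norm_eq_one (by simpa using hz)
      simp only [sub_zero, smul_eq_mul]
      rw [zpow_sub_one₀ hz0, mul_comm]
    rw [this, circleIntegral.integral_sub_zpow_of_ne (by omega), smul_zero]
  have hi : ∀ n : ℤ, CircleIntegrable (fun z : ℂ => z ^ n) 0 1 := fun n =>
    ContinuousOn.circleIntegrable zero_le_one fun z hz =>
      ((continuousAt_zpow₀ z n) (.inl (ne_zero_of_norm_eq_one (by simpa using
        hz)))).continuousWithinAt
  have e := circleAverage_congr_sphere (c := 0) (R := 1)
    (f₁ := fun z : ℂ => (1 - z ^ 2) * (1 - 1 / z ^ 2))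
    (f₂ := ((fun _ : ℂ => (2 : ℂ)) - fun z : ℂ => z ^ (2 : ℤ)) - fun z : ℂ => z ^ (-2 : ℤ))
    (fun z hz => by
      have hz0 : z ≠ 0 := ne_zero_of_norm_eq_one (by simpa using hz)
      simp only [Pi.sub_apply, zpow_neg]
      norm_cast
      field_simp
      ring)
  have h2 : CircleIntegrable (fun _ : ℂ => (2 : ℂ)) 0 1 := circleIntegrable_const _ _ _
  rw [e, circleAverage_sub (h2.sub (hi 2)) (hi _), circleAverage_sub h2 (hi 2), hm 2 (by norm_num),
    hm (-2) (by norm_num), circleAverage_const]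
  simp

/-- At (q, -q, r, -r) with r² = q, the duplication formula cancels every factor of the weight but (1
- z²)(1 - z⁻²). The product side is then simplified with Euler's identity (r, -r, -q; q)_∞ = 1. -/
theorem awNormalized_zero_params (hq : q ≠ 0) (hq1 : ‖q‖ < 1) :
    awNormalized q 0 0 0 0 = 2 / qPochInf q q := by
  obtain ⟨r, hr⟩ := IsAlgClosed.exists_pow_nat_eq q zero_lt_two
  have hr1 : ‖r‖ < 1 := by
    rw [← hr, norm_pow] at hq1
    exact (pow_lt_one_iff_of_nonneg (norm_nonneg r) two_ne_zero).1 hq1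
  have hnq : ‖-q‖ < 1 := by rwa [norm_neg]
  have hnr : ‖-r‖ < 1 := by rwa [norm_neg]
  have split : ∀ x : ℂ, qPochInf (x ^ 2) q = (1 - x ^ 2) * (qPochInf (q * x) q *
      qPochInf (-q * x) q * qPochInf (r * x) q * qPochInf (-r * x) q) := fun x => by
    rw [qPochInf_sq hq1 hr, qPochInf_eq_mul hq1 x, qPochInf_eq_mul hq1 (-x), mul_comm x q,
      show -x * q = -q * x by ring, show -(r * x) = -r * x by ring]
    ring
  have hI : awIntegral q q (-q) r (-r) = 2 := by
    rw [awIntegral, ← circleAverage_one_sub_sq_mul]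
    refine circleAverage_congr_sphere fun z hz => ?_
    have hz : ‖z‖ = 1 := by simpa using hz
    have n : ∀ {x : ℂ}, ‖x‖ < 1 → qPochPM x q z ≠ 0 := fun hx => qPochPM_ne_zero hq hq1 hx hz
    have hne := mul_ne_zero (mul_ne_zero (mul_ne_zero (n hq1) (n hnq)) (n hr1)) (n hnr)
    simp only [awWeight]
    rw [div_eq_iff hne, show 1 / z ^ 2 = (1 / z) ^ 2 by ring, split, split]
    simp only [qPochPM]
    ring_nf
  rw [← awNormalized_eq_zero_params hq hq1 hq1 hnq hr1 hnr, awNormalized, hI]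
  have hqq := qPochInf_ne_zero_of_norm_lt hq hq1 hq1
  have euler : qPochInf r q * qPochInf (-r) q * qPochInf (-q) q = 1 := by
    have := qPochInf_sq hq1 hr r
    rw [hr, show r * r = q by rw [← hr]; ring] at this
    refine mul_left_cancel₀ hqq ?_
    linear_combination -this
  have e3 : qPochInf q q = (1 - q) * ((1 - q * q) * qPochInf (q * -q * r * -r) q) := by
    rw [qPochInf_eq_mul hq1, qPochInf_eq_mul hq1 (q * q),
      show q * -q * r * -r = q * q * q by rw [← hr]; ring]
  have f1 : qPochInf (-q) q = (1 + q) * qPochInf (q * -q) q := by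
    rw [qPochInf_eq_mul hq1, show -q * q = q * -q by ring]; ring
  have f2 : qPochInf r q = (1 - r) * qPochInf (q * r) q := by
    rw [qPochInf_eq_mul hq1, mul_comm r q]
  have f3 : qPochInf (-r) q = (1 + r) * qPochInf (q * -r) q := by
    rw [qPochInf_eq_mul hq1, show -r * q = q * -r by ring]; ring
  have f4 : qPochInf (r * -r) q = (1 + q) * qPochInf (q * -q) q := by
    rw [← f1, show r * -r = -q by rw [← hr]; ring]
  rw [e3] at hqq
  rw [f1, f2, f3] at euler
  rw [show -q * r = q * -r by ring, show -q * -r = q * r by ring, f4,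
    div_eq_div_iff (right_ne_zero_of_mul (right_ne_zero_of_mul hqq)) (by rw [e3]; exact hqq), e3]
  have hrq : (1 - r) * (1 + r) = 1 - q := by rw [← hr]; ring
  generalize qPochInf (q * -q) q = X at *
  generalize qPochInf (q * r) q = Y at *
  generalize qPochInf (q * -r) q = Z at *
  have eu : (1 - q) * (1 + q) * X * Y * Z = 1 := by
    rw [← hrq]
    linear_combination euler
  generalize qPochInf (q * -q * r * -r) q = T at *
  -- Euler's product u enters squared, and u² - 1 = (u + 1)(u - 1).
  linear_combination (2 * T * ((1 - q) * (1 + q) * X * Y * Z + 1)) * eu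

theorem awIntegral_eq (hq : q ≠ 0) (hq1 : ‖q‖ < 1) {a b c d : ℂ} (ha : ‖a‖ < 1)
    (hb : ‖b‖ < 1) (hc : ‖c‖ < 1) (hd : ‖d‖ < 1) :
    awIntegral q a b c d = 2 * qPochInf (a * b * c * d) q /
      (qPochInf q q * (qPochInf (a * b) q * qPochInf (a * c) q * qPochInf (a * d) q *
        qPochInf (b * c) q * qPochInf (b * d) q * qPochInf (c * d) q)) := by
  have h := awNormalized_eq_zero_params hq hq1 ha hb hc hd
  rw [awNormalized_zero_params hq hq1, awNormalized] at h
  have n := fun {x y : ℂ} (hx : ‖x‖ < 1) (hy : ‖y‖ < 1) =>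
    qPochInf_ne_zero_of_norm_lt hq hq1 (norm_mul_lt_one hx hy)
  have h1 := n (norm_mul_lt_one (norm_mul_lt_one ha hb) hc) hd
  have h2 := qPochInf_ne_zero_of_norm_lt hq hq1 hq1
  have h3 := mul_ne_zero (mul_ne_zero (mul_ne_zero (mul_ne_zero (mul_ne_zero (n ha hb) (n ha hc))
    (n ha hd)) (n hb hc)) (n hb hd)) (n hc hd)
  rw [div_eq_div_iff h1 h2] at h
  rw [eq_div_iff (mul_ne_zero h2 h3)]
  linear_combination h

end AskeyWilson

/-! ### Contiguous relations for the Nassrallah–Rahman integral and for its series. -/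

section NassrallahRahman

open Metric Real

variable {q : ℂ}

/-- The Nassrallah--Rahman weight. -/
def nrWeight (q l : ℂ) (a : Fin 5 → ℂ) (z : ℂ) : ℂ :=
  qPochInf (z ^ 2) q * qPochInf (1 / z ^ 2) q * qPochPM l q z / ∏ i, qPochPM (a i) q z

/-- The Nassrallah--Rahman integral, as an average over the unit circle. -/
def nrIntegral (q l : ℂ) (a : Fin 5 → ℂ) : ℂ := circleAverage (nrWeight q l a) 0 1

theorem continuousOn_nrWeight (hq : q ≠ 0) (hq1 : ‖q‖ < 1) {X : Type*} [TopologicalSpace X]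
    {a : X → Fin 5 → ℂ} {z : X → ℂ} {s : Set X} (l : ℂ) (ha : ∀ i, ContinuousOn (fun x => a x i) s)
    (hz : ContinuousOn z s) (ha1 : ∀ x ∈ s, ∀ i, ‖a x i‖ < 1) (hz1 : ∀ x ∈ s, ‖z x‖ = 1) :
    ContinuousOn (fun x => nrWeight q l (a x) (z x)) s := by
  have hz0 : ∀ x ∈ s, z x ≠ 0 := fun x hx => ne_zero_of_norm_eq_one (hz1 x hx)
  refine ContinuousOn.div ?_ ?_ ?_
  · exact ((continuousOn_qPochInf_comp hq1 (hz.pow 2)).mul (continuousOn_qPochInf_comp hq1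
      (continuousOn_const.div (hz.pow 2) fun x hx => pow_ne_zero 2 (hz0 x hx)))).mul
      (continuousOn_qPochPM_comp hq1 continuousOn_const hz hz0)
  · exact continuousOn_finsetProd _ fun i _ => continuousOn_qPochPM_comp hq1 (ha i) hz hz0
  · exact fun x hx => Finset.prod_ne_zero_iff.2 fun i _ =>
      qPochPM_ne_zero hq hq1 (ha1 x hx i) (hz1 x hx)

theorem circleIntegrable_nrWeight (hq : q ≠ 0) (hq1 : ‖q‖ < 1) (l : ℂ) {a : Fin 5 → ℂ}
    (ha : ∀ i, ‖a i‖ < 1) : CircleIntegrable (nrWeight q l a) 0 1 :=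
  ContinuousOn.circleIntegrable zero_le_one <|
    continuousOn_nrWeight hq hq1 l (fun _ => continuousOn_const) continuousOn_id
      (fun _ _ => ha) fun x hx => by simpa using hx

/-- The function (1 - lz)(1 - l/z) is affine in z + 1/z, hence a combination of the analogous
functions for c and d; the coefficients are found by putting z = d and z = c. -/
theorem nrWeight_contiguous (hq : q ≠ 0) (hq1 : ‖q‖ < 1) (l : ℂ) {a b c d e z : ℂ}
    (hc : ‖c‖ < 1) (hd : ‖d‖ < 1)
    (hc0 : c ≠ 0) (hd0 : d ≠ 0) (hcd : c ≠ d) (hz : ‖z‖ = 1) :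
    nrWeight q l ![a, b, c, d, e] z =
      (1 - l * d) * (1 - l / d) / ((1 - c * d) * (1 - c / d)) *
          nrWeight q (l * q) ![a, b, c * q, d, e] z +
        (1 - l * c) * (1 - l / c) / ((1 - c * d) * (1 - d / c)) *
          nrWeight q (l * q) ![a, b, c, d * q, e] z := by
  have hz0 := ne_zero_of_norm_eq_one hz
  have hc' := qPochPM_ne_zero hq hq1 hc hz
  have hd' := qPochPM_ne_zero hq hq1 hd hz
  simp only [nrWeight, Fin.prod_univ_five, Matrix.cons_val]
  rw [qPochPM_eq_mul hq1 c] at hc' ⊢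
  rw [qPochPM_eq_mul hq1 d] at hd' ⊢
  rw [qPochPM_eq_mul hq1 l]
  have hc1 := left_ne_zero_of_mul hc'
  have hc2 := right_ne_zero_of_mul hc'
  have hd1 := left_ne_zero_of_mul hd'
  have hd2 := right_ne_zero_of_mul hd'
  have hcd1 : 1 - c * d ≠ 0 := fun h => by
    have := norm_mul_lt_one hc hd
    rw [← sub_eq_zero.1 h] at this
    simp at this
  have hdc1 : 1 - d * c ≠ 0 := by rwa [mul_comm]
  have h3 : c - d ≠ 0 := sub_ne_zero.2 hcd
  have key : (1 - l * z) * (1 - l / z) =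
      (1 - l * d) * (1 - l / d) / ((1 - c * d) * (1 - c / d)) * ((1 - c * z) * (1 - c / z)) +
      (1 - l * c) * (1 - l / c) / ((1 - c * d) * (1 - d / c)) * ((1 - d * z) * (1 - d / z)) := by
    rw [show (1 - c / d) = - ((c - d) / d) by field_simp; ring,
      show (1 - d / c) = ((c - d) / c) by field_simp]
    field_simp
    ring
  rw [key]
  generalize (1 - l * d) * (1 - l / d) / ((1 - c * d) * (1 - c / d)) = C
  generalize (1 - l * c) * (1 - l / c) / ((1 - c * d) * (1 - d / c)) = D
  generalize (1 - c * z) * (1 - c / z) = c₀ at *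
  generalize (1 - d * z) * (1 - d / z) = d₀ at *
  -- Nothing bounds a, b, e here; if one of their products vanishes, all three weights are 0 by the
  -- convention for division.
  by_cases ha : qPochPM a q z = 0
  · simp [ha]
  by_cases hb : qPochPM b q z = 0
  · simp [hb]
  by_cases he : qPochPM e q z = 0
  · simp [he]
  field_simp

theorem nrIntegral_contiguous (hq : q ≠ 0) (hq1 : ‖q‖ < 1) (l : ℂ) {a b c d e : ℂ}
    (ha : ‖a‖ < 1) (hb : ‖b‖ < 1) (hc : ‖c‖ < 1) (hd : ‖d‖ < 1) (he : ‖e‖ < 1)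
    (hc0 : c ≠ 0) (hd0 : d ≠ 0) (hcd : c ≠ d) :
    nrIntegral q l ![a, b, c, d, e] =
      (1 - l * d) * (1 - l / d) / ((1 - c * d) * (1 - c / d)) *
          nrIntegral q (l * q) ![a, b, c * q, d, e] +
        (1 - l * c) * (1 - l / c) / ((1 - c * d) * (1 - d / c)) *
          nrIntegral q (l * q) ![a, b, c, d * q, e] := by
  have i1 : CircleIntegrable (nrWeight q (l * q) ![a, b, c * q, d, e]) 0 1 :=
    circleIntegrable_nrWeight hq hq1 _ (by
      have := norm_mul_lt_one hc hq1
      rw [norm_mul] at this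
      simp [Fin.forall_fin_succ, ha, hb, this, hd, he])
  have i2 : CircleIntegrable (nrWeight q (l * q) ![a, b, c, d * q, e]) 0 1 :=
    circleIntegrable_nrWeight hq hq1 _ (by
      have := norm_mul_lt_one hd hq1
      rw [norm_mul] at this
      simp [Fin.forall_fin_succ, ha, hb, this, hc, he])
  have h := circleAverage_congr_sphere (c := 0) (R := 1)
    (f₁ := nrWeight q l ![a, b, c, d, e])
    (f₂ := ((1 - l * d) * (1 - l / d) / ((1 - c * d) * (1 - c / d))) •
          nrWeight q (l * q) ![a, b, c * q, d, e] +
        ((1 - l * c) * (1 - l / c) / ((1 - c * d) * (1 - d / c))) •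
          nrWeight q (l * q) ![a, b, c, d * q, e])
    (fun z hz => nrWeight_contiguous hq hq1 l hc hd hc0 hd0 hcd (by simpa using hz))
  rw [circleAverage_add i1.const_smul i2.const_smul, circleAverage_smul, circleAverage_smul] at h
  exact h

/-- The terms of the very-well-poised series on the product side of the Nassrallah--Rahman
integral, multiplied by the infinite products that depend on `l`. -/
def nrTerm (q l a b c d e : ℂ) (m : ℕ) : ℂ :=
  (1 - l ^ 2 * q ^ (2 * m) / q) / (qPochInf (l ^ 2 * q ^ m / q) q * qPoch q q m) *
    ((qPochInf (l * a * q ^ m) q * qPoch (l / a) q m) *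
      (qPochInf (l * b * q ^ m) q * qPoch (l / b) q m) *
      (qPochInf (l * c * q ^ m) q * qPoch (l / c) q m) *
      (qPochInf (l * d * q ^ m) q * qPoch (l / d) q m) *
      (qPochInf (l * e * q ^ m) q * qPoch (l / e) q m)) * (a * b * c * d * e / l) ^ m

/-- Separates the infinite products from the series. In this form the numerator parameter l/e is
absorbed into ∏ (abcde/l - abcd qʲ), which still makes sense at e = 0. -/
theorem nrTerm_eq (hq : q ≠ 0) (hq1 : ‖q‖ < 1) {l a b c d e : ℂ} (hl : l ≠ 0) (he : e ≠ 0)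
    (hlq : ‖l ^ 2 / q‖ < 1) (hla : l * a ∉ Omega q) (hlb : l * b ∉ Omega q)
    (hlc : l * c ∉ Omega q) (hld : l * d ∉ Omega q) (hle : l * e ∉ Omega q) (m : ℕ) :
    nrTerm q l a b c d e m = qPochInf (l * a) q * qPochInf (l * b) q * qPochInf (l * c) q *
      qPochInf (l * d) q * qPochInf (l * e) q / qPochInf (l ^ 2) q *
      vwpTerm (l ^ 2 / q) ![l / a, l / b, l / c, l / d] ![l * a, l * b, l * c, l * d, l * e] q
        (a * b * c * d) (a * b * c * d * e / l) m := by
  have hb' : l ^ 2 / q ∉ Omega q := notMem_Omega_of_norm_lt hq hq1 hlq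
  have h1 : qPochInf (l ^ 2 / q) q = (1 - l ^ 2 / q) * qPochInf (l ^ 2) q := by
    rw [qPochInf_eq_mul hq1, div_mul_cancel₀ _ hq]
  have h2 := qPochInf_eq_qPoch_mul hq1 (l ^ 2 / q) m
  have n1 := qPochInf_ne_zero hq1 hb'
  have n2 := qPoch_ne_zero hb' m
  have n3 : qPochInf (l ^ 2 / q * q ^ m) q ≠ 0 := by
    rw [h2] at n1
    exact right_ne_zero_of_mul n1
  have n4 : 1 - l ^ 2 / q ≠ 0 := by
    rw [h1] at n1
    exact left_ne_zero_of_mul n1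
  have n5 : qPochInf (l ^ 2) q ≠ 0 := by
    rw [h1] at n1
    exact right_ne_zero_of_mul n1
  have hprod : ∏ j ∈ Finset.range m, (a * b * c * d * e / l - a * b * c * d * q ^ j) =
      qPoch (l / e) q m * (a * b * c * d * e / l) ^ m := by
    rw [qPoch, ← Finset.card_range m, ← Finset.prod_const, Finset.card_range,
      ← Finset.prod_mul_distrib]
    refine Finset.prod_congr rfl fun j _ => ?_
    field_simp
  have hx : ∀ {x : ℂ}, x ∉ Omega q → qPochInf (x * q ^ m) q = qPochInf x q / qPoch x q m := by
    intro x hx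
    rw [qPochInf_eq_qPoch_mul hq1 x m, mul_div_cancel_left₀ _ (qPoch_ne_zero hx m)]
  have h3 : (1 - l ^ 2 * q ^ (2 * m) / q) / qPochInf (l ^ 2 * q ^ m / q) q =
      (1 - l ^ 2 / q * q ^ (2 * m)) / (1 - l ^ 2 / q) * qPoch (l ^ 2 / q) q m /
        qPochInf (l ^ 2) q := by
    have h4 : ∀ X P J L Y : ℂ, X / Y * P / L * J = X * (P * J) / (Y * L) := fun X P J L Y => by
      ring
    rw [mul_div_right_comm _ (q ^ m), mul_div_right_comm _ (q ^ (2 * m)), div_eq_iff n3, h4, ← h2, h1,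
      mul_div_cancel_right₀ _ (mul_ne_zero n4 n5)]
  simp only [nrTerm, vwpTerm, Fin.prod_univ_five, Fin.prod_univ_four, Matrix.cons_val, hprod, hx hla,
    hx hlb, hx hlc, hx hld, hx hle, ← div_div, h3]
  ring

/-- The rational identity behind `nrTerm_add_nrCert` once the common shifted factorials are divided
out, with x = q^m and y = q^(m+1). It holds with x and y independent. -/
theorem contiguous_certificate {l a b c d e x y : ℂ} (hl : l ≠ 0) (ha : a ≠ 0) (hb : b ≠ 0) (hc : c ≠ 0)
    (hd : d ≠ 0) (he : e ≠ 0) (hcd : c ≠ d) (h1 : 1 - l ^ 2 * x ≠ 0) (h2 : 1 - y ≠ 0) :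
    a * b * c * d * e / l * (1 - l ^ 2 * x * y) / ((1 - l ^ 2 * x) * (1 - y)) *
      ((1 - l / a) * (1 - l / b) * (1 - l / e)) *
      ((1 - l * c * y) * (1 - l * x / c) * ((1 - l * d * y) * (1 - l * x / d))) +
    (1 - l * c) * (1 - l * d) / (1 - l ^ 2 * x) *
      ((1 - l * a * x) * (1 - l * b * x) * (1 - l * e * x)) * ((1 - l * c * y) * (1 - l * d * y)) =
    (1 - l ^ 2 * x * y) * ((1 - l * c * y) * (1 - l * x / c) * (1 - l * c) *
       ((1 - d * a) * (1 - d * b) * (1 - d * e)) / (1 - d / c) +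
       (1 - l * d * y) * (1 - l * x / d) * (1 - l * d) *
       ((1 - c * a) * (1 - c * b) * (1 - c * e)) / (1 - c / d)) +
    a * b * c * d * e / l * ((1 - l * c) * (1 - l * d)) / (1 - y) *
      ((1 - l * y / a) * (1 - l * y / b) * (1 - l * y / e)) * ((1 - l * x / c) * (1 - l * x / d)) := by
  have h3 : c - d ≠ 0 := sub_ne_zero.2 hcd
  rw [show (1 - c / d) = - ((c - d) / d) by field_simp; ring,
    show (1 - d / c) = ((c - d) / c) by field_simp]
  field_simp
  ring

/-- The certificate of the contiguous relation for the very-well-poised series. -/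
def nrCert (q l a b c d e : ℂ) (m : ℕ) : ℂ :=
  (1 - l * c) * (1 - l * d) * (a * b * c * d * e / l) ^ m /
      (qPochInf (l ^ 2 * q ^ m) q * qPoch q q m) *
    ((qPochInf (l * a * q ^ m) q * qPoch (l * q / a) q m) *
      (qPochInf (l * b * q ^ m) q * qPoch (l * q / b) q m) *
      (qPochInf (l * c * q ^ (m + 1)) q * qPoch (l / c) q m) *
      (qPochInf (l * d * q ^ (m + 1)) q * qPoch (l / d) q m) *
      (qPochInf (l * e * q ^ m) q * qPoch (l * q / e) q m))

/-- Creative telescoping: the contiguous relation holds termwise up to a difference of certificates.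
Index m + 1 faces index m because replacing l by lq turns l²q^(2m)/q into l²q^(2(m+1))/q. -/
theorem nrTerm_add_nrCert (hq : q ≠ 0) (hq1 : ‖q‖ < 1) {l a b c d e : ℂ} (hl : l ≠ 0)
    (ha : a ≠ 0) (hb : b ≠ 0) (hc : c ≠ 0) (hd : d ≠ 0) (he : e ≠ 0) (hcd : c ≠ d)
    (hlq : ‖l ^ 2 / q‖ < 1) (m : ℕ) :
    nrTerm q l a b c d e (m + 1) + nrCert q l a b c d e m =
      (1 - l * d) * (1 - l / d) / (1 - c / d) * ((1 - c * a) * (1 - c * b) * (1 - c * e)) *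
          nrTerm q (l * q) a b (c * q) d e m +
        (1 - l * c) * (1 - l / c) / (1 - d / c) * ((1 - d * a) * (1 - d * b) * (1 - d * e)) *
          nrTerm q (l * q) a b c (d * q) e m +
        nrCert q l a b c d e (m + 1) := by
  have hl2 : ‖l ^ 2‖ < 1 := by
    rw [norm_div, div_lt_one (norm_pos_iff.2 hq)] at hlq
    exact hlq.trans hq1
  have hqm : ∀ m : ℕ, ‖q ^ m‖ ≤ 1 := fun m => by
    rw [norm_pow]; exact pow_le_one₀ (norm_nonneg _) hq1.le
  have hlm : ∀ m : ℕ, l ^ 2 * q ^ m ∉ Omega q := fun m => notMem_Omega_of_norm_lt hq hq1 (by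
    rw [norm_mul]
    exact mul_lt_one_of_nonneg_of_lt_one_left (norm_nonneg _) hl2 (hqm m))
  have z1 : qPochInf (l ^ 2 * q ^ m) q =
      (1 - l ^ 2 * q ^ m) * qPochInf (l ^ 2 * q ^ (m + 1)) q := by
    rw [qPochInf_eq_mul hq1, mul_assoc (l ^ 2), ← pow_succ]
  have z2 : qPochInf (l ^ 2 * q ^ (m + 1) / q) q =
      (1 - l ^ 2 * q ^ m) * qPochInf (l ^ 2 * q ^ (m + 1)) q := by
    rw [← z1, show l ^ 2 * q ^ (m + 1) / q = l ^ 2 * q ^ m by field_simp; ring]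
  have z3 : qPochInf ((l * q) ^ 2 * q ^ m / q) q = qPochInf (l ^ 2 * q ^ (m + 1)) q := by
    rw [show (l * q) ^ 2 * q ^ m / q = l ^ 2 * q ^ (m + 1) by field_simp; ring]
  have z4 : 1 - l ^ 2 * q ^ (2 * (m + 1)) / q = 1 - l ^ 2 * q ^ m * q ^ (m + 1) := by
    field_simp; ring
  have z5 : 1 - (l * q) ^ 2 * q ^ (2 * m) / q = 1 - l ^ 2 * q ^ m * q ^ (m + 1) := by
    field_simp; ring
  have y1 : 1 - l ^ 2 * q ^ m ≠ 0 := by simpa using one_sub_ne_zero_of_notMem (hlm m) 0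
  have y2 : qPochInf (l ^ 2 * q ^ (m + 1)) q ≠ 0 := qPochInf_ne_zero hq1 (hlm (m + 1))
  have y3 : qPoch q q m ≠ 0 := qPoch_ne_zero (notMem_Omega_of_norm_lt hq hq1 hq1) m
  have y4 : qPoch q q (m + 1) = qPoch q q m * (1 - q ^ (m + 1)) := by
    rw [qPoch_succ, pow_succ']
  have y5 : 1 - q ^ (m + 1) ≠ 0 := by
    rw [pow_succ']
    exact one_sub_ne_zero_of_notMem (notMem_Omega_of_norm_lt hq hq1 hq1) m
  have w1 : ∀ x : ℂ, qPochInf (l * x * q ^ m) q =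
      (1 - l * x * q ^ m) * qPochInf (l * x * q ^ (m + 1)) q := fun x => by
    rw [qPochInf_eq_mul hq1, mul_assoc (l * x), ← pow_succ]
  have w2 : ∀ x : ℂ, qPochInf (l * x * q ^ (m + 1)) q =
      (1 - l * x * q ^ (m + 1)) * qPochInf (l * x * q ^ (m + 1 + 1)) q := fun x => by
    rw [qPochInf_eq_mul hq1, mul_assoc (l * x), ← pow_succ]
  have w3 : ∀ x : ℂ, qPochInf (l * q * x * q ^ m) q = qPochInf (l * x * q ^ (m + 1)) q :=
    fun x => by rw [show l * q * x * q ^ m = l * x * q ^ (m + 1) by ring]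
  have w4 : ∀ x : ℂ, qPochInf (l * (x * q) * q ^ (m + 1)) q =
      qPochInf (l * x * q ^ (m + 1 + 1)) q :=
    fun x => by rw [show l * (x * q) * q ^ (m + 1) = l * x * q ^ (m + 1 + 1) by ring]
  have v1 : ∀ x : ℂ, qPoch (l / x) q (m + 1) = (1 - l / x) * qPoch (l * q / x) q m := fun x => by
    rw [qPoch_succ', show l / x * q = l * q / x by ring]
  have v2 : ∀ x : ℂ, qPoch (l / x) q (m + 1) = qPoch (l / x) q m * (1 - l * q ^ m / x) :=
    fun x => by rw [qPoch_succ, show l / x * q ^ m = l * q ^ m / x by ring]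
  have v3 : ∀ x : ℂ, qPoch (l * q / x) q (m + 1) = qPoch (l * q / x) q m *
      (1 - l * q ^ (m + 1) / x) :=
    fun x => by rw [qPoch_succ, show l * q / x * q ^ m = l * q ^ (m + 1) / x by ring]
  have v4 : ∀ x : ℂ, qPoch (l * q / (x * q)) q m = qPoch (l / x) q m := fun x => by
    rw [mul_div_mul_right _ _ hq]
  have v5 : ∀ x : ℂ, (1 - l / x) * qPoch (l * q / x) q m =
      qPoch (l / x) q m * (1 - l * q ^ m / x) := fun x => by rw [← v1, v2]
  have t1 : a * b * (c * q) * d * e / (l * q) = a * b * c * d * e / l := by field_simp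
  have t2 : a * b * c * (d * q) * e / (l * q) = a * b * c * d * e / l := by field_simp
  have cert := contiguous_certificate hl ha hb hc hd he hcd y1 y5
  simp only [nrTerm, nrCert, z1, z2, z3, z4, z5, y4, w3, w4, v4, t1, t2, v3, w1 a, w1 b, w1 e, w2 c,
    w2 d, v1 a, v1 b, v1 e, v2 c, v2 d]
  -- For c and d both (l/x; q)_m and (lq/x; q)_m occur; these two relations reconcile them, and
  -- everything else is treated as independent symbols.
  have v5c := v5 c
  have v5d := v5 d
  clear * - v5c v5d cert
  rw [pow_succ (a * b * c * d * e / l) m]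
  generalize (a * b * c * d * e / l) ^ m = tm
  generalize a * b * c * d * e / l = t at *
  generalize qPochInf (l ^ 2 * q ^ (m + 1)) q = Z
  generalize qPoch q q m = Q
  generalize 1 - l ^ 2 * q ^ m * q ^ (m + 1) = u₁ at *
  generalize 1 - l ^ 2 * q ^ m = u₂ at *
  generalize 1 - q ^ (m + 1) = u₃ at *
  generalize 1 - l / a = ra at *
  generalize 1 - l / b = rb at *
  generalize 1 - l / c = rc at *
  generalize 1 - l / d = rd at *
  generalize 1 - l / e = re at *
  generalize 1 - l * c * q ^ (m + 1) = c₁ at *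
  generalize 1 - l * d * q ^ (m + 1) = d₁ at *
  generalize 1 - l * a * q ^ m = a₁ at *
  generalize 1 - l * b * q ^ m = b₁ at *
  generalize 1 - l * e * q ^ m = e₁ at *
  generalize 1 - l * q ^ m / c = c₂ at *
  generalize 1 - l * q ^ m / d = d₂ at *
  generalize 1 - l * q ^ (m + 1) / a = a₂ at *
  generalize 1 - l * q ^ (m + 1) / b = b₂ at *
  generalize 1 - l * q ^ (m + 1) / e = e₂ at *
  generalize 1 - l * c = c₃ at *
  generalize 1 - l * d = d₃ at *
  generalize (1 - c * a) * (1 - c * b) * (1 - c * e) = κc at *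
  generalize (1 - d * a) * (1 - d * b) * (1 - d * e) = κd at *
  generalize 1 - c / d = δ₁ at *
  generalize 1 - d / c = δ₂ at *
  generalize qPochInf (l * a * q ^ (m + 1)) q = A at *
  generalize qPochInf (l * b * q ^ (m + 1)) q = B at *
  generalize qPochInf (l * e * q ^ (m + 1)) q = E at *
  generalize qPochInf (l * c * q ^ (m + 1 + 1)) q = C at *
  generalize qPochInf (l * d * q ^ (m + 1 + 1)) q = D at *
  generalize qPoch (l * q / a) q m = Pa at *
  generalize qPoch (l * q / b) q m = Pb at *
  generalize qPoch (l * q / c) q m = Pc' at *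
  generalize qPoch (l * q / d) q m = Pd' at *
  generalize qPoch (l * q / e) q m = Pe at *
  generalize qPoch (l / c) q m = Pc at *
  generalize qPoch (l / d) q m = Pd at *
  linear_combination (A * B * C * D * E * Pa * Pb * Pc * Pd * Pe * tm / (Z * Q)) * cert -
    (d₃ / δ₁ * κc * u₁ / (Z * Q) * (A * Pa * B * Pb * C * Pc * d₁ * D * E * Pe) * tm) * v5d -
    (c₃ / δ₂ * κd * u₁ / (Z * Q) * (A * Pa * B * Pb * D * Pd * c₁ * C * E * Pe) * tm) * v5c

end NassrallahRahman

/-! ### Evaluation of the Nassrallah–Rahman integral. -/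

section NassrallahRahman

open Metric Real

variable {q : ℂ}

theorem norm_lt_one_of_sq_div (hq : q ≠ 0) (hq1 : ‖q‖ < 1) {l : ℂ} (hlq : ‖l ^ 2 / q‖ < 1) :
    ‖l‖ < 1 := by
  rw [norm_div, div_lt_one (norm_pos_iff.2 hq), norm_pow] at hlq
  exact (pow_lt_one_iff_of_nonneg (norm_nonneg l) two_ne_zero).1 (hlq.trans hq1)

theorem norm_mul_sq_div_lt_one (hq1 : ‖q‖ < 1) {l : ℂ} (hlq : ‖l ^ 2 / q‖ < 1) :
    ‖(l * q) ^ 2 / q‖ < 1 := by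
  rw [show (l * q) ^ 2 / q = (l ^ 2 / q) * (q * q) by ring]
  exact norm_mul_lt_one hlq (norm_mul_lt_one hq1 hq1)

theorem summable_nrTerm (hq : q ≠ 0) (hq1 : ‖q‖ < 1) {l a b c d e : ℂ} (hl : l ≠ 0) (he : e ≠ 0)
    (hlq : ‖l ^ 2 / q‖ < 1) (ha1 : ‖a‖ < 1) (hb1 : ‖b‖ < 1) (hc1 : ‖c‖ < 1) (hd1 : ‖d‖ < 1)
    (he1 : ‖e‖ < 1) (ht : ‖a * b * c * d * e / l‖ < 1) : Summable (nrTerm q l a b c d e) := by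
  have hl1 := norm_lt_one_of_sq_div hq hq1 hlq
  have n := fun {x : ℂ} (hx : ‖x‖ < 1) => notMem_Omega_of_norm_lt hq hq1 (norm_mul_lt_one hl1 hx)
  have := summable_vwpTerm hq1
    (fun n => one_sub_ne_zero_of_notMem (notMem_Omega_of_norm_lt hq hq1 hlq) (2 * n))
    ![l / a, l / b, l / c, l / d] ![l * a, l * b, l * c, l * d, l * e] (a * b * c * d) ht
  exact (this.mul_left _).congr fun m =>
    (nrTerm_eq hq hq1 hl he hlq (n ha1) (n hb1) (n hc1) (n hd1) (n he1) m).symm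

/-- The certificates have a term ratio with limit abcde/l as well, so they are even summable. -/
theorem tendsto_nrCert (hq : q ≠ 0) (hq1 : ‖q‖ < 1) {l a b c d e : ℂ}
    (hlq : ‖l ^ 2 / q‖ < 1) (ha1 : ‖a‖ < 1) (hb1 : ‖b‖ < 1) (hc1 : ‖c‖ < 1) (hd1 : ‖d‖ < 1)
    (he1 : ‖e‖ < 1) (ht : ‖a * b * c * d * e / l‖ < 1) :
    Tendsto (nrCert q l a b c d e) atTop (𝓝 0) := by
  have hl1 := norm_lt_one_of_sq_div hq hq1 hlq
  refine (summable_of_ratio hq1 (R := fun x => a * b * c * d * e / l * (1 - l ^ 2 * x) /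
    (1 - q * x) * (((1 - l * q / a * x) / (1 - l * a * x)) * ((1 - l * q / b * x) / (1 - l * b * x)) *
    ((1 - l / c * x) / (1 - l * c * q * x)) * ((1 - l / d * x) / (1 - l * d * q * x)) *
    ((1 - l * q / e * x) / (1 - l * e * x)))) ?_ (by simpa using ht) fun m => ?_).tendsto_atTop_zero
  · fun_prop (disch := simp)
  · have w1 : ∀ {x : ℂ}, ‖x‖ < 1 → qPochInf (l * x * q ^ (m + 1)) q =
        qPochInf (l * x * q ^ m) q / (1 - l * x * q ^ m) := fun {x} hx => by
      rw [qPochInf_eq_mul hq1 (l * x * q ^ m), mul_div_cancel_left₀, pow_succ, mul_assoc (l * x)]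
      exact one_sub_ne_zero_of_notMem (notMem_Omega_of_norm_lt hq hq1 (norm_mul_lt_one hl1 hx)) m
    have w2 : ∀ {x : ℂ}, ‖x‖ < 1 → qPochInf (l * x * q ^ (m + 1 + 1)) q =
        qPochInf (l * x * q ^ (m + 1)) q / (1 - l * x * q * q ^ m) := fun {x} hx => by
      rw [qPochInf_eq_mul hq1 (l * x * q ^ (m + 1)), show l * x * q * q ^ m = l * x * q ^ (m + 1) by
        ring, mul_div_cancel_left₀, pow_succ _ (m + 1), mul_assoc (l * x)]
      exact one_sub_ne_zero_of_notMem (notMem_Omega_of_norm_lt hq hq1 (norm_mul_lt_one hl1 hx)) _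
    have w3 : qPochInf (l ^ 2 * q ^ (m + 1)) q =
        qPochInf (l ^ 2 * q ^ m) q / (1 - l ^ 2 * q ^ m) := by
      simpa [sq] using w1 hl1
    unfold nrCert
    rw [w1 ha1, w1 hb1, w1 he1, w2 hc1, w2 hd1, w3, qPoch_succ, qPoch_succ, qPoch_succ, qPoch_succ,
      qPoch_succ, qPoch_succ, pow_succ (a * b * c * d * e / l) m]
    generalize (a * b * c * d * e / l) ^ m = tm
    generalize a * b * c * d * e / l = t
    generalize 1 - l ^ 2 * q ^ m = u
    generalize 1 - q * q ^ m = v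
    rw [div_mul_eq_mul_div (qPochInf (l ^ 2 * q ^ m) q), div_div_eq_mul_div]
    ring

theorem tsum_nrTerm_contiguous (hq : q ≠ 0) (hq1 : ‖q‖ < 1) {l a b c d e : ℂ} (hl : l ≠ 0)
    (ha : a ≠ 0) (hb : b ≠ 0) (hc : c ≠ 0) (hd : d ≠ 0) (he : e ≠ 0) (hcd : c ≠ d)
    (hlq : ‖l ^ 2 / q‖ < 1) (ha1 : ‖a‖ < 1) (hb1 : ‖b‖ < 1) (hc1 : ‖c‖ < 1) (hd1 : ‖d‖ < 1)
    (he1 : ‖e‖ < 1) (ht : ‖a * b * c * d * e / l‖ < 1) :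
    ∑' m, nrTerm q l a b c d e m =
      (1 - l * d) * (1 - l / d) / (1 - c / d) * ((1 - c * a) * (1 - c * b) * (1 - c * e)) *
          ∑' m, nrTerm q (l * q) a b (c * q) d e m +
        (1 - l * c) * (1 - l / c) / (1 - d / c) * ((1 - d * a) * (1 - d * b) * (1 - d * e)) *
          ∑' m, nrTerm q (l * q) a b c (d * q) e m := by
  set C := (1 - l * d) * (1 - l / d) / (1 - c / d) * ((1 - c * a) * (1 - c * b) * (1 - c * e))
    with hC
  set D := (1 - l * c) * (1 - l / c) / (1 - d / c) * ((1 - d * a) * (1 - d * b) * (1 - d * e))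
    with hD
  have hlq0 : l * q ≠ 0 := mul_ne_zero hl hq
  have hlq' := norm_mul_sq_div_lt_one hq1 hlq
  have s0 := summable_nrTerm hq hq1 hl he hlq ha1 hb1 hc1 hd1 he1 ht
  have s1 := summable_nrTerm hq hq1 (c := c * q) hlq0 he hlq' ha1 hb1 (norm_mul_lt_one hc1 hq1) hd1
    he1 (by rwa [show a * b * (c * q) * d * e / (l * q) = a * b * c * d * e / l by field_simp])
  have s2 := summable_nrTerm hq hq1 (d := d * q) hlq0 he hlq' ha1 hb1 hc1 (norm_mul_lt_one hd1 hq1)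
    he1 (by rwa [show a * b * c * (d * q) * e / (l * q) = a * b * c * d * e / l by field_simp])
  -- The term of index 0 equals the certificate of index 0, so the telescoping starts without a
  -- boundary contribution.
  have hpart : ∀ n, ∑ m ∈ Finset.range (n + 1), nrTerm q l a b c d e m =
      C * ∑ m ∈ Finset.range n, nrTerm q (l * q) a b (c * q) d e m +
        D * ∑ m ∈ Finset.range n, nrTerm q (l * q) a b c (d * q) e m + nrCert q l a b c d e n := by
    intro n
    induction n with
    | zero =>
      have h1 : qPochInf (l ^ 2 / q) q = (1 - l ^ 2 / q) * qPochInf (l ^ 2) q := by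
        rw [qPochInf_eq_mul hq1, div_mul_cancel₀ _ hq]
      have n1 := qPochInf_ne_zero_of_norm_lt hq hq1 hlq
      rw [h1] at n1
      have e1 : ∀ x : ℂ, qPochInf (l * x) q = (1 - l * x) * qPochInf (l * x * q) q := fun x =>
        qPochInf_eq_mul hq1 _
      simp only [nrTerm, nrCert, qPoch_zero, zero_add, Finset.range_one, Finset.sum_singleton,
        Finset.range_zero, Finset.sum_empty, mul_zero, pow_zero, mul_one, pow_one, h1, e1 c, e1 d,
        div_mul_cancel_left₀ (left_ne_zero_of_mul n1)]
      ring
    | succ n ih =>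
      rw [Finset.sum_range_succ, ih, Finset.sum_range_succ _ n, Finset.sum_range_succ _ n]
      linear_combination nrTerm_add_nrCert hq hq1 hl ha hb hc hd he hcd hlq n
  have l1 := (s0.hasSum.tendsto_sum_nat).comp (tendsto_add_atTop_nat 1)
  have l2 := ((s1.hasSum.tendsto_sum_nat.const_mul C).add (s2.hasSum.tendsto_sum_nat.const_mul D)).add
    (tendsto_nrCert hq hq1 hlq ha1 hb1 hc1 hd1 he1 ht)
  rw [add_zero] at l2
  exact tendsto_nhds_unique l1 (l2.congr fun n => (hpart n).symm)

/-- The product of `(x y; q)_∞` over all pairs of the five parameters. -/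
def pairProd (q a b c d e : ℂ) : ℂ :=
  qPochInf (a * b) q * qPochInf (a * c) q * qPochInf (a * d) q * qPochInf (a * e) q *
    qPochInf (b * c) q * qPochInf (b * d) q * qPochInf (b * e) q * qPochInf (c * d) q *
    qPochInf (c * e) q * qPochInf (d * e) q

theorem pairProd_ne_zero (hq : q ≠ 0) (hq1 : ‖q‖ < 1) {a b c d e : ℂ} (ha1 : ‖a‖ < 1)
    (hb1 : ‖b‖ < 1) (hc1 : ‖c‖ < 1) (hd1 : ‖d‖ < 1) (he1 : ‖e‖ < 1) :
    pairProd q a b c d e ≠ 0 := by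
  have n := fun {x y : ℂ} (hx : ‖x‖ < 1) (hy : ‖y‖ < 1) =>
    qPochInf_ne_zero_of_norm_lt hq hq1 (norm_mul_lt_one hx hy)
  simp [pairProd, n ha1 hb1, n ha1 hc1, n ha1 hd1, n ha1 he1, n hb1 hc1, n hb1 hd1, n hb1 he1,
    n hc1 hd1, n hc1 he1, n hd1 he1]

/-- The product side of the Nassrallah--Rahman integral. -/
def nrClosed (q l a b c d e : ℂ) : ℂ :=
  2 * qPochInf (a * b * c * d * e / l) q / (qPochInf q q * pairProd q a b c d e) *
    ∑' m, nrTerm q l a b c d e m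

/-- The quantity abcde/l is unchanged by both shifts, and the extra linear factors in the series
relation are exactly those by which `pairProd` changes. The result is the recurrence of
`nrIntegral_contiguous`. -/
theorem nrClosed_contiguous (hq : q ≠ 0) (hq1 : ‖q‖ < 1) {l a b c d e : ℂ} (hl : l ≠ 0)
    (ha : a ≠ 0) (hb : b ≠ 0) (hc : c ≠ 0) (hd : d ≠ 0) (he : e ≠ 0) (hcd : c ≠ d)
    (hlq : ‖l ^ 2 / q‖ < 1) (ha1 : ‖a‖ < 1) (hb1 : ‖b‖ < 1) (hc1 : ‖c‖ < 1) (hd1 : ‖d‖ < 1)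
    (he1 : ‖e‖ < 1) (ht : ‖a * b * c * d * e / l‖ < 1) :
    nrClosed q l a b c d e =
      (1 - l * d) * (1 - l / d) / ((1 - c * d) * (1 - c / d)) *
          nrClosed q (l * q) a b (c * q) d e +
        (1 - l * c) * (1 - l / c) / ((1 - c * d) * (1 - d / c)) *
          nrClosed q (l * q) a b c (d * q) e := by
  have hcd1 : 1 - c * d ≠ 0 := by
    simpa using one_sub_ne_zero_of_notMem
      (notMem_Omega_of_norm_lt hq hq1 (norm_mul_lt_one hc1 hd1)) 0
  have n := fun {x : ℂ} (hx : ‖x‖ < 1) => norm_mul_lt_one hx hq1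
  have p0 := pairProd_ne_zero hq hq1 ha1 hb1 hc1 hd1 he1
  have p1 := pairProd_ne_zero hq hq1 ha1 hb1 (n hc1) hd1 he1
  have p2 := pairProd_ne_zero hq hq1 ha1 hb1 hc1 (n hd1) he1
  have f1 : ∀ x y : ℂ, qPochInf (x * y) q = (1 - y * x) * qPochInf (x * (y * q)) q := fun x y => by
    rw [qPochInf_eq_mul hq1, mul_comm y x, mul_assoc]
  have f2 : ∀ x y : ℂ, qPochInf (x * y) q = (1 - x * y) * qPochInf (x * q * y) q := fun x y => by
    rw [qPochInf_eq_mul hq1, mul_right_comm]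
  have e1 : pairProd q a b c d e = (1 - c * a) * (1 - c * b) * (1 - c * e) * (1 - c * d) *
      pairProd q a b (c * q) d e := by
    simp only [pairProd]
    rw [f1 a c, f1 b c, f2 c d, f2 c e]
    ring
  have e2 : pairProd q a b c d e = (1 - d * a) * (1 - d * b) * (1 - d * e) * (1 - c * d) *
      pairProd q a b c (d * q) e := by
    simp only [pairProd]
    rw [f1 a d, f1 b d, f1 c d, f2 d e]
    ring
  simp only [nrClosed]
  rw [tsum_nrTerm_contiguous hq hq1 hl ha hb hc hd he hcd hlq ha1 hb1 hc1 hd1 he1 ht,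
    show a * b * (c * q) * d * e / (l * q) = a * b * c * d * e / l by field_simp,
    show a * b * c * (d * q) * e / (l * q) = a * b * c * d * e / l by field_simp]
  generalize ∑' m, nrTerm q (l * q) a b (c * q) d e m = S₁
  generalize ∑' m, nrTerm q (l * q) a b c (d * q) e m = S₂
  have d1 : (1 - c * a) * (1 - c * b) * (1 - c * e) / pairProd q a b c d e =
      1 / ((1 - c * d) * pairProd q a b (c * q) d e) := by
    rw [div_eq_div_iff p0 (mul_ne_zero hcd1 p1), e1]
    ring
  have d2 : (1 - d * a) * (1 - d * b) * (1 - d * e) / pairProd q a b c d e =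
      1 / ((1 - c * d) * pairProd q a b c (d * q) e) := by
    rw [div_eq_div_iff p0 (mul_ne_zero hcd1 p2), e2]
    ring
  generalize (1 - c * a) * (1 - c * b) * (1 - c * e) = κ₁ at *
  generalize (1 - d * a) * (1 - d * b) * (1 - d * e) = κ₂ at *
  generalize 1 - c * d = u at *
  generalize 1 - c / d = v
  generalize 1 - d / c = w
  linear_combination (2 * qPochInf (a * b * c * d * e / l) q / qPochInf q q *
    ((1 - l * d) * (1 - l / d) / v) * S₁) * d1 + (2 * qPochInf (a * b * c * d * e / l) q /
    qPochInf q q * ((1 - l * c) * (1 - l / c) / w) * S₂) * d2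

/-- When the fifth parameter equals l, its factor cancels the numerator. -/
theorem nrIntegral_eq_awIntegral (hq : q ≠ 0) (hq1 : ‖q‖ < 1) {l : ℂ} (hl1 : ‖l‖ < 1)
    (a b c d : ℂ) : nrIntegral q l ![a, b, c, d, l] = awIntegral q a b c d := by
  refine circleAverage_congr_sphere fun z hz => ?_
  have := qPochPM_ne_zero hq hq1 (z := z) hl1 (by simpa using hz)
  simp only [nrWeight, awWeight, Fin.prod_univ_five, Matrix.cons_val]
  rw [mul_div_mul_right _ _ this]

/-- Since lq^(M+1) = (lq)q^M, the contiguous relation lowers M while the fifth parameter stays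
fixed. It also shifts l, c, d, which are therefore quantified inside the induction, and the
separation of the progressions of c and d keeps them distinct throughout. For M = 0 the factor (1;
q)_m kills all terms with m > 0. -/
theorem nrIntegral_eq_nrClosed_of_terminating (hq : q ≠ 0) (hq1 : ‖q‖ < 1) {a b : ℂ}
    (ha : a ≠ 0) (hb : b ≠ 0) (ha1 : ‖a‖ < 1) (hb1 : ‖b‖ < 1) (M : ℕ) :
    ∀ {l c d : ℂ}, l ≠ 0 → c ≠ 0 → d ≠ 0 → ‖l ^ 2 / q‖ < 1 → ‖c‖ < 1 → ‖d‖ < 1 →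
      (∀ i j : ℕ, c * q ^ i ≠ d * q ^ j) →
      nrIntegral q l ![a, b, c, d, l * q ^ M] = nrClosed q l a b c d (l * q ^ M) := by
  induction M with
  | zero =>
    intro l c d hl hc hd hlq hc1 hd1 hcd
    have hl1 := norm_lt_one_of_sq_div hq hq1 hlq
    rw [pow_zero, mul_one, nrIntegral_eq_awIntegral hq hq1 hl1, awIntegral_eq hq hq1 ha1 hb1 hc1 hd1,
      nrClosed, tsum_eq_single 0]
    · have h1 : qPochInf (l ^ 2 / q) q = (1 - l ^ 2 / q) * qPochInf (l ^ 2) q := by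
        rw [qPochInf_eq_mul hq1, div_mul_cancel₀ _ hq]
      have n1 := qPochInf_ne_zero_of_norm_lt hq hq1 hlq
      rw [h1] at n1
      have n := fun {x y : ℂ} (hx : ‖x‖ < 1) (hy : ‖y‖ < 1) =>
        qPochInf_ne_zero_of_norm_lt hq hq1 (norm_mul_lt_one hx hy)
      have n2 := right_ne_zero_of_mul n1
      have n3 := n ha1 hl1
      have n4 := n hb1 hl1
      have n5 := n hc1 hl1
      have n6 := n hd1 hl1
      simp only [nrTerm, qPoch_zero, mul_zero, pow_zero, mul_one, h1, pairProd,
        div_mul_cancel_left₀ (left_ne_zero_of_mul n1), mul_div_cancel_right₀ _ hl]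
      rw [mul_comm l a, mul_comm l b, mul_comm l c, mul_comm l d, ← sq]
      field_simp
    · intro m hm
      obtain ⟨k, rfl⟩ := Nat.exists_eq_succ_of_ne_zero hm
      have : qPoch (l / l) q (k + 1) = 0 := by
        rw [qPoch_succ', div_self hl, sub_self, zero_mul]
      simp [nrTerm, this]
  | succ M ih =>
    intro l c d hl hc hd hlq hc1 hd1 hcd
    have hl1 := norm_lt_one_of_sq_div hq hq1 hlq
    have hqM : ‖q ^ (M + 1)‖ < 1 := by
      rw [norm_pow]; exact pow_lt_one₀ (norm_nonneg q) hq1 (by omega)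
    have he1 : ‖l * q ^ (M + 1)‖ < 1 := norm_mul_lt_one hl1 hqM
    have ht : ‖a * b * c * d * (l * q ^ (M + 1)) / l‖ < 1 := by
      rw [show a * b * c * d * (l * q ^ (M + 1)) / l = a * b * c * d * q ^ (M + 1) by field_simp]
      exact norm_mul_lt_one (norm_mul_lt_one (norm_mul_lt_one (norm_mul_lt_one ha1 hb1) hc1) hd1) hqM
    have hcd' : c ≠ d := by simpa using hcd 0 0
    rw [nrIntegral_contiguous hq hq1 l ha1 hb1 hc1 hd1 he1 hc hd hcd', nrClosed_contiguous hq hq1 hl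
      ha hb hc hd (mul_ne_zero hl (pow_ne_zero _ hq)) hcd' hlq ha1 hb1 hc1 hd1 he1 ht]
    rw [show l * q ^ (M + 1) = l * q * q ^ M by ring]
    have hlq' := norm_mul_sq_div_lt_one hq1 hlq
    rw [ih (mul_ne_zero hl hq) (mul_ne_zero hc hq) hd hlq' (norm_mul_lt_one hc1 hq1) hd1
      (fun i j => by rw [mul_assoc, ← pow_succ']; exact hcd (i + 1) j),
      ih (mul_ne_zero hl hq) hc (mul_ne_zero hd hq) hlq' hc1 (norm_mul_lt_one hd1 hq1)
      (fun i j => by rw [mul_assoc, ← pow_succ']; exact hcd i (j + 1))]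

/-- The **Nassrallah--Rahman integral**. -/
theorem nrIntegral_eq_nrClosed (hq : q ≠ 0) (hq1 : ‖q‖ < 1) {l a b c d e : ℂ}
    (hl : l ≠ 0) (ha : a ≠ 0) (hb : b ≠ 0) (hc : c ≠ 0) (hd : d ≠ 0) (he : e ≠ 0)
    (hlq : ‖l ^ 2 / q‖ < 1) (ha1 : ‖a‖ < 1) (hb1 : ‖b‖ < 1) (hc1 : ‖c‖ < 1) (hd1 : ‖d‖ < 1)
    (he1 : ‖e‖ < 1) (ht : ‖a * b * c * d * e / l‖ < 1)
    (hcd : ∀ i j : ℕ, c * q ^ i ≠ d * q ^ j) :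
    nrIntegral q l ![a, b, c, d, e] = nrClosed q l a b c d e := by
  have hl1 := norm_lt_one_of_sq_div hq hq1 hlq
  set k := a * b * c * d / l with hk
  have hk0 : k ≠ 0 := by simp [hk, ha, hb, hc, hd, hl]
  have hkp : 0 < ‖k‖ := norm_pos_iff.2 hk0
  have hke : ∀ x : ℂ, a * b * c * d * x / l = k * x := fun x => by rw [hk]; ring
  -- On this disc both |x| < 1 and |abcdx/l| < 1 hold, which is all that the integral and the series
  -- require of the fifth parameter x.
  set ρ := min 1 ‖k‖⁻¹ with hρ
  have hρ0 : 0 < ρ := lt_min one_pos (inv_pos.2 hkp)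
  have hmem : ∀ x : ℂ, x ∈ ball (0 : ℂ) ρ ↔ ‖x‖ < 1 ∧ ‖k * x‖ < 1 := fun x => by
    rw [mem_ball_zero_iff, hρ, lt_min_iff, norm_mul, ← lt_inv_mul_iff₀ hkp, mul_one]
  set f : ℂ → ℂ := fun x => nrIntegral q l ![a, b, c, d, x]
  -- The closed form rewritten without l/x, so that it is holomorphic at x = 0, where the
  -- interpolation points accumulate.
  set g : ℂ → ℂ := fun x => 2 * qPochInf (k * x) q / (qPochInf q q * pairProd q a b c d x) *
    (qPochInf (l * a) q * qPochInf (l * b) q * qPochInf (l * c) q *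
      qPochInf (l * d) q * qPochInf (l * x) q / qPochInf (l ^ 2) q *
      ∑' m, vwpTerm (l ^ 2 / q) ![l / a, l / b, l / c, l / d] ![l * a, l * b, l * c, l * d, l * x] q
        (a * b * c * d) (k * x) m) with hg
  have n := fun {x : ℂ} (hx : ‖x‖ < 1) => notMem_Omega_of_norm_lt hq hq1 (norm_mul_lt_one hl1 hx)
  have hgeq : ∀ x, x ≠ 0 → ‖x‖ < 1 → g x = nrClosed q l a b c d x := by
    intro x hx0 hx1
    simp only [hg, nrClosed, nrTerm_eq hq hq1 hl hx0 hlq (n ha1) (n hb1) (n hc1) (n hd1) (n hx1),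
      tsum_mul_left, hke]
  have hf : DifferentiableOn ℂ f (ball 0 ρ) := by
    refine differentiableOn_circleAverage isOpen_ball ?_ fun z hz => ?_
    · refine continuousOn_nrWeight hq hq1 l (fun i => ?_) (by fun_prop) (fun x hx => ?_)
        fun x hx => by simpa using hx.2
      · fin_cases i <;> simp <;> fun_prop
      · have := ((hmem x.1).1 hx.1).1
        simp [Fin.forall_fin_succ, ha1, hb1, hc1, hd1, this]
    · have hz : ‖z‖ = 1 := by simpa using hz
      simp only [nrWeight, Fin.prod_univ_five, Matrix.cons_val]
      refine (differentiableOn_const _).div (((differentiableOn_const _)).mul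
        (differentiableOn_qPochPM hq1 differentiableOn_id z)) fun x hx => ?_
      simp [qPochPM_ne_zero hq hq1 ha1 hz, qPochPM_ne_zero hq hq1 hb1 hz,
        qPochPM_ne_zero hq hq1 hc1 hz, qPochPM_ne_zero hq hq1 hd1 hz,
        qPochPM_ne_zero hq hq1 ((hmem x).1 hx).1 hz]
  have hdq : ∀ y : ℂ, Differentiable ℂ fun x => qPochInf (y * x) q := fun y =>
    (differentiable_qPochInf hq1).comp (differentiable_id.const_mul y)
  have hgd : DifferentiableOn ℂ g (ball 0 ρ) := by
    refine DifferentiableOn.mul (DifferentiableOn.div ?_ ?_ fun x hx => ?_)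
      (DifferentiableOn.mul ?_ ?_)
    · exact ((hdq k).const_mul 2).differentiableOn
    · unfold pairProd
      have := hdq a
      have := hdq b
      have := hdq c
      have := hdq d
      fun_prop
    · exact mul_ne_zero (qPochInf_ne_zero_of_norm_lt hq hq1 hq1)
        (pairProd_ne_zero hq hq1 ha1 hb1 hc1 hd1 ((hmem x).1 hx).1)
    · exact (((hdq l).const_mul _).div_const _).differentiableOn
    · refine differentiableOn_tsum_vwpTerm hq hq1 isOpen_ball (differentiableOn_const _)
        (fun _ => differentiableOn_const _) (fun i => ?_) (differentiableOn_const _) (by fun_prop)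
        (fun x hx n => one_sub_ne_zero_of_notMem (notMem_Omega_of_norm_lt hq hq1 hlq) (2 * n))
        (fun x hx => ?_)
        (fun x hx => ((hmem x).1 hx).2)
      · fin_cases i <;> simp <;> fun_prop
      · have := ((hmem x).1 hx).1
        simp [Fin.forall_fin_succ, n ha1, n hb1, n hc1, n hd1, n this]
  -- The points x = lq^M tend to 0, and the terminating case gives equality there.
  have hfreq : ∃ᶠ x in 𝓝[≠] (0 : ℂ), f x = g x := by
    have hlim : Tendsto (fun M : ℕ => l * q ^ M) atTop (𝓝[≠] 0) := by
      refine tendsto_nhdsWithin_iff.2 ⟨?_, Eventually.of_forall fun M =>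
        mul_ne_zero hl (pow_ne_zero _ hq)⟩
      simpa using (tendsto_pow_atTop_nhds_zero_of_norm_lt_one hq1).const_mul l
    refine hlim.frequently (Frequently.of_forall fun M => ?_)
    have hM1 : ‖l * q ^ M‖ < 1 := by
      rw [norm_mul, norm_pow]
      exact mul_lt_one_of_nonneg_of_lt_one_left (norm_nonneg _) hl1
        (pow_le_one₀ (norm_nonneg _) hq1.le)
    rw [hgeq _ (mul_ne_zero hl (pow_ne_zero _ hq)) hM1]
    exact nrIntegral_eq_nrClosed_of_terminating hq hq1 ha hb ha1 hb1 M hl hc hd hlq hc1 hd1 hcd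
  have heq := (hf.analyticOnNhd isOpen_ball).eqOn_of_preconnected_of_frequently_eq
    (hgd.analyticOnNhd isOpen_ball) (convex_ball 0 ρ).isPreconnected (mem_ball_self hρ0) hfreq
  rw [← hgeq e he he1]
  exact heq ((hmem e).2 ⟨he1, by rwa [← hke]⟩)

end NassrallahRahman

/-! ### Residues of the Nassrallah–Rahman integrand as terms of `_8W_7` series. -/

section Residues

open Metric Real Set

variable {q : ℂ}

/-- By this symmetry only the poles attached to the parameter of index 0 need to be analysed. -/
theorem nrWeight_comp_perm (q l : ℂ) (a : Fin 5 → ℂ) (σ : Equiv.Perm (Fin 5)) :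
    nrWeight q l (a ∘ σ) = nrWeight q l a := by
  ext z
  simp only [nrWeight, Function.comp]
  rw [Equiv.prod_comp σ fun i => qPochPM (a i) q z]

/-- The cofactor of the simple pole of `z⁻¹ * nrWeight q l a z` at `z = a 0 * q ^ n`. -/
def poleCofactor (q l : ℂ) (a : Fin 5 → ℂ) (n : ℕ) (z : ℂ) : ℂ :=
  qPochInf (z ^ 2) q * qPochInf (1 / z ^ 2) q * qPochPM l q z /
    (qPochInf (a 0 * z) q * (qPoch (a 0 / z) q n * qPochInf (a 0 * q ^ (n + 1) / z) q) *
      ∏ j : Fin 4, qPochPM (a j.succ) q z)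

theorem inv_mul_nrWeight (hq1 : ‖q‖ < 1) (l : ℂ) (a : Fin 5 → ℂ) (n : ℕ) {z : ℂ} (hz : z ≠ 0) :
    z⁻¹ * nrWeight q l a z = poleCofactor q l a n z / (z - a 0 * q ^ n) := by
  have h : qPochInf (a 0 / z) q = qPoch (a 0 / z) q n * ((1 - a 0 * q ^ n / z) *
      qPochInf (a 0 * q ^ (n + 1) / z) q) := by
    rw [qPochInf_eq_qPoch_mul hq1 _ n, qPochInf_eq_mul hq1 (a 0 / z * q ^ n),
      show a 0 / z * q ^ n = a 0 * q ^ n / z by ring,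
      show a 0 * q ^ n / z * q = a 0 * q ^ (n + 1) / z by ring]
  have h2 : z - a 0 * q ^ n = z * (1 - a 0 * q ^ n / z) := by field_simp
  have h3 : qPochPM (a 0) q z = qPochInf (a 0 * z) q * qPochInf (a 0 / z) q := rfl
  rw [nrWeight, poleCofactor, Fin.prod_univ_succ, h3, h, h2]
  generalize 1 - a 0 * q ^ n / z = u
  simp only [div_eq_mul_inv, mul_inv]
  ring

theorem mul_pow_notMem (hq : q ≠ 0) {x y : ℂ} (hy : y ≠ 0)
    (hxy : ∀ i j : ℕ, x * q ^ i ≠ y * q ^ j) (n : ℕ) : x / (y * q ^ n) ∉ Omega q := by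
  rintro ⟨k, hk⟩
  refine hxy k n ?_
  have := pow_ne_zero k hq
  have := pow_ne_zero n hq
  field_simp at hk
  linear_combination hk

theorem norm_mul_pow_lt_one (hq1 : ‖q‖ < 1) {x : ℂ} (hx : ‖x‖ < 1) (n : ℕ) : ‖x * q ^ n‖ < 1 := by
  rw [norm_mul, norm_pow]
  exact mul_lt_one_of_nonneg_of_lt_one_left (norm_nonneg _) hx (pow_le_one₀ (norm_nonneg _) hq1.le)

theorem analyticAt_poleCofactor (hq : q ≠ 0) (hq1 : ‖q‖ < 1) (l : ℂ) {a : Fin 5 → ℂ}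
    (ha : ∀ i, a i ≠ 0) (ha1 : ∀ i, ‖a i‖ < 1)
    (hne : ∀ j : Fin 4, ∀ m n : ℕ, a j.succ * q ^ m ≠ a 0 * q ^ n) (n : ℕ) :
    AnalyticAt ℂ (poleCofactor q l a n) (a 0 * q ^ n) := by
  have hp0 : a 0 * q ^ n ≠ 0 := mul_ne_zero (ha 0) (pow_ne_zero _ hq)
  have hA : ∀ {f : ℂ → ℂ}, AnalyticAt ℂ f (a 0 * q ^ n) →
      AnalyticAt ℂ (fun z => qPochInf (f z) q) (a 0 * q ^ n) := fun {f} hf =>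
    AnalyticAt.comp (g := fun x => qPochInf x q)
      ((differentiable_qPochInf hq1).analyticAt _) hf
  have hdiv : ∀ x : ℂ, AnalyticAt ℂ (fun z => x / z) (a 0 * q ^ n) := fun x =>
    analyticAt_const.div analyticAt_id hp0
  have hmul : ∀ x : ℂ, AnalyticAt ℂ (fun z => x * z) (a 0 * q ^ n) := fun x => by fun_prop
  have hpm : ∀ x : ℂ, AnalyticAt ℂ (fun z => qPochPM x q z) (a 0 * q ^ n) := fun x =>
    (hA (hmul x)).mul (hA (hdiv x))
  have hqn : q ^ n ≠ 0 := pow_ne_zero n hq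
  have hsmall : ∀ i, qPochInf (a i * (a 0 * q ^ n)) q ≠ 0 := fun i =>
    qPochInf_ne_zero_of_norm_lt hq hq1
      (norm_mul_lt_one (ha1 i) (norm_mul_pow_lt_one hq1 (ha1 0) n))
  have hsq : AnalyticAt ℂ (fun z : ℂ => z ^ 2) (a 0 * q ^ n) := by fun_prop
  have hisq : AnalyticAt ℂ (fun z : ℂ => 1 / z ^ 2) (a 0 * q ^ n) :=
    analyticAt_const.div hsq (pow_ne_zero 2 hp0)
  refine AnalyticAt.div (((hA hsq).mul (hA hisq)).mul (hpm l))
    (((hA (hmul _)).mul (AnalyticAt.mul ?_ (hA (hdiv _)))).mul ?_) ?_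
  · refine Finset.analyticAt_fun_prod _ fun j _ => analyticAt_const.sub ((hdiv _).mul analyticAt_const)
  · exact Finset.analyticAt_fun_prod _ fun j _ => hpm _
  · refine mul_ne_zero (mul_ne_zero (hsmall 0) (mul_ne_zero ?_ ?_)) ?_
    · refine Finset.prod_ne_zero_iff.2 fun j hj => ?_
      have hj := Finset.mem_range.1 hj
      -- With n = j + i + 1 the factor of index j at the pole is 1 - q^(-(i+1)), which is nonzero.
      obtain ⟨i, rfl⟩ := Nat.exists_eq_add_of_lt hj
      have hqi : q ^ (i + 1) ≠ 0 := pow_ne_zero _ hq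
      have h1 := one_sub_ne_zero_of_notMem (notMem_Omega_of_norm_lt hq hq1 hq1) i
      intro h
      apply h1
      have h0 := ha 0
      have hqj := pow_ne_zero j hq
      rw [show a 0 / (a 0 * q ^ (j + i + 1)) * q ^ j = 1 / q ^ (i + 1) by
        field_simp; ring] at h
      field_simp at h
      linear_combination - h
    · rw [show a 0 * q ^ (n + 1) / (a 0 * q ^ n) = q by
        have := ha 0
        field_simp; ring]
      exact qPochInf_ne_zero_of_norm_lt hq hq1 hq1
    · exact Finset.prod_ne_zero_iff.2 fun j _ => mul_ne_zero (hsmall _)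
        (qPochInf_ne_zero hq1 (mul_pow_notMem hq (ha 0) (hne j) n))

/-- The terms of the `_8W_7` series with base `a 0 ^ 2`. -/
def leftTerm (q l : ℂ) (a : Fin 5 → ℂ) (n : ℕ) : ℂ :=
  vwpTerm (a 0 ^ 2) (fun j => a 0 * a j.succ)
    ![q * a 0 / a 1, q * a 0 / a 2, q * a 0 / a 3, q * a 0 / a 4, l * a 0] q
    (q ^ 2 * a 0 / ∏ i, a i) (q * l / ∏ i, a i) n

/-- The infinite products in front of the `_8W_7` series with base `a 0 ^ 2`. -/
def leftFactor (q l : ℂ) (a : Fin 5 → ℂ) : ℂ :=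
  qPochInf (l * a 0) q * qPochInf (1 / a 0 ^ 2) q * qPochInf (l / a 0) q /
    ((∏ j : Fin 4, qPochInf (a 0 * a j.succ) q) * ∏ j : Fin 4, qPochInf (a j.succ / a 0) q)

/-- Together with `qPochPM_mul`, the quasi-periodicity under z ↦ qz behind both the ratio of
consecutive residues and the decay of the weight near 0. -/
theorem qPochInf_sq_mul_inv_sq (hq : q ≠ 0) (hq1 : ‖q‖ < 1) {z : ℂ} (hz : z ≠ 0)
    (h1 : 1 - z ^ 2 ≠ 0) :
    qPochInf ((q * z) ^ 2) q * qPochInf (1 / (q * z) ^ 2) q =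
      (1 - q ^ 2 * z ^ 2) / (q ^ 3 * z ^ 4 * (1 - z ^ 2)) *
        (qPochInf (z ^ 2) q * qPochInf (1 / z ^ 2) q) := by
  have s1 : qPochInf (z ^ 2) q = (1 - z ^ 2) * ((1 - q * z ^ 2) * qPochInf ((q * z) ^ 2) q) := by
    rw [qPochInf_eq_mul hq1, qPochInf_eq_mul hq1 (z ^ 2 * q)]
    ring_nf
  have s2 : qPochInf (1 / (q * z) ^ 2) q = (1 - 1 / (q * z) ^ 2) * ((1 - 1 / (q * z ^ 2)) *
      qPochInf (1 / z ^ 2) q) := by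
    rw [qPochInf_eq_mul hq1, qPochInf_eq_mul hq1 (1 / (q * z) ^ 2 * q),
      show 1 / (q * z) ^ 2 * q = 1 / (q * z ^ 2) by field_simp,
      show 1 / (q * z ^ 2) * q = 1 / z ^ 2 by field_simp]
  rw [s1, s2]
  field_simp
  ring

theorem qPochPM_mul (hq : q ≠ 0) (hq1 : ‖q‖ < 1) {x z : ℂ} (hz : z ≠ 0) (hx : 1 - x * z ≠ 0) :
    qPochPM x q (q * z) = (q * z - x) / (q * z * (1 - x * z)) * qPochPM x q z := by
  have s1 : qPochInf (x * z) q = (1 - x * z) * qPochInf (x * (q * z)) q := by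
    rw [qPochInf_eq_mul hq1]
    ring_nf
  have s2 : qPochInf (x / (q * z)) q = (1 - x / (q * z)) * qPochInf (x / z) q := by
    rw [qPochInf_eq_mul hq1, show x / (q * z) * q = x / z by field_simp]
  rw [qPochPM, qPochPM, s1, s2]
  field_simp

/-- Here x stands for qⁿ: the left side is the ratio of consecutive residues obtained from
quasi-periodicity, the right side the term ratio of the `_8W_7` with base a². -/
theorem residue_ratio {q l a b c d e x : ℂ} (hq : q ≠ 0) (hx : x ≠ 0) (ha : a ≠ 0) (hb : b ≠ 0)
    (hc : c ≠ 0) (hd : d ≠ 0) (he : e ≠ 0) (h1 : 1 - (a * x) ^ 2 ≠ 0) (h2 : 1 - q * x ≠ 0)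
    (hl : 1 - l * (a * x) ≠ 0) (hb2 : q * (a * x) - b ≠ 0) (hc2 : q * (a * x) - c ≠ 0)
    (hd2 : q * (a * x) - d ≠ 0) (he2 : q * (a * x) - e ≠ 0)
    (hb3 : 1 - b * (a * x) ≠ 0) (hc3 : 1 - c * (a * x) ≠ 0) (hd3 : 1 - d * (a * x) ≠ 0)
    (he3 : 1 - e * (a * x) ≠ 0) :
    (1 - q ^ 2 * (a * x) ^ 2) / (q ^ 3 * (a * x) ^ 4 * (1 - (a * x) ^ 2)) *
      ((q * (a * x) - l) / (q * (a * x) * (1 - l * (a * x)))) /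
      ((1 - 1 / (q * x)) * ((q * (a * x) - b) / (q * (a * x) * (1 - b * (a * x))) *
        ((q * (a * x) - c) / (q * (a * x) * (1 - c * (a * x)))) *
        ((q * (a * x) - d) / (q * (a * x) * (1 - d * (a * x)))) *
        ((q * (a * x) - e) / (q * (a * x) * (1 - e * (a * x)))))) * (1 - a * (a * x)) =
    (1 - a ^ 2 * q ^ 2 * x ^ 2) / (1 - a ^ 2 * x ^ 2) * ((1 - a ^ 2 * x) / (1 - q * x)) *
      ((1 - a * b * x) * (1 - a * c * x) * (1 - a * d * x) * (1 - a * e * x) /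
        ((1 - q * a / b * x) * (1 - q * a / c * x) * (1 - q * a / d * x) * (1 - q * a / e * x) *
          (1 - l * a * x))) *
      (q * l / (a * b * c * d * e) - q ^ 2 * a / (a * b * c * d * e) * x) := by
  have r : ∀ y : ℂ, y ≠ 0 → 1 - q * a / y * x = -(q * (a * x) - y) / y := fun y hy => by
    field_simp; ring
  have s : 1 - 1 / (q * x) = -(1 - q * x) / (q * x) := by field_simp; ring
  rw [r b hb, r c hc, r d hd, r e he, s, show a ^ 2 * x ^ 2 = (a * x) ^ 2 by ring,
    show a * b * x = b * (a * x) by ring, show a * c * x = c * (a * x) by ring,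
    show a * d * x = d * (a * x) by ring, show a * e * x = e * (a * x) by ring,
    show l * a * x = l * (a * x) by ring, show a ^ 2 * x = a * (a * x) by ring,
    show a ^ 2 * q ^ 2 * x ^ 2 = q ^ 2 * (a * x) ^ 2 by ring,
    show q * l / (a * b * c * d * e) - q ^ 2 * a / (a * b * c * d * e) * x =
      -(q / (a * b * c * d * e)) * (q * (a * x) - l) by ring]
  generalize 1 - (a * x) ^ 2 = A1 at *
  generalize 1 - q ^ 2 * (a * x) ^ 2 = A2 at *
  generalize q * (a * x) - b = B at *
  generalize q * (a * x) - c = C at *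
  generalize q * (a * x) - d = D at *
  generalize q * (a * x) - e = F at *
  generalize q * (a * x) - l = L at *
  generalize 1 - b * (a * x) = B' at *
  generalize 1 - c * (a * x) = C' at *
  generalize 1 - d * (a * x) = D' at *
  generalize 1 - e * (a * x) = F' at *
  generalize 1 - l * (a * x) = L' at *
  generalize 1 - a * (a * x) = A' at *
  generalize 1 - q * x = X at *
  field_simp

theorem poleCofactor_succ (hq : q ≠ 0) (hq1 : ‖q‖ < 1) {l : ℂ} (hl1 : ‖l‖ < 1) {a : Fin 5 → ℂ}
    (ha : ∀ i, a i ≠ 0) (ha1 : ∀ i, ‖a i‖ < 1)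
    (hne : ∀ j : Fin 4, ∀ m n : ℕ, a j.succ * q ^ m ≠ a 0 * q ^ n) (n : ℕ) :
    poleCofactor q l a (n + 1) (a 0 * q ^ (n + 1)) =
      vwpRatio (a 0 ^ 2) (fun j => a 0 * a j.succ)
        ![q * a 0 / a 1, q * a 0 / a 2, q * a 0 / a 3, q * a 0 / a 4, l * a 0] q
        (q ^ 2 * a 0 / ∏ i, a i) (q * l / ∏ i, a i) (q ^ n) *
      poleCofactor q l a n (a 0 * q ^ n) := by
  have hx0 : q ^ n ≠ 0 := pow_ne_zero n hq
  have h0 := ha 0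
  have hz1 := norm_mul_pow_lt_one hq1 (ha1 0) n
  have hz0 : a 0 * q ^ n ≠ 0 := mul_ne_zero h0 hx0
  have sm : ∀ {y : ℂ}, ‖y‖ < 1 → 1 - y ≠ 0 := fun hy => by
    simpa using one_sub_ne_zero_of_notMem (notMem_Omega_of_norm_lt hq hq1 hy) 0
  have k1 : 1 - (a 0 * q ^ n) ^ 2 ≠ 0 := sm (by rw [sq]; exact norm_mul_lt_one hz1 hz1)
  have k2 : ∀ {y : ℂ}, ‖y‖ < 1 → 1 - y * (a 0 * q ^ n) ≠ 0 := fun hy => sm (norm_mul_lt_one hy hz1)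
  have k3 : 1 - q * q ^ n ≠ 0 := one_sub_ne_zero_of_notMem (notMem_Omega_of_norm_lt hq hq1 hq1) n
  have k4 : ∀ j : Fin 4, q * (a 0 * q ^ n) - a j.succ ≠ 0 := fun j h => hne j 0 (n + 1) (by
    linear_combination -h)
  have e1 : a 0 * q ^ (n + 1) = q * (a 0 * q ^ n) := by ring
  have e2 : qPochInf (a 0 * (a 0 * q ^ n)) q =
      (1 - a 0 * (a 0 * q ^ n)) * qPochInf (a 0 * (q * (a 0 * q ^ n))) q := by
    rw [qPochInf_eq_mul hq1]
    ring_nf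
  have e3 : qPoch (a 0 / (q * (a 0 * q ^ n))) q (n + 1) =
      (1 - 1 / (q * q ^ n)) * qPoch (a 0 / (a 0 * q ^ n)) q n := by
    rw [qPoch_succ', show a 0 / (q * (a 0 * q ^ n)) * q = a 0 / (a 0 * q ^ n) by field_simp,
      show a 0 / (q * (a 0 * q ^ n)) = 1 / (q * q ^ n) by field_simp]
  have e4 : a 0 * q ^ (n + 1 + 1) / (q * (a 0 * q ^ n)) = a 0 * q ^ (n + 1) / (a 0 * q ^ n) := by
    field_simp
    ring
  have e5 : ∀ j : Fin 4, qPochPM (a j.succ) q (q * (a 0 * q ^ n)) =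
      (q * (a 0 * q ^ n) - a j.succ) / (q * (a 0 * q ^ n) * (1 - a j.succ * (a 0 * q ^ n))) *
        qPochPM (a j.succ) q (a 0 * q ^ n) := fun j => qPochPM_mul hq hq1 hz0 (k2 (ha1 _))
  simp only [poleCofactor, e1, e2, e3, e4, e5, Finset.prod_mul_distrib,
    qPochInf_sq_mul_inv_sq hq hq1 hz0 k1, qPochPM_mul hq hq1 hz0 (k2 hl1)]
  rw [← e1]
  generalize qPochInf ((a 0 * q ^ n) ^ 2) q * qPochInf (1 / (a 0 * q ^ n) ^ 2) q = T₁
  generalize qPochPM l q (a 0 * q ^ n) = T₂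
  generalize qPochInf (a 0 * (a 0 * q ^ (n + 1))) q = T₃
  generalize qPoch (a 0 / (a 0 * q ^ n)) q n = T₄
  generalize qPochInf (a 0 * q ^ (n + 1) / (a 0 * q ^ n)) q = T₅
  generalize (∏ i : Fin 4, qPochPM (a i.succ) q (a 0 * q ^ n)) = T₆
  rw [e1]
  have key : (1 - q ^ 2 * (a 0 * q ^ n) ^ 2) / (q ^ 3 * (a 0 * q ^ n) ^ 4 * (1 - (a 0 * q ^ n) ^ 2)) *
      ((q * (a 0 * q ^ n) - l) / (q * (a 0 * q ^ n) * (1 - l * (a 0 * q ^ n)))) /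
      ((1 - 1 / (q * q ^ n)) * ∏ j : Fin 4, ((q * (a 0 * q ^ n) - a j.succ) /
        (q * (a 0 * q ^ n) * (1 - a j.succ * (a 0 * q ^ n))))) * (1 - a 0 * (a 0 * q ^ n)) =
      vwpRatio (a 0 ^ 2) (fun j => a 0 * a j.succ)
        ![q * a 0 / a 1, q * a 0 / a 2, q * a 0 / a 3, q * a 0 / a 4, l * a 0] q
        (q ^ 2 * a 0 / ∏ i, a i) (q * l / ∏ i, a i) (q ^ n) := by
    simp only [vwpRatio, Fin.prod_univ_five, Fin.prod_univ_four, Matrix.cons_val]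
    exact residue_ratio hq hx0 h0 (ha 1) (ha 2) (ha 3) (ha 4) k1 k3 (k2 hl1) (k4 0) (k4 1) (k4 2)
      (k4 3) (k2 (ha1 1)) (k2 (ha1 2)) (k2 (ha1 3)) (k2 (ha1 4))
  rw [← key]
  have k0 := k2 (ha1 0)
  generalize 1 - a 0 * (a 0 * q ^ n) = u at *
  generalize 1 - 1 / (q * q ^ n) = v
  generalize (∏ j : Fin 4, ((q * (a 0 * q ^ n) - a j.succ) /
        (q * (a 0 * q ^ n) * (1 - a j.succ * (a 0 * q ^ n))))) = w
  generalize (1 - q ^ 2 * (a 0 * q ^ n) ^ 2) / (q ^ 3 * (a 0 * q ^ n) ^ 4 * (1 - (a 0 * q ^ n) ^ 2)) = x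
  generalize ((q * (a 0 * q ^ n) - l) / (q * (a 0 * q ^ n) * (1 - l * (a 0 * q ^ n)))) = y
  field_simp

/-- Both sides satisfy the same first-order recurrence in n. At n = 0 the factor (q; q)_∞ cancels
(a₀q/z; q)_∞ at z = a₀, and (z²; q)_∞ cancels (a₀z; q)_∞. -/
theorem poleCofactor_eq (hq : q ≠ 0) (hq1 : ‖q‖ < 1) {l : ℂ} (hl1 : ‖l‖ < 1) {a : Fin 5 → ℂ}
    (ha : ∀ i, a i ≠ 0) (ha1 : ∀ i, ‖a i‖ < 1)
    (hne : ∀ j : Fin 4, ∀ m n : ℕ, a j.succ * q ^ m ≠ a 0 * q ^ n) (n : ℕ) :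
    qPochInf q q * poleCofactor q l a n (a 0 * q ^ n) = leftFactor q l a * leftTerm q l a n := by
  have h0 := ha 0
  have hsq : ‖a 0 ^ 2‖ < 1 := by rw [sq]; exact norm_mul_lt_one (ha1 0) (ha1 0)
  have hΩ := notMem_Omega_of_norm_lt hq hq1 hsq
  induction n with
  | zero =>
    have hsq' := qPochInf_ne_zero hq1 hΩ
    have hqq := qPochInf_ne_zero_of_norm_lt hq hq1 hq1
    have h1 : 1 - a 0 ^ 2 ≠ 0 := by simpa using one_sub_ne_zero_of_notMem hΩ 0
    simp only [poleCofactor, leftFactor, leftTerm, vwpTerm, qPochPM, qPoch_zero, pow_zero, mul_one,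
      mul_zero, Finset.range_zero, Finset.prod_empty, Finset.prod_const_one, zero_add, pow_one,
      div_one, one_mul, div_self h1, Finset.prod_mul_distrib, mul_div_cancel_left₀ q h0]
    rw [← sq, Finset.prod_congr rfl fun (j : Fin 4) _ => by rw [mul_comm (a j.succ) (a 0)]]
    simp only [div_eq_mul_inv, mul_inv]
    field_simp
  | succ n ih =>
    rw [poleCofactor_succ hq hq1 hl1 ha ha1 hne, mul_left_comm, ih, leftTerm, leftTerm,
      vwpTerm_succ fun n => one_sub_ne_zero_of_notMem hΩ (2 * n)]
    ring

end Residues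

/-! ### The integral as the sum of all residues in the unit disc. -/

section ResidueSum

open Metric Real Set

variable {q : ℂ}

/-- The multiplier of `nrWeight` under `z ↦ q * z`. -/
def nrMultiplier (q l : ℂ) (a : Fin 5 → ℂ) (z : ℂ) : ℂ :=
  q * (1 - q ^ 2 * z ^ 2) / (1 - z ^ 2) * ((q * z - l) / (1 - l * z)) *
    ∏ i, ((1 - a i * z) / (q * z - a i))

theorem nrWeight_mul (hq : q ≠ 0) (hq1 : ‖q‖ < 1) {l : ℂ} (hl1 : ‖l‖ < 1) {a : Fin 5 → ℂ}
    (ha1 : ∀ i, ‖a i‖ < 1) {z : ℂ} (hz : z ≠ 0) (hz1 : ‖z‖ < 1) :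
    nrWeight q l a (q * z) = nrMultiplier q l a z * nrWeight q l a z := by
  have sm : ∀ {y : ℂ}, ‖y‖ < 1 → 1 - y ≠ 0 := fun hy => by
    simpa using one_sub_ne_zero_of_notMem (notMem_Omega_of_norm_lt hq hq1 hy) 0
  have k1 : 1 - z ^ 2 ≠ 0 := sm (by rw [sq]; exact norm_mul_lt_one hz1 hz1)
  have k2 : ∀ {y : ℂ}, ‖y‖ < 1 → 1 - y * z ≠ 0 := fun hy => sm (norm_mul_lt_one hy hz1)
  have e : ∏ i, qPochPM (a i) q (q * z) =
      (∏ i, ((1 - a i * z) / (q * z - a i)))⁻¹ / (q * z) ^ 5 * ∏ i, qPochPM (a i) q z := by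
    rw [Finset.prod_congr rfl fun i _ => qPochPM_mul hq hq1 hz (k2 (ha1 i)),
      Finset.prod_mul_distrib, ← Finset.prod_inv_distrib,
      show (q * z) ^ 5 = ∏ _i : Fin 5, q * z by simp, ← Finset.prod_div_distrib]
    congr 1
    refine Finset.prod_congr rfl fun i _ => ?_
    rw [inv_div, div_div, mul_comm (q * z)]
  have k0 := k2 hl1
  rw [nrWeight, nrWeight, nrMultiplier, qPochInf_sq_mul_inv_sq hq hq1 hz k1,
    qPochPM_mul hq hq1 hz k0, e]
  generalize ∏ i, ((1 - a i * z) / (q * z - a i)) = P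
  generalize ∏ i, qPochPM (a i) q z = Q
  generalize qPochInf (z ^ 2) q * qPochInf (1 / z ^ 2) q = T
  generalize 1 - z ^ 2 = u at *
  generalize 1 - l * z = v at *
  generalize q * z - l = w at *
  generalize 1 - q ^ 2 * z ^ 2 = y at *
  simp only [div_eq_mul_inv, mul_inv, inv_inv]
  field_simp

theorem continuousAt_nrMultiplier (q l : ℂ) {a : Fin 5 → ℂ} (ha : ∀ i, a i ≠ 0) :
    ContinuousAt (nrMultiplier q l a) 0 := by
  unfold nrMultiplier
  refine ContinuousAt.mul (ContinuousAt.mul (ContinuousAt.div ?_ ?_ ?_)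
    (ContinuousAt.div ?_ ?_ ?_)) (tendsto_finsetProd _ fun i _ => ContinuousAt.div ?_ ?_ ?_)
  all_goals first
    | fun_prop
    | simp [ha]

/-- This limiting multiplier is the argument of the `_8W_7` series on the left; the condition |q| <
|A/λ| says that its modulus is less than 1. -/
theorem nrMultiplier_zero (q l : ℂ) (a : Fin 5 → ℂ) :
    nrMultiplier q l a 0 = q * l / ∏ i, a i := by
  simp only [nrMultiplier, Fin.prod_univ_five]
  simp only [mul_zero, sub_zero, zero_sub, zero_pow two_ne_zero, div_one, mul_one, one_div, inv_neg]
  rw [div_eq_mul_inv]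
  simp only [mul_inv]
  ring

theorem differentiableAt_nrWeight (hq : q ≠ 0) (hq1 : ‖q‖ < 1) (l : ℂ) {a : Fin 5 → ℂ}
    (ha1 : ∀ i, ‖a i‖ < 1) {z : ℂ} (hz : z ≠ 0) (hz1 : ‖z‖ ≤ 1)
    (hne : ∀ i, ∀ n : ℕ, z ≠ a i * q ^ n) : DifferentiableAt ℂ (nrWeight q l a) z := by
  have hdiv : ∀ x : ℂ, DifferentiableAt ℂ (fun z => x / z) z := fun x =>
    (differentiableAt_const _).div differentiableAt_id hz
  have hpm : ∀ x : ℂ, DifferentiableAt ℂ (fun z => qPochPM x q z) z := fun x =>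
    (differentiableAt_qPochInf_comp hq1 (by fun_prop)).mul
      (differentiableAt_qPochInf_comp hq1 (hdiv x))
  refine DifferentiableAt.div (((differentiableAt_qPochInf_comp hq1 (by fun_prop)).mul
    (differentiableAt_qPochInf_comp hq1 ((differentiableAt_const _).div (differentiableAt_id.pow 2)
      (pow_ne_zero 2 hz)))).mul (hpm l)) (DifferentiableAt.fun_finsetProd fun i _ => hpm _) ?_
  refine Finset.prod_ne_zero_iff.2 fun i _ => mul_ne_zero (qPochInf_ne_zero_of_norm_lt hq hq1 ?_)
    (qPochInf_ne_zero hq1 ?_)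
  · rw [norm_mul]
    exact mul_lt_one_of_nonneg_of_lt_one_left (norm_nonneg _) (ha1 i) hz1
  · rintro ⟨k, hk⟩
    refine hne i k ?_
    have := pow_ne_zero k hq
    field_simp at hk
    exact hk.symm

theorem norm_circleAverage_le {f : ℂ → ℂ} {r C : ℝ} (hr : 0 < r)
    (hf : ∀ z : ℂ, ‖z‖ = r → ‖f z‖ ≤ C) : ‖circleAverage f 0 r‖ ≤ C := by
  rw [circleAverage_eq_circleIntegral hr.ne']
  refine (circleIntegral.norm_two_pi_i_inv_smul_integral_le_of_norm_le_const hr.le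
    (C := r⁻¹ * C) fun z hz => ?_).trans_eq (by field_simp)
  have hz : ‖z‖ = r := by simpa using hz
  rw [sub_zero, norm_smul, norm_inv, hz]
  gcongr
  exact hf z hz

/-- The circles of radius ρ|q|^N are carried into one another by multiplication by q. Once they are
small, each step multiplies the maximum of the weight by at most κ < 1. -/
theorem tendsto_circleAverage_nrWeight (hq : q ≠ 0) (hq1 : ‖q‖ < 1) {l : ℂ} (hl1 : ‖l‖ < 1)
    {a : Fin 5 → ℂ} (ha : ∀ i, a i ≠ 0) (ha1 : ∀ i, ‖a i‖ < 1) (hlow : ‖q * l / ∏ i, a i‖ < 1)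
    {ρ : ℝ} (hρ : 0 < ρ) (hρ1 : ρ < 1)
    (hne : ∀ i, ∀ n N : ℕ, ρ * ‖q‖ ^ N ≠ ‖a i * q ^ n‖) :
    Tendsto (fun N : ℕ => circleAverage (nrWeight q l a) 0 (ρ * ‖q‖ ^ N)) atTop (𝓝 0) := by
  have hq0 : 0 < ‖q‖ := norm_pos_iff.2 hq
  obtain ⟨κ, hκ, hκ1⟩ := exists_between hlow
  have hκ0 : 0 ≤ κ := (norm_nonneg _).trans hκ.le
  rw [← nrMultiplier_zero] at hκ
  obtain ⟨δ, hδ, hR⟩ := Metric.eventually_nhds_iff.1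
    ((continuousAt_nrMultiplier q l ha).norm.eventually_lt_const hκ)
  have hpow : Tendsto (fun N : ℕ => ρ * ‖q‖ ^ N) atTop (𝓝 0) := by
    simpa using (tendsto_pow_atTop_nhds_zero_of_lt_one hq0.le hq1).const_mul ρ
  obtain ⟨M, hM⟩ := eventually_atTop.1 (hpow.eventually_lt_const hδ)
  have hpos : ∀ N : ℕ, 0 < ρ * ‖q‖ ^ N := fun N => by positivity
  have hlt : ∀ N : ℕ, ρ * ‖q‖ ^ N < 1 := fun N =>
    mul_lt_one_of_nonneg_of_lt_one_left hρ.le hρ1 (pow_le_one₀ hq0.le hq1.le)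
  have hcont : ContinuousOn (nrWeight q l a) (sphere 0 (ρ * ‖q‖ ^ M)) := fun z hz => by
    have hz : ‖z‖ = ρ * ‖q‖ ^ M := by simpa using hz
    refine (differentiableAt_nrWeight hq hq1 l ha1 ?_ ?_ ?_).continuousAt.continuousWithinAt
    · exact norm_pos_iff.1 (hz ▸ hpos M)
    · exact hz ▸ (hlt M).le
    · exact fun i n h => hne i n M (by rw [← hz, h])
  obtain ⟨C, hC⟩ := (isCompact_sphere (0 : ℂ) (ρ * ‖q‖ ^ M)).exists_bound_of_continuousOn hcont
  have hbound : ∀ m : ℕ, ∀ z : ℂ, ‖z‖ = ρ * ‖q‖ ^ (m + M) → ‖nrWeight q l a z‖ ≤ C * κ ^ m := by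
    intro m
    induction m with
    | zero => intro z hz; simpa using hC z (by simpa using hz)
    | succ m ih =>
      intro z hz
      have hw : ‖z / q‖ = ρ * ‖q‖ ^ (m + M) := by
        rw [norm_div, hz]
        field_simp
        ring
      have hw0 : z / q ≠ 0 := norm_pos_iff.1 (hw ▸ hpos _)
      have h := nrWeight_mul hq hq1 hl1 ha1 hw0 (hw ▸ hlt _)
      rw [mul_div_cancel₀ z hq] at h
      rw [h, norm_mul, pow_succ, ← mul_assoc, mul_comm]
      have hκz := (hR (y := z / q) (by rw [dist_zero_right, hw]; exact hM _ (by omega))).le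
      gcongr
      · exact (norm_nonneg _).trans (ih _ hw)
      · exact ih _ hw
  rw [← tendsto_add_atTop_iff_nat M]
  refine squeeze_zero_norm (fun m => norm_circleAverage_le (hpos _) (hbound m)) ?_
  simpa using (tendsto_pow_atTop_nhds_zero_of_lt_one hκ0 hκ1).const_mul C

theorem injective_mul_pow (hq : q ≠ 0) (hq1 : ‖q‖ < 1) {ι : Type*} {a : ι → ℂ} (ha : ∀ i, a i ≠ 0)
    (hne : ∀ i j, i ≠ j → ∀ m n : ℕ, a i * q ^ m ≠ a j * q ^ n) :
    Function.Injective fun p : ι × ℕ => a p.1 * q ^ p.2 := by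
  rintro ⟨i, m⟩ ⟨j, n⟩ h
  by_cases hij : i = j
  · subst hij
    have h1 : q ^ m = q ^ n := mul_left_cancel₀ (ha i) h
    have h2 : ‖q‖ ^ m = ‖q‖ ^ n := by rw [← norm_pow, ← norm_pow, h1]
    rw [pow_right_injective₀ (norm_pos_iff.2 hq) hq1.ne h2]
  · exact absurd h (hne i j hij m n)

/-- Only countably many radii would send some circle of radius ρ|q|^N through a pole. -/
theorem exists_radius (q : ℂ) (a : Fin 5 → ℂ) : ∃ ρ : ℝ, 0 < ρ ∧ ρ < 1 ∧
    ∀ i, ∀ n N : ℕ, ρ ≠ ‖a i * q ^ n‖ / ‖q‖ ^ N := by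
  obtain ⟨ρ, hρ, h0, h1⟩ := ((countable_range fun p : Fin 5 × ℕ × ℕ =>
    ‖a p.1 * q ^ p.2.1‖ / ‖q‖ ^ p.2.2).dense_compl ℝ).exists_between (zero_lt_one' ℝ)
  exact ⟨ρ, h0, h1, fun i n N h => hρ ⟨(i, n, N), h.symm⟩⟩

theorem finite_lt_norm_mul_pow (hq1 : ‖q‖ < 1) {a : Fin 5 → ℂ} (ha1 : ∀ i, ‖a i‖ < 1) {r : ℝ}
    (hr : 0 < r) : {p : Fin 5 × ℕ | r < ‖a p.1 * q ^ p.2‖}.Finite := by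
  obtain ⟨M, hM⟩ := exists_pow_lt_of_lt_one hr hq1
  refine ((finite_univ (α := Fin 5)).prod (finite_lt_nat M)).subset fun p hp => ⟨mem_univ _, ?_⟩
  simp only [mem_ofPred_eq, norm_mul, norm_pow] at hp ⊢
  by_contra! h
  have h1 : ‖a p.1‖ * ‖q‖ ^ p.2 ≤ 1 * ‖q‖ ^ M :=
    mul_le_mul (ha1 _).le (pow_le_pow_of_le_one (norm_nonneg _) hq1.le h) (by positivity) zero_le_one
  linarith

theorem tendsto_toFinset_atTop (hq : q ≠ 0) (hq1 : ‖q‖ < 1) {a : Fin 5 → ℂ}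
    (ha : ∀ i, a i ≠ 0) (ha1 : ∀ i, ‖a i‖ < 1) {ρ : ℝ} (hρ : 0 < ρ)
    (hpos : ∀ N : ℕ, 0 < ρ * ‖q‖ ^ N) :
    Tendsto (fun N => (finite_lt_norm_mul_pow hq1 ha1 (hpos N)).toFinset) atTop atTop := by
  have hq0 : 0 < ‖q‖ := norm_pos_iff.2 hq
  refine tendsto_atTop_finset_of_monotone (fun M N hMN p hp => ?_) fun p => ?_
  · simp only [Finite.mem_toFinset, mem_ofPred_eq] at hp ⊢
    refine lt_of_le_of_lt ?_ hp
    exact mul_le_mul_of_nonneg_left (pow_le_pow_of_le_one hq0.le hq1.le hMN) hρ.le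
  · have : Tendsto (fun N : ℕ => ρ * ‖q‖ ^ N) atTop (𝓝 0) := by
      simpa using (tendsto_pow_atTop_nhds_zero_of_lt_one hq0.le hq1).const_mul ρ
    obtain ⟨N, hN⟩ := (this.eventually_lt_const (norm_pos_iff.2
      (mul_ne_zero (ha p.1) (pow_ne_zero p.2 hq)))).exists
    exact ⟨N, by simpa using hN⟩

theorem circleAverage_nrWeight_sub (hq : q ≠ 0) (hq1 : ‖q‖ < 1) (l : ℂ) {a : Fin 5 → ℂ}
    (ha : ∀ i, a i ≠ 0) (ha1 : ∀ i, ‖a i‖ < 1)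
    (hne : ∀ i j, i ≠ j → ∀ m n : ℕ, a i * q ^ m ≠ a j * q ^ n) {r : ℝ} (hr : 0 < r) (hr1 : r < 1)
    (hrne : ∀ i, ∀ n : ℕ, r ≠ ‖a i * q ^ n‖) :
    nrIntegral q l a - circleAverage (nrWeight q l a) 0 r =
      ∑ p ∈ (finite_lt_norm_mul_pow hq1 ha1 hr).toFinset,
        poleCofactor q l (a ∘ Equiv.swap 0 p.1) p.2 (a p.1 * q ^ p.2) := by
  classical
  set s := (finite_lt_norm_mul_pow hq1 ha1 hr).toFinset with hs
  set v : Fin 5 × ℕ → ℂ := fun p => a p.1 * q ^ p.2 with hv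
  have hinj : Function.Injective v := injective_mul_pow hq hq1 ha hne
  have hv0 : ∀ p, v p ≠ 0 := fun p => mul_ne_zero (ha _) (pow_ne_zero _ hq)
  have hswap : ∀ k, (a ∘ Equiv.swap 0 k) 0 = a k := fun k => by simp
  have key := circleIntegral_sub_eq_sum_residues hr hr1.le (s.image v)
    (by
      intro p hp
      obtain ⟨x, hx, rfl⟩ := Finset.mem_image.1 hp
      exact ⟨by simpa [hs, hv] using hx, norm_mul_pow_lt_one hq1 (ha1 _) _⟩)
    -- The poles are distinct, so `Function.invFun v` recovers the index (k, n) from the point, as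
    -- the residue theorem indexes cofactors by points.
    (fun p => poleCofactor q l (a ∘ Equiv.swap 0 (Function.invFun v p).1) (Function.invFun v p).2)
    (by
      intro p hp
      obtain ⟨x, hx, rfl⟩ := Finset.mem_image.1 hp
      rw [Function.leftInverse_invFun hinj x]
      have := analyticAt_poleCofactor hq hq1 l (a := a ∘ Equiv.swap 0 x.1) (fun i => ha _)
        (fun i => ha1 _) (fun j m n => hne _ _ (fun h => Fin.succ_ne_zero j
        ((Equiv.swap 0 _).injective h)) m n) x.2
      rwa [hswap] at this)
    (fun z => (z - 0)⁻¹ • nrWeight q l a z)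
    (by
      intro z hz hz1 hzS
      have hz0 : z ≠ 0 := norm_pos_iff.1 (hr.trans_le hz)
      refine DifferentiableAt.smul (DifferentiableAt.inv (h := fun z => z - 0) (by fun_prop)
        (by simpa using hz0))
        (differentiableAt_nrWeight hq hq1 l ha1 hz0 hz1 fun i n h => ?_)
      refine hzS (Finset.mem_image.2 ⟨(i, n), ?_, h.symm⟩)
      simp only [hs, Finite.mem_toFinset, mem_ofPred_eq, ← h]
      exact lt_of_le_of_ne hz (h ▸ hrne i n))
    (by
      intro p hp
      obtain ⟨x, hx, rfl⟩ := Finset.mem_image.1 hp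
      rw [Function.leftInverse_invFun hinj x]
      filter_upwards [(eventually_ne_nhds (hv0 x)).filter_mono nhdsWithin_le_nhds] with z hz
      rw [sub_zero, smul_eq_mul, ← nrWeight_comp_perm q l a (Equiv.swap 0 x.1),
        inv_mul_nrWeight hq1 l _ x.2 hz, hswap])
  rw [Finset.sum_image hinj.injOn] at key
  simp only [Function.leftInverse_invFun hinj _] at key
  rw [nrIntegral, circleAverage_eq_circleIntegral one_ne_zero,
    circleAverage_eq_circleIntegral hr.ne', ← smul_sub, key, smul_eq_mul, ← mul_assoc,
    inv_mul_cancel₀ Complex.two_pi_I_ne_zero, one_mul]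

theorem summable_leftTerm (hq1 : ‖q‖ < 1) {l : ℂ} {a : Fin 5 → ℂ}
    (hb : ∀ n : ℕ, 1 - a 0 ^ 2 * q ^ (2 * n) ≠ 0) (hlow : ‖q * l / ∏ i, a i‖ < 1) :
    Summable (leftTerm q l a) :=
  summable_vwpTerm hq1 hb _ _ _ hlow

/-- As the inner circle shrinks its average tends to 0, while the finite sets of enclosed poles
exhaust all pairs (k, n); the double series converges absolutely and may be summed progression by
progression. -/
theorem qPochInf_mul_nrIntegral (hq : q ≠ 0) (hq1 : ‖q‖ < 1) {l : ℂ} (hl1 : ‖l‖ < 1)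
    {a : Fin 5 → ℂ} (ha : ∀ i, a i ≠ 0) (ha1 : ∀ i, ‖a i‖ < 1) (hlow : ‖q * l / ∏ i, a i‖ < 1)
    (hne : ∀ i j, i ≠ j → ∀ m n : ℕ, a i * q ^ m ≠ a j * q ^ n) :
    qPochInf q q * nrIntegral q l a = ∑ k, leftFactor q l (a ∘ Equiv.swap 0 k) *
      ∑' n, leftTerm q l (a ∘ Equiv.swap 0 k) n := by
  have hq0 : 0 < ‖q‖ := norm_pos_iff.2 hq
  obtain ⟨ρ, hρ, hρ1, hρne⟩ := exists_radius q a
  have hne' : ∀ i, ∀ n N : ℕ, ρ * ‖q‖ ^ N ≠ ‖a i * q ^ n‖ := fun i n N h => hρne i n N (by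
    rw [← h, mul_div_cancel_right₀ _ (pow_pos hq0 N).ne'])
  have hpos : ∀ N : ℕ, 0 < ρ * ‖q‖ ^ N := fun N => by positivity
  have hlt : ∀ N : ℕ, ρ * ‖q‖ ^ N < 1 := fun N =>
    mul_lt_one_of_nonneg_of_lt_one_left hρ.le hρ1 (pow_le_one₀ hq0.le hq1.le)
  have hprod : ∀ k, ∏ i, (a ∘ Equiv.swap 0 k) i = ∏ i, a i := fun k =>
    Equiv.prod_comp (Equiv.swap 0 k) a
  obtain ⟨f, hf⟩ : ∃ f : Fin 5 × ℕ → ℂ, ∀ p, f p = leftFactor q l (a ∘ Equiv.swap 0 p.1) *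
    leftTerm q l (a ∘ Equiv.swap 0 p.1) p.2 := ⟨_, fun _ => rfl⟩
  have hsk : ∀ k, Summable fun n => f (k, n) := fun k => by
    have hk : Summable (leftTerm q l (a ∘ Equiv.swap 0 k)) := by
      refine summable_leftTerm hq1 (fun n => ?_) (by rwa [hprod])
      refine one_sub_ne_zero_of_notMem (notMem_Omega_of_norm_lt hq hq1 ?_) _
      rw [sq]
      exact norm_mul_lt_one (ha1 _) (ha1 _)
    simpa only [hf] using hk.mul_left _
  have hsum : Summable f := summable_norm_iff.1 <| (summable_prod_of_nonneg fun _ => norm_nonneg _).2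
    ⟨fun k => (hsk k).norm, Summable.of_finite⟩
  have hcof : ∀ p : Fin 5 × ℕ, qPochInf q q *
      poleCofactor q l (a ∘ Equiv.swap 0 p.1) p.2 (a p.1 * q ^ p.2) = f p := fun p => by
    have := poleCofactor_eq hq hq1 hl1 (a := a ∘ Equiv.swap 0 p.1) (fun i => ha _)
      (fun i => ha1 _) (fun j m n => hne _ _ (fun h => Fin.succ_ne_zero j
        ((Equiv.swap 0 _).injective h)) m n) p.2
    rw [hf, ← this, Function.comp_apply, Equiv.swap_apply_left]
  have h1 : Tendsto (fun N => ∑ p ∈ (finite_lt_norm_mul_pow hq1 ha1 (hpos N)).toFinset, f p) atTop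
      (𝓝 (∑' p, f p)) := hsum.hasSum.comp (tendsto_toFinset_atTop hq hq1 ha ha1 hρ hpos)
  have h2 : Tendsto (fun N : ℕ => qPochInf q q * (nrIntegral q l a -
      circleAverage (nrWeight q l a) 0 (ρ * ‖q‖ ^ N))) atTop (𝓝 (qPochInf q q * nrIntegral q l a)) := by
    simpa using ((tendsto_circleAverage_nrWeight hq hq1 hl1 ha ha1 hlow hρ hρ1 hne').const_sub
      (nrIntegral q l a)).const_mul (qPochInf q q)
  have h3 : ∀ N : ℕ, qPochInf q q * (nrIntegral q l a -
      circleAverage (nrWeight q l a) 0 (ρ * ‖q‖ ^ N)) =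
      ∑ p ∈ (finite_lt_norm_mul_pow hq1 ha1 (hpos N)).toFinset, f p := fun N => by
    rw [circleAverage_nrWeight_sub hq hq1 l ha ha1 hne (hpos N) (hlt N) fun i n => hne' i n N,
      Finset.mul_sum]
    exact Finset.sum_congr rfl fun p _ => hcof p
  simp only [h3] at h2
  rw [tendsto_nhds_unique h2 h1, hsum.tsum_prod, tsum_fintype]
  exact Finset.sum_congr rfl fun k _ => by simp only [hf, tsum_mul_left]

end ResidueSum

/-! ### Translation of the `_8W_7` series into the working form. -/

section Series

variable {q : ℂ}

theorem sqrt_sq (b : ℂ) : Complex.sqrt b ^ 2 = b := Complex.cpow_ofNat_inv_pow b 2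

/-- The quotient (qr; q)_n / (r; q)_n telescopes to (1 - rqⁿ)/(1 - r); the factors for r and -r are
then multiplied. -/
theorem qPoch_sqrt_quotient {b r : ℂ} (hr : r ^ 2 = b) (hb : ∀ n : ℕ, 1 - b * q ^ (2 * n) ≠ 0)
    (n : ℕ) : qPoch (q * r) q n * qPoch (-(q * r)) q n / (qPoch r q n * qPoch (-r) q n) =
      (1 - b * q ^ (2 * n)) / (1 - b) := by
  have hfac : ∀ j : ℕ, 1 - b * q ^ (2 * j) = (1 - r * q ^ j) * (1 - -r * q ^ j) := fun j => by
    rw [← hr]; ring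
  have hne : ∀ j : ℕ, 1 - r * q ^ j ≠ 0 ∧ 1 - -r * q ^ j ≠ 0 := fun j =>
    mul_ne_zero_iff.1 (hfac j ▸ hb j)
  have h1 : qPoch r q n ≠ 0 := Finset.prod_ne_zero_iff.2 fun j _ => (hne j).1
  have h2 : qPoch (-r) q n ≠ 0 := Finset.prod_ne_zero_iff.2 fun j _ => (hne j).2
  have h0 : 1 - b ≠ 0 := by simpa using hb 0
  have e1 := (qPoch_succ' r q n).symm.trans (qPoch_succ r q n)
  have e2 := (qPoch_succ' (-r) q n).symm.trans (qPoch_succ (-r) q n)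
  rw [mul_comm r q] at e1
  rw [show -r * q = -(q * r) by ring] at e2
  rw [div_eq_div_iff (mul_ne_zero h1 h2) h0, hfac, show 1 - b = (1 - r) * (1 - -r) by rw [← hr]; ring]
  linear_combination ((1 - -r) * qPoch (-(q * r)) q n) * e1 +
    (qPoch r q n * (1 - r * q ^ n)) * e2

theorem WTerm_eq_vwpTerm {b : ℂ} (hb : ∀ n : ℕ, 1 - b * q ^ (2 * n) ≠ 0) (c₀ c₁ c₂ c₃ c₄ z : ℂ)
    (n : ℕ) : WTerm b [c₀, c₁, c₂, c₃, c₄] q z n = vwpTerm b ![c₀, c₁, c₂, c₃]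
      ![q * b / c₀, q * b / c₁, q * b / c₂, q * b / c₃, q * b / c₄] q (z * c₄) z n := by
  have hz : ∏ j ∈ Finset.range n, (z - z * c₄ * q ^ j) = qPoch c₄ q n * z ^ n := by
    rw [qPoch, ← Finset.card_range n, ← Finset.prod_const, Finset.card_range,
      ← Finset.prod_mul_distrib]
    exact Finset.prod_congr rfl fun j _ => by ring
  rw [vwpTerm, hz, ← qPoch_sqrt_quotient (sqrt_sq b) hb]
  simp only [WTerm, phiTerm, vwpNum, vwpDen, List.cons_append, List.nil_append, List.map_cons,
    List.map_nil, List.prod_cons, List.prod_nil, List.length_cons, List.length_nil,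
    Fin.prod_univ_four, Fin.prod_univ_five, Matrix.cons_val]
  -- With eight numerator and seven denominator parameters the exponent of (-1)^k q^(k choose 2) is
  -- 0.
  norm_num
  simp only [div_eq_mul_inv, mul_inv]
  ring

theorem WTerm_leftParams (hq : q ≠ 0) {l : ℂ} (hl : l ≠ 0) {a : Fin 5 → ℂ} (ha : ∀ i, a i ≠ 0)
    (hb : ∀ n : ℕ, 1 - a 0 ^ 2 * q ^ (2 * n) ≠ 0) (n : ℕ) :
    WTerm (a 0 ^ 2) (leftParams l q a) q (q * l / ∏ i, a i) n = leftTerm q l a n := by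
  have h0 := ha 0
  have hd : ∀ i, q * a 0 ^ 2 / (a 0 * a i) = q * a 0 / a i := fun i => by
    have := ha i
    field_simp
  rw [leftParams, WTerm_eq_vwpTerm hb, leftTerm, hd, hd, hd, hd,
    show q * a 0 ^ 2 / (q * a 0 / l) = l * a 0 by field_simp,
    show q * l / (∏ i, a i) * (q * a 0 / l) = q ^ 2 * a 0 / ∏ i, a i by field_simp]
  congr 1
  ext j
  fin_cases j <;> rfl

/-- The terms of the `_8W_7` series with base `l ^ 2 / q`. -/
def rightTerm (q l : ℂ) (a : Fin 5 → ℂ) (n : ℕ) : ℂ :=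
  vwpTerm (l ^ 2 / q) ![l / a 0, l / a 1, l / a 2, l / a 3] (fun i => l * a i) q
    (a 0 * a 1 * a 2 * a 3) ((∏ i, a i) / l) n

theorem WTerm_rightParams (hq : q ≠ 0) {l : ℂ} (hl : l ≠ 0) {a : Fin 5 → ℂ} (ha : ∀ i, a i ≠ 0)
    (hb : ∀ n : ℕ, 1 - l ^ 2 / q * q ^ (2 * n) ≠ 0) (n : ℕ) :
    WTerm (l ^ 2 / q) (rightParams l a) q ((∏ i, a i) / l) n = rightTerm q l a n := by
  have hd : ∀ i, q * (l ^ 2 / q) / (l / a i) = l * a i := fun i => by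
    have := ha i
    field_simp
  rw [rightParams, WTerm_eq_vwpTerm hb, rightTerm, hd, hd, hd, hd, hd,
    show (∏ i, a i) / l * (l / a 4) = a 0 * a 1 * a 2 * a 3 by
      have := ha 4
      rw [Fin.prod_univ_five]
      field_simp]
  congr 1
  ext j
  fin_cases j <;> rfl

end Series

/-! ### The identity for small parameters and its continuation by scaling. -/

section Identity

variable {q : ℂ}

/-- The left-hand side of the five-term identity. -/
def leftSide (q l : ℂ) (a : Fin 5 → ℂ) : ℂ :=
  ∑ k, leftFactor q l (a ∘ Equiv.swap 0 k) * ∑' n, leftTerm q l (a ∘ Equiv.swap 0 k) n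

/-- The right-hand side of the five-term identity. -/
def rightSide (q l : ℂ) (a : Fin 5 → ℂ) : ℂ :=
  2 * ((∏ i, qPochInf (l * a i) q) * qPochInf ((∏ i, a i) / l) q) /
    ((∏ i, ∏ j ∈ Finset.Ioi i, qPochInf (a i * a j) q) * qPochInf (l ^ 2) q) *
    ∑' n, rightTerm q l a n

theorem prod_Ioi_eq_pairProd (q : ℂ) (a : Fin 5 → ℂ) :
    ∏ i, ∏ j ∈ Finset.Ioi i, qPochInf (a i * a j) q =
      pairProd q (a 0) (a 1) (a 2) (a 3) (a 4) := by
  have h0 : Finset.Ioi (0 : Fin 5) = {1, 2, 3, 4} := by decide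
  have h1 : Finset.Ioi (1 : Fin 5) = {2, 3, 4} := by decide
  have h2 : Finset.Ioi (2 : Fin 5) = {3, 4} := by decide
  have h3 : Finset.Ioi (3 : Fin 5) = {4} := by decide
  have h4 : Finset.Ioi (4 : Fin 5) = ∅ := by decide
  rw [Fin.prod_univ_five, h0, h1, h2, h3, h4, pairProd]
  simp [mul_assoc]

theorem rightSide_eq_nrClosed (hq : q ≠ 0) (hq1 : ‖q‖ < 1) {l : ℂ} (hl : l ≠ 0) {a : Fin 5 → ℂ}
    (ha : ∀ i, a i ≠ 0) (ha1 : ∀ i, ‖a i‖ < 1) (hlq : ‖l ^ 2 / q‖ < 1) :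
    rightSide q l a = qPochInf q q * nrClosed q l (a 0) (a 1) (a 2) (a 3) (a 4) := by
  have hl1 := norm_lt_one_of_sq_div hq hq1 hlq
  have n := fun i => notMem_Omega_of_norm_lt hq hq1 (norm_mul_lt_one hl1 (ha1 i))
  have hqq := qPochInf_ne_zero_of_norm_lt hq hq1 hq1
  have hv : (fun i => l * a i) = ![l * a 0, l * a 1, l * a 2, l * a 3, l * a 4] := by
    ext i
    fin_cases i <;> rfl
  rw [rightSide, prod_Ioi_eq_pairProd]
  simp only [nrClosed, rightTerm,
    nrTerm_eq hq hq1 hl (ha 4) hlq (n 0) (n 1) (n 2) (n 3) (n 4), tsum_mul_left, hv,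
    Fin.prod_univ_five]
  generalize (∑' m, vwpTerm _ _ _ _ _ _ m) = T
  generalize pairProd _ _ _ _ _ _ = P
  generalize qPochInf (l ^ 2) q = Q
  simp only [div_eq_mul_inv, mul_inv]
  field_simp

/-- Both sides equal (q; q)_∞ times the Nassrallah–Rahman integral. -/
theorem leftSide_eq_rightSide_of_norm_lt (hq : q ≠ 0) (hq1 : ‖q‖ < 1) {l : ℂ} (hl : l ≠ 0)
    {a : Fin 5 → ℂ} (ha : ∀ i, a i ≠ 0) (ha1 : ∀ i, ‖a i‖ < 1) (hlq : ‖l ^ 2 / q‖ < 1)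
    (hlow : ‖q * l / ∏ i, a i‖ < 1) (hup : ‖(∏ i, a i) / l‖ < 1)
    (hne : ∀ i j, i ≠ j → ∀ m n : ℕ, a i * q ^ m ≠ a j * q ^ n) :
    leftSide q l a = rightSide q l a := by
  rw [rightSide_eq_nrClosed hq hq1 hl ha ha1 hlq, leftSide,
    ← qPochInf_mul_nrIntegral hq hq1 (norm_lt_one_of_sq_div hq hq1 hlq) ha ha1 hlow hne,
    ← nrIntegral_eq_nrClosed hq hq1 hl (ha 0) (ha 1) (ha 2) (ha 3) (ha 4) hlq (ha1 0) (ha1 1)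
      (ha1 2) (ha1 3) (ha1 4) (by rwa [Fin.prod_univ_five] at hup) (hne 2 3 (by decide))]
  congr 2
  ext i
  fin_cases i <;> rfl

theorem mul_pow_ne_mul_pow (hq : q ≠ 0) {x y : ℂ} (hx : x ≠ 0) (hy : y ≠ 0) (hxy : x / y ∉ Omega q)
    (hyx : y / x ∉ Omega q) (m n : ℕ) : x * q ^ m ≠ y * q ^ n := by
  have hqp : ∀ k, q ^ k ≠ 0 := fun k => pow_ne_zero k hq
  intro h
  rcases le_total m n with hmn | hmn
  · obtain ⟨k, rfl⟩ := Nat.exists_eq_add_of_le hmn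
    refine hyx ⟨k, ?_⟩
    rw [pow_add, mul_left_comm, mul_comm x, mul_right_inj' (hqp m)] at h
    rw [h]
    have := hqp k
    field_simp
  · obtain ⟨k, rfl⟩ := Nat.exists_eq_add_of_le hmn
    refine hxy ⟨k, ?_⟩
    rw [pow_add, mul_left_comm, mul_comm y, mul_right_inj' (hqp n)] at h
    rw [← h]
    have := hqp k
    field_simp

/-- The set is the zero set of the entire function (x; q)_∞. -/
theorem isClosed_Omega (hq : q ≠ 0) (hq1 : ‖q‖ < 1) : IsClosed (Omega q) := by
  have h : Omega q = (fun x => qPochInf x q) ⁻¹' {0} := by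
    ext x
    refine ⟨?_, fun hx => by_contra fun h => qPochInf_ne_zero hq1 h hx⟩
    rintro ⟨k, rfl⟩
    rw [Set.mem_preimage, Set.mem_singleton_iff, qPochInf_eq_qPoch_mul hq1 _ (k + 1), qPoch_succ,
      inv_mul_cancel₀ (pow_ne_zero k hq)]
    simp
  rw [h]
  exact isClosed_singleton.preimage (differentiable_qPochInf hq1).continuous

theorem countable_preimage_Omega (q : ℂ) {c : ℂ} (hc : c ≠ 0) {m : ℕ} (hm : 0 < m) :
    {s : ℂ | c * s ^ m ∈ Omega q}.Countable := by
  classical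
  refine (Set.countable_iUnion fun k : ℕ =>
    (Polynomial.nthRoots m ((q ^ k)⁻¹ / c)).toFinset.countable_toSet).mono ?_
  rintro s ⟨k, hk⟩
  refine Set.mem_iUnion.2 ⟨k, ?_⟩
  rw [Finset.mem_coe, Multiset.mem_toFinset, Polynomial.mem_nthRoots hm, ← hk]
  field_simp

/-- The complement of a countable set in the plane is connected, so the identity theorem applies on
U. -/
theorem eq_of_scaling {f g : ℂ → ℂ} {U : Set ℂ} (hU : IsOpen U) (hUc : Uᶜ.Countable)
    (hf : DifferentiableOn ℂ f U) (hg : DifferentiableOn ℂ g U)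
    (hfg : ∀ᶠ s in 𝓝[≠] (0 : ℂ), s ∈ U ∧ f s = g s) {s : ℂ} (hs : s ∈ U) : f s = g s := by
  have hconn : IsPreconnected U := by
    have := (hUc.isPathConnected_compl_of_one_lt_rank
      (by rw [Complex.rank_real_complex]; exact Cardinal.one_lt_two)).isConnected.isPreconnected
    rwa [compl_compl] at this
  -- The point 0 need not lie in U, so the identity theorem is based at a nearby z ≠ 0 around which
  -- the functions agree.
  obtain ⟨z, hz, hzU⟩ := ((eventually_eventually_nhdsWithin.2 hfg).and hfg).and
    self_mem_nhdsWithin |>.exists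
  have hz0 : z ≠ 0 := hzU
  rw [isOpen_compl_singleton.nhdsWithin_eq hz0] at hz
  exact (hf.analyticOnNhd hU).eqOn_of_preconnected_of_eventuallyEq (hg.analyticOnNhd hU) hconn
    hz.2.1 (hz.1.mono fun _ h => h.2) hs

theorem one_sub_sq_mul_pow_ne_zero {x : ℂ} (hx : x ∉ Omega q) (hx' : -x ∉ Omega q) (n : ℕ) :
    1 - x ^ 2 * q ^ (2 * n) ≠ 0 := by
  have h := mul_ne_zero (one_sub_ne_zero_of_notMem hx n) (one_sub_ne_zero_of_notMem hx' n)
  rwa [show (1 - x * q ^ n) * (1 - -x * q ^ n) = 1 - x ^ 2 * q ^ (2 * n) by ring] at h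

theorem mul_notMem_Omega (hq : q ≠ 0) {x : ℂ} (hx : x ∉ Omega q) : q * x ∉ Omega q := by
  rintro ⟨k, hk⟩
  refine hx ⟨k + 1, ?_⟩
  have := pow_ne_zero k hq
  rw [pow_succ, mul_inv, ← hk]
  field_simp

/-- If x/q = q^(-k), then x lies in Ω_q for k ≥ 1, while k = 0 is the one extra case x = q. -/
theorem div_notMem_Omega (hq : q ≠ 0) {x : ℂ} (hx : x ∉ Omega q) (hxq : x ≠ q) :
    x / q ∉ Omega q := by
  rintro ⟨k, hk⟩
  rw [div_eq_iff hq] at hk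
  cases k with
  | zero => exact hxq (by simpa using hk)
  | succ k =>
    refine hx ⟨k, ?_⟩
    have := pow_ne_zero k hq
    rw [hk, pow_succ]
    field_simp

/-- The condition that all denominators of the five-term identity which vary under scaling are
nonzero. -/
structure Admissible (q l : ℂ) (a : Fin 5 → ℂ) : Prop where
  pair : ∀ i j, i ≠ j → a i * a j ∉ Omega q
  pos : ∀ i, a i ∉ Omega q
  neg : ∀ i, -a i ∉ Omega q
  mul : ∀ i, l * a i ∉ Omega q
  sq : l ^ 2 / q ∉ Omega q

theorem admissible_of_norm_lt (hq : q ≠ 0) (hq1 : ‖q‖ < 1) {l : ℂ} {a : Fin 5 → ℂ}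
    (ha1 : ∀ i, ‖a i‖ < 1) (hlq : ‖l ^ 2 / q‖ < 1) : Admissible q l a where
  pair i j _ := notMem_Omega_of_norm_lt hq hq1 (norm_mul_lt_one (ha1 i) (ha1 j))
  pos i := notMem_Omega_of_norm_lt hq hq1 (ha1 i)
  neg i := notMem_Omega_of_norm_lt hq hq1 (by simpa using ha1 i)
  mul i := notMem_Omega_of_norm_lt hq hq1
    (norm_mul_lt_one (norm_lt_one_of_sq_div hq hq1 hlq) (ha1 i))
  sq := notMem_Omega_of_norm_lt hq hq1 hlq

/-- The admissible scaling parameters. -/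
def scalingDomain (q l : ℂ) (a : Fin 5 → ℂ) : Set ℂ :=
  {s | s ≠ 0 ∧ Admissible q (s ^ 5 * l) fun i => s * a i}

/-- Since each aᵢ has weight 1 and l weight 5, every forbidden condition has the form c·s^m ∈ Ω_q;
both countability and closedness are read off from this. -/
theorem compl_scalingDomain (q l : ℂ) (a : Fin 5 → ℂ) :
    (scalingDomain q l a)ᶜ = {0} ∪ ((⋃ i, ⋃ j, ⋃ _ : i ≠ j, {s | a i * a j * s ^ 2 ∈ Omega q}) ∪
      ((⋃ i, {s | a i * s ^ 1 ∈ Omega q}) ∪ ((⋃ i, {s | -a i * s ^ 1 ∈ Omega q}) ∪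
        ((⋃ i, {s | l * a i * s ^ 6 ∈ Omega q}) ∪ {s | l ^ 2 / q * s ^ 10 ∈ Omega q})))) := by
  rw [compl_eq_comm]
  ext s
  simp only [Set.mem_compl_iff, Set.mem_union, Set.mem_iUnion, Set.mem_singleton_iff,
    Set.mem_ofPred_eq, not_or, not_exists, scalingDomain]
  have e1 : ∀ i j, a i * a j * s ^ 2 = s * a i * (s * a j) := fun i j => by ring
  have e2 : ∀ i, a i * s ^ 1 = s * a i := fun i => by ring
  have e3 : ∀ i, -a i * s ^ 1 = -(s * a i) := fun i => by ring
  have e4 : ∀ i, l * a i * s ^ 6 = s ^ 5 * l * (s * a i) := fun i => by ring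
  have e5 : l ^ 2 / q * s ^ 10 = (s ^ 5 * l) ^ 2 / q := by ring
  simp only [e1, e2, e3, e4, e5]
  exact ⟨fun ⟨h0, h1, h2, h3, h4, h5⟩ => ⟨h0, h1, h2, h3, h4, h5⟩,
    fun ⟨h0, h1, h2, h3, h4, h5⟩ => ⟨h0, h1, h2, h3, h4, h5⟩⟩

theorem countable_compl_scalingDomain (hq : q ≠ 0) {l : ℂ} (hl : l ≠ 0) {a : Fin 5 → ℂ}
    (ha : ∀ i, a i ≠ 0) : (scalingDomain q l a)ᶜ.Countable := by
  rw [compl_scalingDomain]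
  have h := fun {c : ℂ} (hc : c ≠ 0) {m : ℕ} (hm : 0 < m) => countable_preimage_Omega q hc hm
  refine (Set.countable_singleton 0).union (Set.Countable.union ?_ (Set.Countable.union ?_
    (Set.Countable.union ?_ (Set.Countable.union ?_ ?_))))
  · exact Set.countable_iUnion fun i => Set.countable_iUnion fun j => Set.countable_iUnion fun _ =>
      h (mul_ne_zero (ha i) (ha j)) two_pos
  · exact Set.countable_iUnion fun i => h (ha i) one_pos
  · exact Set.countable_iUnion fun i => h (neg_ne_zero.2 (ha i)) one_pos
  · exact Set.countable_iUnion fun i => h (mul_ne_zero hl (ha i)) (by norm_num)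
  · exact h (div_ne_zero (pow_ne_zero 2 hl) hq) (by norm_num)

theorem isOpen_scalingDomain (hq : q ≠ 0) (hq1 : ‖q‖ < 1) (l : ℂ) (a : Fin 5 → ℂ) :
    IsOpen (scalingDomain q l a) := by
  rw [← isClosed_compl_iff, compl_scalingDomain]
  have h : ∀ (c : ℂ) (m : ℕ), IsClosed {s : ℂ | c * s ^ m ∈ Omega q} := fun c m =>
    (isClosed_Omega hq hq1).preimage (by fun_prop : Continuous fun s : ℂ => c * s ^ m)
  refine isClosed_singleton.union (IsClosed.union ?_ (IsClosed.union ?_ (IsClosed.union ?_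
    (IsClosed.union ?_ (h _ _)))))
  · exact isClosed_iUnion_of_finite fun i => isClosed_iUnion_of_finite fun j =>
      isClosed_iUnion_of_finite fun _ => h _ _
  all_goals exact isClosed_iUnion_of_finite fun i => h _ _

theorem prod_const_mul (s : ℂ) (a : Fin 5 → ℂ) : ∏ i, s * a i = s ^ 5 * ∏ i, a i := by
  simp [Finset.prod_mul_distrib]

theorem differentiableOn_leftFactor (hq1 : ‖q‖ < 1) {l : ℂ} {a : Fin 5 → ℂ} (ha : ∀ i, a i ≠ 0)
    {U : Set ℂ} (h0 : ∀ s ∈ U, s ≠ 0) (hpair : ∀ s ∈ U, ∀ j : Fin 4, s * a 0 * (s * a j.succ) ∉ Omega q)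
    (hdiv : ∀ j : Fin 4, a j.succ / a 0 ∉ Omega q) :
    DifferentiableOn ℂ (fun s => leftFactor q (s ^ 5 * l) fun i => s * a i) U := by
  have h0' : ∀ s ∈ U, s * a 0 ≠ 0 := fun s hs => mul_ne_zero (h0 s hs) (ha 0)
  unfold leftFactor
  refine DifferentiableOn.div (((differentiableOn_qPochInf_comp hq1 (by fun_prop)).mul
    (differentiableOn_qPochInf_comp hq1 (DifferentiableOn.div (by fun_prop) (by fun_prop)
      fun s hs => pow_ne_zero 2 (h0' s hs)))).mul
    (differentiableOn_qPochInf_comp hq1 (DifferentiableOn.div (by fun_prop) (by fun_prop) h0')))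
    ((DifferentiableOn.fun_finsetProd fun j _ =>
      differentiableOn_qPochInf_comp hq1 (by fun_prop)).mul
      (DifferentiableOn.fun_finsetProd fun j _ =>
        differentiableOn_qPochInf_comp hq1 (DifferentiableOn.div (by fun_prop) (by fun_prop) h0')))
    fun s hs => mul_ne_zero (Finset.prod_ne_zero_iff.2 fun j _ => qPochInf_ne_zero hq1
      (hpair s hs j)) (Finset.prod_ne_zero_iff.2 fun j _ => qPochInf_ne_zero hq1 ?_)
  rw [mul_div_mul_left _ _ (h0 s hs)]
  exact hdiv j

theorem differentiableOn_tsum_leftTerm (hq : q ≠ 0) (hq1 : ‖q‖ < 1) {l : ℂ} {a : Fin 5 → ℂ}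
    (ha : ∀ i, a i ≠ 0) (hlow : ‖q * l / ∏ i, a i‖ < 1) {U : Set ℂ} (hU : IsOpen U)
    (h0 : ∀ s ∈ U, s ≠ 0)
    (hsq : ∀ s ∈ U, ∀ n : ℕ, 1 - (s * a 0) ^ 2 * q ^ (2 * n) ≠ 0)
    (hmul : ∀ s ∈ U, s ^ 5 * l * (s * a 0) ∉ Omega q)
    (hdiv : ∀ i, i ≠ 0 → a 0 / a i ∉ Omega q) :
    DifferentiableOn ℂ (fun s => ∑' n, leftTerm q (s ^ 5 * l) (fun i => s * a i) n) U := by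
  have hA : ∀ s ∈ U, ∏ i, s * a i ≠ 0 := fun s hs =>
    Finset.prod_ne_zero_iff.2 fun i _ => mul_ne_zero (h0 s hs) (ha i)
  have hdA : DifferentiableOn ℂ (fun s => ∏ i, s * a i) U :=
    DifferentiableOn.fun_finsetProd fun i _ => by fun_prop
  have hd : ∀ i, DifferentiableOn ℂ (fun s => q * (s * a 0) / (s * a i)) U := fun i =>
    DifferentiableOn.div (by fun_prop) (by fun_prop) fun s hs => mul_ne_zero (h0 s hs) (ha i)
  have hdΩ : ∀ s ∈ U, ∀ i, i ≠ 0 → q * (s * a 0) / (s * a i) ∉ Omega q := fun s hs i hi => by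
    rw [mul_div_assoc, mul_div_mul_left _ _ (h0 s hs)]
    exact mul_notMem_Omega hq (hdiv i hi)
  unfold leftTerm
  refine differentiableOn_tsum_vwpTerm hq hq1 hU (by fun_prop) (fun j => by fun_prop) (fun i => ?_)
    (DifferentiableOn.div (by fun_prop) hdA hA) (DifferentiableOn.div (by fun_prop) hdA hA) hsq
    (fun s hs i => ?_) (fun s hs => ?_)
  · fin_cases i
    exacts [hd 1, hd 2, hd 3, hd 4, (by fun_prop : DifferentiableOn ℂ
      (fun s => s ^ 5 * l * (s * a 0)) U)]
  · fin_cases i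
    exacts [hdΩ s hs 1 (by decide), hdΩ s hs 2 (by decide), hdΩ s hs 3 (by decide),
      hdΩ s hs 4 (by decide), hmul s hs]
  -- The argument qλ/A does not change under the scaling.
  · rwa [prod_const_mul, mul_left_comm, mul_div_mul_left _ _ (pow_ne_zero 5 (h0 s hs))]

theorem differentiableOn_leftSide (hq : q ≠ 0) (hq1 : ‖q‖ < 1) {l : ℂ} {a : Fin 5 → ℂ}
    (ha : ∀ i, a i ≠ 0) (hlow : ‖q * l / ∏ i, a i‖ < 1)
    (hdiv : ∀ i j, i ≠ j → a j / a i ∉ Omega q) :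
    DifferentiableOn ℂ (fun s => leftSide q (s ^ 5 * l) fun i => s * a i) (scalingDomain q l a) := by
  unfold leftSide
  refine DifferentiableOn.fun_sum fun k _ => ?_
  have hinj := (Equiv.swap 0 k).injective
  refine DifferentiableOn.mul
    (differentiableOn_leftFactor hq1 (a := a ∘ Equiv.swap 0 k) (fun i => ha _) (fun s hs => hs.1)
      (fun s hs j => hs.2.pair _ _ (hinj.ne (Fin.succ_ne_zero j).symm))
      (fun j => hdiv _ _ (hinj.ne (Fin.succ_ne_zero j).symm)))
    (differentiableOn_tsum_leftTerm hq hq1 (a := a ∘ Equiv.swap 0 k) (fun i => ha _) ?_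
      (isOpen_scalingDomain hq hq1 l a) (fun s hs => hs.1)
      (fun s hs n => one_sub_sq_mul_pow_ne_zero (hs.2.pos _) (hs.2.neg _) n)
      (fun s hs => hs.2.mul _) (fun i hi => hdiv _ _ (hinj.ne hi)))
  rwa [show ∏ i, (a ∘ Equiv.swap 0 k) i = ∏ i, a i from Equiv.prod_comp (Equiv.swap 0 k) a]

theorem differentiableOn_rightSide (hq : q ≠ 0) (hq1 : ‖q‖ < 1) {l : ℂ} (hl : l ≠ 0)
    {a : Fin 5 → ℂ} (ha : ∀ i, a i ≠ 0) (hup : ‖(∏ i, a i) / l‖ < 1) :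
    DifferentiableOn ℂ (fun s => rightSide q (s ^ 5 * l) fun i => s * a i)
      (scalingDomain q l a) := by
  have hdA : DifferentiableOn ℂ (fun s => (∏ i, s * a i) / (s ^ 5 * l)) (scalingDomain q l a) :=
    DifferentiableOn.div (DifferentiableOn.fun_finsetProd fun i _ => by fun_prop) (by fun_prop)
      fun s hs => mul_ne_zero (pow_ne_zero 5 hs.1) hl
  have hd : ∀ i, DifferentiableOn ℂ (fun s => s ^ 5 * l / (s * a i)) (scalingDomain q l a) :=
    fun i => DifferentiableOn.div (by fun_prop) (by fun_prop) fun s hs => mul_ne_zero hs.1 (ha i)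
  unfold rightSide rightTerm
  refine DifferentiableOn.mul (DifferentiableOn.div (DifferentiableOn.const_mul
    (DifferentiableOn.mul (DifferentiableOn.fun_finsetProd fun i _ =>
      differentiableOn_qPochInf_comp hq1 (by fun_prop)) (differentiableOn_qPochInf_comp hq1 hdA)) 2)
    (DifferentiableOn.mul (DifferentiableOn.fun_finsetProd fun i _ =>
      DifferentiableOn.fun_finsetProd fun j _ => differentiableOn_qPochInf_comp hq1 (by fun_prop))
      (differentiableOn_qPochInf_comp hq1 (by fun_prop))) fun s hs => mul_ne_zero
        (Finset.prod_ne_zero_iff.2 fun i _ => Finset.prod_ne_zero_iff.2 fun j hj =>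
          qPochInf_ne_zero hq1 (hs.2.pair i j (Finset.mem_Ioi.1 hj).ne))
        (qPochInf_ne_zero hq1 ?_))
    (differentiableOn_tsum_vwpTerm hq hq1 (isOpen_scalingDomain hq hq1 l a) (by fun_prop)
      (fun i => ?_) (fun i => by fun_prop) (by fun_prop) hdA
      (fun s hs n => one_sub_ne_zero_of_notMem hs.2.sq _) (fun s hs i => hs.2.mul i)
      (fun s hs => ?_))
  · have := mul_notMem_Omega hq hs.2.sq
    rwa [mul_div_cancel₀ _ hq] at this
  · fin_cases i
    exacts [hd 0, hd 1, hd 2, hd 3]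
  · rwa [prod_const_mul, mul_div_mul_left _ _ (pow_ne_zero 5 hs.1)]

/-- For s near 0 all scaled parameters are small and the integral evaluation applies. The invariance
of A/λ and of aⱼ/aᵢ keeps convergence and separation of the poles; s = 1 gives the claim. -/
theorem leftSide_eq_rightSide (hq : q ≠ 0) (hq1 : ‖q‖ < 1) {l : ℂ} (hl : l ≠ 0)
    {a : Fin 5 → ℂ} (ha : ∀ i, a i ≠ 0) (hlow : ‖q * l / ∏ i, a i‖ < 1)
    (hup : ‖(∏ i, a i) / l‖ < 1) (hdiv : ∀ i j, i ≠ j → a j / a i ∉ Omega q)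
    (had : Admissible q l a) : leftSide q l a = rightSide q l a := by
  have hsmall : ∀ᶠ s in 𝓝 (0 : ℂ), (∀ i, ‖s * a i‖ < 1) ∧ ‖(s ^ 5 * l) ^ 2 / q‖ < 1 := by
    refine (eventually_all.2 fun i => ?_).and ?_
    · exact (by fun_prop : Continuous fun s : ℂ => ‖s * a i‖).continuousAt.eventually_lt_const
        (by simp)
    · exact (by fun_prop : Continuous fun s : ℂ => ‖(s ^ 5 * l) ^ 2 / q‖).continuousAt.eventually_lt_const
        (by simp)
  have key := eq_of_scaling (isOpen_scalingDomain hq hq1 l a) (countable_compl_scalingDomain hq hl ha)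
    (differentiableOn_leftSide hq hq1 ha hlow hdiv) (differentiableOn_rightSide hq hq1 hl ha hup)
    ?_ (s := 1) ⟨one_ne_zero, by simpa using had⟩
  · simpa using key
  · filter_upwards [hsmall.filter_mono nhdsWithin_le_nhds, self_mem_nhdsWithin] with s hs hs0
    have hs0 : s ≠ 0 := hs0
    have hs5 := pow_ne_zero 5 hs0
    have hsa : ∀ i, s * a i ≠ 0 := fun i => mul_ne_zero hs0 (ha i)
    refine ⟨⟨hs0, admissible_of_norm_lt hq hq1 hs.1 hs.2⟩, leftSide_eq_rightSide_of_norm_lt hq hq1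
      (mul_ne_zero hs5 hl) hsa hs.1 hs.2 ?_ ?_
      fun i j hij => mul_pow_ne_mul_pow hq (hsa i) (hsa j) ?_ ?_⟩
    · rwa [prod_const_mul, mul_left_comm, mul_div_mul_left _ _ hs5]
    · rwa [prod_const_mul, mul_div_mul_left _ _ hs5]
    · rw [mul_div_mul_left _ _ hs0]
      exact hdiv j i hij.symm
    · rw [mul_div_mul_left _ _ hs0]
      exact hdiv i j hij

end Identity

end

end BasicHyp

/-! ### The theorem for the original series. -/

theorem mainTheorem8 (q l : ℂ) (a : Fin 5 → ℂ)
    (hq0 : q ≠ 0) (hq1 : ‖q‖ < 1) (hl : l ≠ 0) (ha : ∀ i, a i ≠ 0)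
    -- the convergence condition `|q| < |a_1a_2a_3a_4a_5/λ| < 1`
    (hlow : ‖q‖ < ‖(∏ i, a i) / l‖) (hup : ‖(∏ i, a i) / l‖ < 1)
    -- no infinite product in a denominator vanishes
    (haa : ∀ i j, i ≠ j → a i * a j ∉ BasicHyp.Omega q)
    (hdiv : ∀ i j, i ≠ j → a j / a i ∉ BasicHyp.Omega q)
    (hll : l ^ 2 ∉ BasicHyp.Omega q)
    -- no denominator parameter of an `_8W_7` lies in `Ω_q`; given the conditions above this
    -- leaves `±√(a_i²) = ±a_i`, `λ a_i` and `±√(λ²/q)` (the last one only if `λ² = q`)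
    (hpos : ∀ i, a i ∉ BasicHyp.Omega q) (hneg : ∀ i, -a i ∉ BasicHyp.Omega q)
    (hla : ∀ i, l * a i ∉ BasicHyp.Omega q) (hlq : l ^ 2 ≠ q) :
    (∀ k : Fin 5, Summable (BasicHyp.WTerm ((a ∘ Equiv.swap 0 k) 0 ^ 2)
        (BasicHyp.leftParams l q (a ∘ Equiv.swap 0 k)) q (q * l / ∏ i, a i))) ∧
    Summable (BasicHyp.WTerm (l ^ 2 / q) (BasicHyp.rightParams l a) q ((∏ i, a i) / l)) ∧
    BasicHyp.symSum (BasicHyp.leftSummand l q) a =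
      2 * ((∏ i, BasicHyp.qPochInf (l * a i) q) * BasicHyp.qPochInf ((∏ i, a i) / l) q) /
          ((∏ i, ∏ j ∈ Finset.Ioi i, BasicHyp.qPochInf (a i * a j) q) *
            BasicHyp.qPochInf (l ^ 2) q) *
        BasicHyp.W (l ^ 2 / q) (BasicHyp.rightParams l a) q ((∏ i, a i) / l) := by
  have hlow' : ‖q * l / ∏ i, a i‖ < 1 := by
    have h0 : 0 < ‖(∏ i, a i) / l‖ := (norm_nonneg q).trans_lt hlow
    rw [show q * l / ∏ i, a i = q / ((∏ i, a i) / l) by rw [div_div_eq_mul_div], norm_div]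
    exact (div_lt_one h0).2 hlow
  have hsq : l ^ 2 / q ∉ BasicHyp.Omega q := BasicHyp.div_notMem_Omega hq0 hll hlq
  have hbl : ∀ k n, 1 - (a ∘ Equiv.swap 0 k) 0 ^ 2 * q ^ (2 * n) ≠ 0 := fun k =>
    BasicHyp.one_sub_sq_mul_pow_ne_zero (hpos _) (hneg _)
  have hbr : ∀ n : ℕ, 1 - l ^ 2 / q * q ^ (2 * n) ≠ 0 := fun n =>
    BasicHyp.one_sub_ne_zero_of_notMem hsq _
  have hprod : ∀ k, ∏ i, (a ∘ Equiv.swap 0 k) i = ∏ i, a i := fun k =>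
    Equiv.prod_comp (Equiv.swap 0 k) a
  have hleft : ∀ k, BasicHyp.WTerm ((a ∘ Equiv.swap 0 k) 0 ^ 2)
      (BasicHyp.leftParams l q (a ∘ Equiv.swap 0 k)) q (q * l / ∏ i, a i) =
        BasicHyp.leftTerm q l (a ∘ Equiv.swap 0 k) := fun k => funext fun n => by
    rw [← hprod k]
    exact BasicHyp.WTerm_leftParams hq0 hl (fun i => ha _) (hbl k) n
  have hright : BasicHyp.WTerm (l ^ 2 / q) (BasicHyp.rightParams l a) q ((∏ i, a i) / l) =
      BasicHyp.rightTerm q l a := funext fun n => BasicHyp.WTerm_rightParams hq0 hl ha hbr n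
  refine ⟨fun k => ?_, ?_, ?_⟩
  · rw [hleft]
    exact BasicHyp.summable_leftTerm hq1 (hbl k) (by rwa [hprod])
  · rw [hright]
    exact BasicHyp.summable_vwpTerm hq1 hbr _ _ _ hup
  · have key := BasicHyp.leftSide_eq_rightSide hq0 hq1 hl ha hlow' hup hdiv
      ⟨haa, hpos, hneg, hla, hsq⟩
    rw [BasicHyp.W, hright]
    refine Eq.trans (Finset.sum_congr rfl fun k _ => ?_) key
    rw [BasicHyp.leftSummand, BasicHyp.W, hprod, hleft]
    rfl
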